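/- Let $n\ge 1$. A cube is a bounded cube $Q\subset\mathbb R^n$ of positive edge length with edges parallel to the axes (open, closed or neither). Let $p:\mathbb R^n\to(0,\infty)$ be measurable with $p_-:=\operatorname{ess\,inf}p>0$ and $p_+:=\operatorname{ess\,sup}p$, and suppose that $p$ is globally log-Hölder continuous: there are positive constants $C_0,p_\infty,C_\infty$ such that $|p(x)-p(y)|\le -C_0/\log|x-y|$ whenever $0<|x-y|<\frac12$, and $|p(x)-p_\infty|\le C_\infty/\log(e+|x|)$ for all $x$. For measurable $f$ and an exponent $q(\cdot)$ put $$\|f\|_{L^{q(\cdot)}}:=\inf\Big\{\lambda>0:\int_{\mathbb R^n}\Big|\frac{f(x)}{\lambda}\Big|^{q(x)}dx\le1\Big\}\in[0,\infty].$$ A weight is a nonnegative measurable function $w$ on $\mathbb R^n$ that is positive almost everywhere, and $w\in\mathcal A_{p(\cdot),\infty}$ means that $$[w]_{\mathcal A_{p(\cdot),\infty}}:=\sup_Q\frac{\|w\mathbf 1_Q\|_{L^{p(\cdot)}}}{\|\mathbf 1_Q\|_{L^{p(\cdot)}}}\exp\Big(\frac1{|Q|}\int_Q\log(w^{-1}(y))\,dy\Big)<\infty,$$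 the supremum being over all cubes $Q$ (the exponential is read as $\infty$ when $\log (w^{-1})\notin L^1(Q)$). Then there are positive constants $C,C_1,C_2,A,A_1$, depending only on $n,p_-,p_+,p_\infty,C_0,C_\infty$, such that for every $w\in\mathcal A_{p(\cdot),\infty}$, every $r\in(1,r_w]$ with $$r_w:=1+\frac{1}{C_1\,[w]_{\mathcal A_{p(\cdot),\infty}}^{A_1}\,2^{C_2[w]_{\mathcal A_{p(\cdot),\infty}}}},$$ and every cube $Q$, $$\frac{\|w\mathbf 1_Q\|_{L^{rp(\cdot)}}}{\|\mathbf 1_Q\|_{L^{rp(\cdot)}}}\le C\,[w]_{\mathcal A_{p(\cdot),\infty}}^{A}\,\frac{\|w\mathbf 1_Q\|_{L^{p(\cdot)}}}{\|\mathbf 1_Q\|_{L^{p(\cdot)}}}.$$ -/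

import Mathlib

open MeasureTheory Set
open scoped ENNReal

/-- Cubes of `ℝⁿ` with edges parallel to the coordinate axes and edge length `l ∈ (0,∞)`: products
of `n` bounded intervals of the same length `l`, each of which may or may not contain either of its
end points (a set between `(a, a + l)` and `[a, a + l]` is one of the four such intervals). -/
def IsCube {n : ℕ} (Q : Set (EuclideanSpace ℝ (Fin n))) : Prop :=
  ∃ (a : Fin n → ℝ) (l : ℝ) (I : Fin n → Set ℝ), 0 < l ∧
    (∀ i, Ioo (a i) (a i + l) ⊆ I i ∧ I i ⊆ Icc (a i) (a i + l)) ∧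
    Q = {x | ∀ i, x i ∈ I i}

/-- The class `𝒫₀` (finite exponents): measurable `p : ℝⁿ → (0,∞)` with `ess inf p > 0`.
Infinite values of `p` are excluded by log-Hölder continuity, which is about real functions. -/
structure IsExponentP0 {n : ℕ} (p : EuclideanSpace ℝ (Fin n) → ℝ) : Prop where
  measurable : Measurable p
  pos : ∀ x, 0 < p x
  essInf_pos : 0 < essInf p volume

/-- Global log-Hölder continuity of `p`, with local constant `C₀`, limit value `pinf` and
constant at infinity `Cinf`. For `x = y` the first condition reads `0 ≤ 0`. -/
structure IsLogHolder {n : ℕ} (p : EuclideanSpace ℝ (Fin n) → ℝ) (C₀ pinf Cinf : ℝ) : Prop where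
  C₀_pos : 0 < C₀
  pinf_pos : 0 < pinf
  Cinf_pos : 0 < Cinf
  loc : ∀ x y, ‖x - y‖ < 1 / 2 → |p x - p y| ≤ -C₀ / Real.log ‖x - y‖
  infty : ∀ x, |p x - pinf| ≤ Cinf / Real.log (Real.exp 1 + ‖x‖)

/-- The modular `ρ_{L^{p(·)}}(f) = ∫ |f(x)|^{p(x)} dx ∈ [0,∞]`. -/
noncomputable def varModular {n : ℕ} (p f : EuclideanSpace ℝ (Fin n) → ℝ) : ℝ≥0∞ :=
  ∫⁻ x, ENNReal.ofReal (|f x| ^ p x)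

/-- The (quasi-)norm `‖f‖_{L^{p(·)}} = inf {t ∈ (0,∞) : ρ(f / t) ≤ 1}`, with value in `[0,∞]`
(the infimum of the empty set is `∞`). -/
noncomputable def varNorm {n : ℕ} (p f : EuclideanSpace ℝ (Fin n) → ℝ) : ℝ≥0∞ :=
  ⨅ (t : ℝ) (_ : 0 < t) (_ : varModular p (fun x => f x / t) ≤ 1), ENNReal.ofReal t

/-- The normalized local norm `‖w 1_Q‖_{L^{p(·)}} / ‖1_Q‖_{L^{p(·)}}`. -/
noncomputable def varAverage {n : ℕ} (p w : EuclideanSpace ℝ (Fin n) → ℝ)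
    (Q : Set (EuclideanSpace ℝ (Fin n))) : ℝ≥0∞ :=
  varNorm p (Q.indicator w) / varNorm p (Q.indicator fun _ => 1)

/-- Scalar weights: nonnegative measurable functions that are positive almost everywhere. -/
structure IsWeight {n : ℕ} (w : EuclideanSpace ℝ (Fin n) → ℝ) : Prop where
  measurable : Measurable w
  nonneg : ∀ x, 0 ≤ w x
  pos_ae : ∀ᵐ x, 0 < w x

open Classical in
/-- `exp (⨍_Q log (w⁻¹))`, with value `∞` if `log (w⁻¹)` is not integrable on `Q`. For a weight with
`‖w 1_Q‖_{L^{p(·)}} < ∞` the positive part of `log w` is integrable on `Q`, so that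
non-integrability of `log (w⁻¹)` means that its mean over `Q` is `+∞`. -/
noncomputable def expMeanLogInv {n : ℕ} (w : EuclideanSpace ℝ (Fin n) → ℝ)
    (Q : Set (EuclideanSpace ℝ (Fin n))) : ℝ≥0∞ :=
  if IntegrableOn (fun y => Real.log (w y)⁻¹) Q volume then
    ENNReal.ofReal (Real.exp (⨍ y in Q, Real.log (w y)⁻¹))
  else ∞

/-- The weight constant `[w]_{𝒜_{p(·),∞}} ∈ [0,∞]`: the supremum over all cubes `Q` of
`‖w 1_Q‖_{L^{p(·)}} / ‖1_Q‖_{L^{p(·)}} * exp (⨍_Q log (w⁻¹))`. -/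
noncomputable def apInftyConst {n : ℕ} (p w : EuclideanSpace ℝ (Fin n) → ℝ) : ℝ≥0∞ :=
  ⨆ (Q : Set (EuclideanSpace ℝ (Fin n))) (_ : IsCube Q), varAverage p w Q * expMeanLogInv w Q

/-- The class `𝒜_{p(·),∞}`. -/
structure IsApInfty {n : ℕ} (p w : EuclideanSpace ℝ (Fin n) → ℝ) : Prop where
  isWeight : IsWeight w
  const_lt_top : apInftyConst p w < ∞

/-! A reverse Jensen inequality log x ≤ y + k on all dyadic subcubes, where x is the mean of a
weight and y the mean of its logarithm, already forces a reverse Hölder inequality with gain δ ≈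
e^(-2k). The tool is the Bellman function 2x^(1+δ) - e^(2y) x^(δ-1). Where log x ≤ y + k it lies
below a plane touching it at (x, y), at least for jumps to dyadic children, because the strict
concavity of the logarithm beats the convexity of x^(1+δ) (`bellman_le_affine`). Averaging over
children therefore does not increase it. It dominates x^(1+δ) at the leaves and is at most 2x^(1+δ)
at the root; this gives `childAvg_pow_rpow_le`, which is stated for functions of cubes because it is
used at two different scales.

Cubes of edge at most 2: log-Hölder continuity makes ‖1_Q‖^(-p(x)) comparable to 1/|Q|. For w
normalised on a cube, 1 + w^p satisfies reverse Jensen on all subcubes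
(`WeightBounds.log_boxMean_le`). Where the local average of w exceeds 1 it is at most a power of the
inverse edge length, so its variable power is almost constant; where it is at most 1, the summand 1
takes over. Dyadic differentiation and Fatou's lemma turn the bound on averages into one on
integrals.

Larger cubes are cut into blocks of edge in [1, 2]. Decay at infinity allows p(x) to be replaced by
`pinf` for numbers in [0, 1], up to an error of total mass at most 1/2 (`exists_rpow_comparison`),
so N(c)^pinf is comparable to the sum of N(b)^pinf over the blocks b. Block norms thus inherit
reverse Jensen from the weight condition, the Bellman lemma applies to the tree above the blocks,
and the small-cube inequality applies inside each block (`WeightBounds.setIntegral_rpow_mul_le`).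

With κ = log [w] and P an upper bound of p, the constant k is at most Pκ plus a constant. The
admissible gain is therefore a constant times [w]^(-2P), polynomial in [w], and the factor 2^(C₂[w])
in r_w is used only through being at least 1. -/

/-! ### Half-open cubes, dyadic children, averages over the dyadic tree -/

/-- The half-open cube with corner `c.1` and edge length `c.2`. -/
def boxSet {n : ℕ} (c : (Fin n → ℝ) × ℝ) : Set (EuclideanSpace ℝ (Fin n)) :=
  {x | ∀ i, x i ∈ Ico (c.1 i) (c.1 i + c.2)}

/-- The dyadic children of a cube. -/
noncomputable def child {n : ℕ} (c : (Fin n → ℝ) × ℝ) (ε : Fin n → Bool) : (Fin n → ℝ) × ℝ :=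
  (fun i => c.1 i + if ε i then c.2 / 2 else 0, c.2 / 2)

/-- The index of the child of `c` that contains the point `x` of the cube. -/
noncomputable def childIndex {n : ℕ} (c : (Fin n → ℝ) × ℝ) (x : EuclideanSpace ℝ (Fin n)) :
    Fin n → Bool :=
  fun i => decide (c.1 i + c.2 / 2 ≤ x i)

@[simp] lemma child_snd {n : ℕ} (c : (Fin n → ℝ) × ℝ) (ε : Fin n → Bool) :
    (child c ε).2 = c.2 / 2 := rfl

lemma mem_boxSet_child_iff {n : ℕ} {c : (Fin n → ℝ) × ℝ} (hc : 0 < c.2) {ε : Fin n → Bool}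
    {x : EuclideanSpace ℝ (Fin n)} :
    x ∈ boxSet (child c ε) ↔ x ∈ boxSet c ∧ childIndex c x = ε := by
  simp only [boxSet, child, childIndex, Set.mem_ofPred_eq, mem_Ico, funext_iff, ← forall_and]
  refine forall_congr' fun i => ?_
  cases h : ε i <;> simp only [Bool.false_eq_true, if_true, if_false, add_zero,
    decide_eq_false_iff_not, decide_eq_true_eq, not_le] <;> constructor <;> rintro ⟨h1, h2⟩
  · exact ⟨⟨h1, by linarith⟩, h2⟩
  · exact ⟨h1.1, h2⟩
  · exact ⟨⟨by linarith, by linarith⟩, h1⟩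
  · exact ⟨h2, by linarith [h1.2]⟩

lemma boxSet_child_subset {n : ℕ} {c : (Fin n → ℝ) × ℝ} (hc : 0 < c.2) (ε : Fin n → Bool) :
    boxSet (child c ε) ⊆ boxSet c := fun _ hx => ((mem_boxSet_child_iff hc).1 hx).1

lemma boxSet_eq_iUnion_child {n : ℕ} {c : (Fin n → ℝ) × ℝ} (hc : 0 < c.2) :
    boxSet c = ⋃ ε, boxSet (child c ε) := by
  ext x
  simp [mem_boxSet_child_iff hc]

lemma disjoint_boxSet_child {n : ℕ} {c : (Fin n → ℝ) × ℝ} (hc : 0 < c.2) :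
    Pairwise fun ε ε' => Disjoint (boxSet (child c ε)) (boxSet (child c ε')) := by
  intro ε ε' h
  rw [Set.disjoint_left]
  intro x hx hx'
  exact h (((mem_boxSet_child_iff hc).1 hx).2.symm.trans ((mem_boxSet_child_iff hc).1 hx').2)

lemma boxSet_eq_preimage {n : ℕ} (c : (Fin n → ℝ) × ℝ) :
    boxSet c = (MeasurableEquiv.toLp 2 (Fin n → ℝ)).symm ⁻¹'
      (Set.univ.pi fun i => Ico (c.1 i) (c.1 i + c.2)) := by
  ext x
  simp [boxSet]

@[measurability] lemma measurableSet_boxSet {n : ℕ} (c : (Fin n → ℝ) × ℝ) :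
    MeasurableSet (boxSet c) := by
  rw [boxSet_eq_preimage]
  exact (MeasurableEquiv.toLp 2 (Fin n → ℝ)).symm.measurable
    (MeasurableSet.univ_pi fun i => measurableSet_Ico)

lemma volume_boxSet {n : ℕ} (c : (Fin n → ℝ) × ℝ) (hc : 0 < c.2) :
    volume (boxSet c) = ENNReal.ofReal (c.2 ^ n) := by
  rw [boxSet_eq_preimage, (EuclideanSpace.volume_preserving_symm_measurableEquiv_toLp
    (Fin n)).measure_preimage (MeasurableSet.univ_pi fun i => measurableSet_Ico).nullMeasurableSet,
    volume_pi, Measure.pi_pi]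
  simp [ENNReal.ofReal_pow hc.le]

lemma volume_real_boxSet {n : ℕ} (c : (Fin n → ℝ) × ℝ) (hc : 0 < c.2) :
    volume.real (boxSet c) = c.2 ^ n := by
  rw [Measure.real, volume_boxSet c hc, ENNReal.toReal_ofReal (by positivity)]

lemma volume_boxSet_lt_top {n : ℕ} (c : (Fin n → ℝ) × ℝ) (hc : 0 < c.2) :
    volume (boxSet c) < ∞ := by
  rw [volume_boxSet c hc]; exact ENNReal.ofReal_lt_top

lemma norm_sub_le_of_mem_boxSet {n : ℕ} {c : (Fin n → ℝ) × ℝ} (hc : 0 < c.2)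
    {x y : EuclideanSpace ℝ (Fin n)} (hx : x ∈ boxSet c) (hy : y ∈ boxSet c) :
    ‖x - y‖ ≤ √n * c.2 := by
  rw [EuclideanSpace.norm_eq, ← Real.sqrt_sq hc.le, ← Real.sqrt_mul (by positivity)]
  apply Real.sqrt_le_sqrt
  calc ∑ i, ‖(x - y) i‖ ^ 2 ≤ ∑ _i : Fin n, c.2 ^ 2 := by
        refine Finset.sum_le_sum fun i _ => ?_
        have h1 := hx i
        have h2 := hy i
        simp only [mem_Ico] at h1 h2
        rw [Real.norm_eq_abs, sq_abs, PiLp.sub_apply]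
        exact sq_le_sq' (by linarith) (by linarith)
    _ = n * c.2 ^ 2 := by simp

/-- Averaging of a function of cubes over the dyadic children. -/
noncomputable def childAvg (n : ℕ) : ((Fin n → ℝ) × ℝ → ℝ) →ₗ[ℝ] ((Fin n → ℝ) × ℝ → ℝ) where
  toFun f c := (2 ^ n : ℝ)⁻¹ * ∑ ε, f (child c ε)
  map_add' f g := by
    ext c
    simp [Finset.sum_add_distrib, mul_add]
  map_smul' r f := by
    ext c
    simp only [Pi.smul_apply, smul_eq_mul, RingHom.id_apply, ← Finset.mul_sum]
    ring

lemma childAvg_apply {n : ℕ} (f : (Fin n → ℝ) × ℝ → ℝ) (c : (Fin n → ℝ) × ℝ) :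
    childAvg n f c = (2 ^ n : ℝ)⁻¹ * ∑ ε, f (child c ε) := rfl

lemma childAvg_pow_succ_apply {n : ℕ} (m : ℕ) (f : (Fin n → ℝ) × ℝ → ℝ) (c : (Fin n → ℝ) × ℝ) :
    (childAvg n ^ (m + 1)) f c = (2 ^ n : ℝ)⁻¹ * ∑ ε, (childAvg n ^ m) f (child c ε) := by
  rw [pow_succ', Module.End.mul_apply, childAvg_apply]

lemma childAvg_const {n : ℕ} (r : ℝ) : childAvg n (fun _ => r) = fun _ => r := by
  ext c
  simp [childAvg_apply]

lemma childAvg_pow_const {n : ℕ} (m : ℕ) (r : ℝ) : (childAvg n ^ m) (fun _ => r) = fun _ => r := by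
  rw [Module.End.pow_apply]
  exact Function.iterate_fixed (childAvg_const r) m

/-- Monotonicity of iterated averages along a family of cubes that is stable under taking
children. -/
lemma childAvg_pow_mono {n : ℕ} {V : ℕ → (Fin n → ℝ) × ℝ → Prop}
    (hV : ∀ j c, V (j + 1) c → ∀ ε, V j (child c ε)) {f g : (Fin n → ℝ) × ℝ → ℝ}
    (hfg : ∀ c, V 0 c → f c ≤ g c) (m : ℕ) (c : (Fin n → ℝ) × ℝ) (hc : V m c) :
    (childAvg n ^ m) f c ≤ (childAvg n ^ m) g c := by
  induction m generalizing c with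
  | zero => simpa using hfg c hc
  | succ m ih =>
    rw [childAvg_pow_succ_apply, childAvg_pow_succ_apply]
    gcongr with ε
    exact ih _ (hV m c hc ε)

/-- The mean of a function over a half-open cube. -/
noncomputable def boxMean {n : ℕ} (F : EuclideanSpace ℝ (Fin n) → ℝ) (c : (Fin n → ℝ) × ℝ) : ℝ :=
  (c.2 ^ n)⁻¹ * ∫ x in boxSet c, F x

lemma boxMean_eq_average {n : ℕ} (F : EuclideanSpace ℝ (Fin n) → ℝ) {c : (Fin n → ℝ) × ℝ}
    (hc : 0 < c.2) : boxMean F c = ⨍ x in boxSet c, F x := by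
  rw [setAverage_eq, volume_real_boxSet c hc, boxMean, smul_eq_mul]

lemma setIntegral_eq_boxMean {n : ℕ} (F : EuclideanSpace ℝ (Fin n) → ℝ) {c : (Fin n → ℝ) × ℝ}
    (hc : 0 < c.2) : ∫ x in boxSet c, F x = c.2 ^ n * boxMean F c := by
  rw [boxMean, mul_inv_cancel_left₀ (by positivity)]

lemma childAvg_boxMean {n : ℕ} (F : EuclideanSpace ℝ (Fin n) → ℝ) {c : (Fin n → ℝ) × ℝ}
    (hc : 0 < c.2) (hF : IntegrableOn F (boxSet c)) : childAvg n (boxMean F) c = boxMean F c := by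
  have h : ∫ x in boxSet c, F x = ∑ ε, ∫ x in boxSet (child c ε), F x := by
    rw [boxSet_eq_iUnion_child hc]
    exact integral_iUnion_fintype (fun ε => measurableSet_boxSet _) (disjoint_boxSet_child hc)
      fun ε => hF.mono_set (boxSet_child_subset hc ε)
  simp only [childAvg_apply, boxMean, h, child_snd, ← Finset.mul_sum, div_pow]
  field_simp

/-- Means form a martingale along the dyadic tree. This is what turns averages of leaf values back
into integrals over the root cube. -/
lemma childAvg_pow_boxMean {n : ℕ} (F : EuclideanSpace ℝ (Fin n) → ℝ) (m : ℕ)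
    {c : (Fin n → ℝ) × ℝ} (hc : 0 < c.2) (hF : IntegrableOn F (boxSet c)) :
    (childAvg n ^ m) (boxMean F) c = boxMean F c := by
  induction m generalizing c with
  | zero => simp
  | succ m ih =>
    rw [childAvg_pow_succ_apply, ← childAvg_boxMean F hc hF, childAvg_apply]
    congr 1
    exact Finset.sum_congr rfl fun ε _ =>
      ih (half_pos hc) (hF.mono_set (boxSet_child_subset hc ε))

lemma boxMean_mono {n : ℕ} {F G : EuclideanSpace ℝ (Fin n) → ℝ} {c : (Fin n → ℝ) × ℝ}
    (hc : 0 < c.2) (hF : IntegrableOn F (boxSet c)) (hG : IntegrableOn G (boxSet c))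
    (h : ∀ᵐ x, x ∈ boxSet c → F x ≤ G x) : boxMean F c ≤ boxMean G c := by
  exact mul_le_mul_of_nonneg_left (setIntegral_mono_on_ae hF hG (measurableSet_boxSet c) h)
    (by positivity)

lemma boxMean_add {n : ℕ} {F G : EuclideanSpace ℝ (Fin n) → ℝ} {c : (Fin n → ℝ) × ℝ}
    (hF : IntegrableOn F (boxSet c)) (hG : IntegrableOn G (boxSet c)) :
    boxMean (fun x => F x + G x) c = boxMean F c + boxMean G c := by
  simp only [boxMean, integral_add hF hG, mul_add]

lemma boxMean_sub {n : ℕ} {F G : EuclideanSpace ℝ (Fin n) → ℝ} {c : (Fin n → ℝ) × ℝ}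
    (hF : IntegrableOn F (boxSet c)) (hG : IntegrableOn G (boxSet c)) :
    boxMean (fun x => F x - G x) c = boxMean F c - boxMean G c := by
  simp only [boxMean, integral_sub hF hG, mul_sub]

lemma boxMean_const_mul {n : ℕ} (F : EuclideanSpace ℝ (Fin n) → ℝ) (c : (Fin n → ℝ) × ℝ) (r : ℝ) :
    boxMean (fun x => r * F x) c = r * boxMean F c := by
  simp only [boxMean, integral_const_mul]; ring

lemma boxMean_const {n : ℕ} {c : (Fin n → ℝ) × ℝ} (hc : 0 < c.2) (r : ℝ) :
    boxMean (fun _ => r) c = r := by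
  simp only [boxMean, setIntegral_const, volume_real_boxSet c hc, smul_eq_mul]
  rw [inv_mul_cancel_left₀ (by positivity)]

lemma integrableOn_boxSet_const {n : ℕ} {c : (Fin n → ℝ) × ℝ} (hc : 0 < c.2) (r : ℝ) :
    IntegrableOn (fun _ => r) (boxSet c) :=
  integrableOn_const (volume_boxSet_lt_top c hc).ne

/-- Integrability on small cubes implies integrability on all cubes. -/
lemma integrableOn_boxSet_of_le {n : ℕ} {F : EuclideanSpace ℝ (Fin n) → ℝ} {L : ℝ} (hL : 0 < L)
    (h : ∀ c : (Fin n → ℝ) × ℝ, 0 < c.2 → c.2 ≤ L → IntegrableOn F (boxSet c))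
    {c : (Fin n → ℝ) × ℝ} (hc : 0 < c.2) : IntegrableOn F (boxSet c) := by
  obtain ⟨m, hm⟩ := pow_unbounded_of_one_lt (c.2 / L) one_lt_two
  rw [div_lt_iff₀ hL] at hm
  induction m generalizing c with
  | zero => exact h c hc (by simpa using hm.le)
  | succ m ih =>
    rw [boxSet_eq_iUnion_child hc, integrableOn_finite_iUnion]
    refine fun ε => ih (half_pos hc) ?_
    rw [child_snd, div_lt_iff₀ two_pos]
    rw [pow_succ] at hm
    linarith

/-! ### The Bellman function and the dyadic reverse Hölder inequality -/

/-- A Bellman function for the reverse Hölder inequality: `x` stands for the mean of a weight and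
`y` for the mean of its logarithm. -/
noncomputable def bellman (δ x y : ℝ) : ℝ := 2 * x ^ (1 + δ) - Real.exp (2 * y) * x ^ (δ - 1)

/-- Bernoulli's inequality for t^δ, multiplied by t. The quadratic term carries the factor δ, so
that a small δ makes it absorbable. -/
lemma rpow_one_add_le_quadratic {t δ : ℝ} (ht : 0 < t) (h0 : 0 ≤ δ) (h1 : δ ≤ 1) :
    t ^ (1 + δ) ≤ 1 + (1 + δ) * (t - 1) + δ * (t - 1) ^ 2 := by
  have h := rpow_one_add_le_one_add_mul_self (s := t - 1) (by linarith) h0 h1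
  rw [add_sub_cancel] at h
  rw [Real.rpow_add ht, Real.rpow_one]
  calc t * t ^ δ ≤ t * (1 + δ * (t - 1)) := by gcongr
    _ = _ := by ring

/-- The bound log u ≤ u - 1 at u = √t gives t - 1 - log t ≥ (√t - 1)², while (t - 1)² = (√t - 1)²(√t
+ 1)² and (√t + 1)² ≤ 4M. -/
lemma quadratic_le_sub_one_sub_log {t M : ℝ} (ht : 0 < t) (htM : t ≤ M) (hM : 1 ≤ M) :
    (t - 1) ^ 2 / (4 * M) ≤ t - 1 - Real.log t := by
  have hs := Real.sqrt_pos.2 ht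
  have hsq := Real.sq_sqrt ht.le
  have h1 : Real.log t ≤ 2 * (√t - 1) := by
    have := Real.log_le_sub_one_of_pos hs
    rw [Real.log_sqrt ht.le] at this
    linarith
  have h2 : (t - 1) ^ 2 = (√t - 1) ^ 2 * (√t + 1) ^ 2 := by
    nth_rewrite 1 [← hsq]; ring
  have h3 : (√t + 1) ^ 2 ≤ 4 * M := by nlinarith [sq_nonneg (√t - 1)]
  rw [div_le_iff₀ (by linarith), h2]
  calc (√t - 1) ^ 2 * (√t + 1) ^ 2 ≤ (√t - 1) ^ 2 * (4 * M) := by gcongr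
    _ = (t - 2 * √t + 1) * (4 * M) := by nth_rewrite 2 [← hsq]; ring
    _ ≤ _ := by gcongr; linarith

/-- The Bellman function lies below an affine function that touches it at `(x, y)`. -/
lemma bellman_le_affine {x y x' y' k M δ : ℝ} (hx : 0 < x) (hx' : 0 < x') (hM : 1 ≤ M)
    (hxM : x' ≤ M * x) (hk : Real.log x ≤ y + k) (h0 : 0 ≤ δ) (h1 : δ ≤ 1 / 2)
    (hδ : 16 * M * δ * Real.exp (2 * k) ≤ 1) :
    bellman δ x' y' ≤ x ^ (1 + δ) * (2 - Real.exp (2 * (y - Real.log x)) +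
      (2 * (1 + δ) + Real.exp (2 * (y - Real.log x)) * (1 - δ)) * (x' / x - 1) -
      2 * Real.exp (2 * (y - Real.log x)) * (y' - y)) := by
  set E := Real.exp (2 * (y - Real.log x)) with hE
  have hE0 : 0 < E := Real.exp_pos _
  set t := x' / x with ht
  have ht0 : 0 < t := div_pos hx' hx
  have hx't : x' = x * t := by rw [ht]; field_simp
  have htM : t ≤ M := by rw [ht, div_le_iff₀ hx]; exact hxM
  have hEk : 16 * M * δ ≤ E := by
    have h2 : Real.exp (-(2 * k)) ≤ E := Real.exp_le_exp.2 (by linarith)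
    have h3 : 16 * M * δ ≤ Real.exp (-(2 * k)) := by
      rw [Real.exp_neg, ← one_div, le_div_iff₀ (Real.exp_pos _)]; exact hδ
    exact h3.trans h2
  have hB : bellman δ x' y' = x ^ (1 + δ) *
      (2 * t ^ (1 + δ) - E * Real.exp (2 * (y' - y) - (1 - δ) * Real.log t)) := by
    rw [bellman, hx't, Real.mul_rpow hx.le ht0.le, mul_sub]
    congr 1
    · ring
    · rw [Real.rpow_def_of_pos (mul_pos hx ht0), Real.rpow_def_of_pos hx, hE, ← Real.exp_add,
        ← Real.exp_add, ← Real.exp_add, Real.log_mul hx.ne' ht0.ne']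
      congr 1; ring
  rw [hB]
  refine mul_le_mul_of_nonneg_left ?_ (by positivity)
  have e1 := rpow_one_add_le_quadratic ht0 h0 (by linarith)
  have e2 := Real.add_one_le_exp (2 * (y' - y) - (1 - δ) * Real.log t)
  have e3 := quadratic_le_sub_one_sub_log ht0 htM hM
  -- The quadratic error of 2t^(1+δ) is absorbed by the second-order gain of the logarithm: 1 - δ ≥
  -- 1/2 and E ≥ 16Mδ are exactly enough.
  have e4 : 2 * δ * (t - 1) ^ 2 ≤ E * ((1 - δ) * ((t - 1) ^ 2 / (4 * M))) := by
    have : 2 * δ * (t - 1) ^ 2 = (16 * M * δ) * ((1 / 2) * ((t - 1) ^ 2 / (4 * M))) := by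
      field_simp; ring
    rw [this]
    gcongr
    linarith
  have e5 : (1 - δ) * ((t - 1) ^ 2 / (4 * M)) ≤ (1 - δ) * (t - 1 - Real.log t) := by
    gcongr; linarith
  have e6 := mul_le_mul_of_nonneg_left e5 hE0.le
  have e7 := mul_le_mul_of_nonneg_left e2 hE0.le
  linarith

/-- The dyadic reverse Hölder inequality for a weight with leaf means `f`, whose logarithm has
leaf means `g`. -/
theorem childAvg_pow_rpow_le {n : ℕ} {k δ : ℝ} (h0 : 0 ≤ δ) (h1 : δ ≤ 1 / 2)
    (hδ : 16 * 2 ^ n * δ * Real.exp (2 * k) ≤ 1) {V : ℕ → (Fin n → ℝ) × ℝ → Prop}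
    (hV : ∀ j c, V (j + 1) c → ∀ ε, V j (child c ε)) {f g : (Fin n → ℝ) × ℝ → ℝ}
    (hf : ∀ c, V 0 c → 0 < f c) (hgf : ∀ c, V 0 c → g c ≤ Real.log (f c))
    (hk : ∀ j c, V j c → Real.log ((childAvg n ^ j) f c) ≤ (childAvg n ^ j) g c + k)
    (m : ℕ) (c : (Fin n → ℝ) × ℝ) (hc : V m c) :
    (childAvg n ^ m) (fun c => f c ^ (1 + δ)) c ≤ 2 * (childAvg n ^ m) f c ^ (1 + δ) := by
  have hpos : ∀ (m : ℕ) (c : (Fin n → ℝ) × ℝ), V m c → 0 < (childAvg n ^ m) f c := by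
    intro m
    induction m with
    | zero => intro c hc; simpa using hf c hc
    | succ m ih =>
      intro c hc
      rw [childAvg_pow_succ_apply]
      have := Finset.sum_pos (fun ε _ => ih _ (hV m c hc ε)) (s := Finset.univ)
        Finset.univ_nonempty
      positivity
  have key : ∀ (m : ℕ) (c : (Fin n → ℝ) × ℝ), V m c →
      (childAvg n ^ m) (fun c => f c ^ (1 + δ)) c ≤
        bellman δ ((childAvg n ^ m) f c) ((childAvg n ^ m) g c) := by
    intro m
    induction m with
    | zero =>
      intro c hc
      have hfc := hf c hc
      -- At a leaf y ≤ log x, so the subtracted term of the Bellman function removes at most half of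
      -- 2x^(1+δ).
      have h : Real.exp (2 * g c) * f c ^ (δ - 1) ≤ f c ^ (1 + δ) := by
        rw [Real.rpow_def_of_pos hfc, Real.rpow_def_of_pos hfc, ← Real.exp_add, Real.exp_le_exp]
        linarith [hgf c hc]
      simp only [pow_zero, Module.End.one_apply, bellman]
      linarith
    | succ m ih =>
      intro c hc
      set x := (childAvg n ^ (m + 1)) f c with hx
      set y := (childAvg n ^ (m + 1)) g c with hy
      have hx0 : 0 < x := hpos _ _ hc
      have hxs : x = (2 ^ n : ℝ)⁻¹ * ∑ ε, (childAvg n ^ m) f (child c ε) :=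
        childAvg_pow_succ_apply m f c
      have hys : y = (2 ^ n : ℝ)⁻¹ * ∑ ε, (childAvg n ^ m) g (child c ε) :=
        childAvg_pow_succ_apply m g c
      rw [childAvg_pow_succ_apply]
      set E := Real.exp (2 * (y - Real.log x)) with hE
      calc (2 ^ n : ℝ)⁻¹ * ∑ ε, (childAvg n ^ m) (fun c => f c ^ (1 + δ)) (child c ε)
          ≤ (2 ^ n : ℝ)⁻¹ * ∑ ε, x ^ (1 + δ) * (2 - E +
              (2 * (1 + δ) + E * (1 - δ)) * ((childAvg n ^ m) f (child c ε) / x - 1) -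
              2 * E * ((childAvg n ^ m) g (child c ε) - y)) := by
            gcongr with ε
            refine (ih _ (hV m c hc ε)).trans ?_
            refine bellman_le_affine hx0 (hpos _ _ (hV m c hc ε)) (one_le_pow₀ one_le_two) ?_
              (hk _ _ hc) h0 h1 hδ
            -- The value at one child is at most the sum over all 2^n children, that is 2^n times
            -- the parent value; hence M = 2^n.
            rw [hxs, mul_inv_cancel_left₀ (by positivity)]
            exact Finset.single_le_sum (fun ε' _ => (hpos _ _ (hV m c hc ε')).le)
              (Finset.mem_univ ε)
        -- The bound is affine in the child data, so averaging substitutes the parent data, the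
        -- linear terms vanish, and the value at the touching point remains.
        _ = x ^ (1 + δ) * (2 - E + (2 * (1 + δ) + E * (1 - δ)) *
              ((2 ^ n : ℝ)⁻¹ * (∑ ε, (childAvg n ^ m) f (child c ε)) / x - 1) -
              2 * E * ((2 ^ n : ℝ)⁻¹ * (∑ ε, (childAvg n ^ m) g (child c ε)) - y)) := by
            simp only [← Finset.mul_sum, Finset.sum_sub_distrib, Finset.sum_add_distrib,
              ← Finset.sum_div, Finset.sum_const, Finset.card_univ, Fintype.card_pi,
              Fintype.card_bool, Finset.prod_const, Fintype.card_fin, nsmul_eq_mul]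
            push_cast
            field_simp
        _ = bellman δ x y := by
            have hEx : x ^ (1 + δ) * E = Real.exp (2 * y) * x ^ (δ - 1) := by
              rw [hE, Real.rpow_def_of_pos hx0, Real.rpow_def_of_pos hx0, ← Real.exp_add,
                ← Real.exp_add]
              congr 1; ring
            rw [← hxs, ← hys, div_self hx0.ne', bellman]
            linear_combination -hEx
  refine (key m c hc).trans ?_
  rw [bellman]
  have := hpos m c hc
  have : 0 < Real.exp (2 * (childAvg n ^ m) g c) * (childAvg n ^ m) f c ^ (δ - 1) := by positivity
  linarith

/-! ### Dyadic differentiation and integrals of dyadic step functions -/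

/-- The mean over a half-open cube as an average over a closed ball of the supremum norm. -/
lemma boxMean_eq_average_closedBall {n : ℕ} (F : EuclideanSpace ℝ (Fin n) → ℝ)
    {c : (Fin n → ℝ) × ℝ} (hc : 0 < c.2) :
    boxMean F c =
      ⨍ y in Metric.closedBall (fun i => c.1 i + c.2 / 2) (c.2 / 2), F (WithLp.toLp 2 y) := by
  have hball : Metric.closedBall (fun i => c.1 i + c.2 / 2) (c.2 / 2) =
      Set.univ.pi fun i => Icc (c.1 i) (c.1 i + c.2) := by
    rw [closedBall_pi _ (half_pos hc).le]
    congr 1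
    ext1 i
    rw [Real.closedBall_eq_Icc]
    congr 1 <;> ring
  have hae : (Set.univ.pi fun i => Ico (c.1 i) (c.1 i + c.2) : Set (Fin n → ℝ)) =ᵐ[volume]
      Metric.closedBall (fun i => c.1 i + c.2 / 2) (c.2 / 2) := by
    rw [hball]
    exact Measure.pi_Ico_ae_eq_pi_Icc
  rw [boxMean_eq_average F hc, setAverage_eq, setAverage_eq]
  have hmp := EuclideanSpace.volume_preserving_symm_measurableEquiv_toLp (Fin n)
  have hmeas : MeasurableSet (Set.univ.pi fun i => Ico (c.1 i) (c.1 i + c.2)) :=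
    MeasurableSet.univ_pi fun i => measurableSet_Ico
  congr 1
  · rw [← measureReal_congr hae, Measure.real, Measure.real, boxSet_eq_preimage,
      hmp.measure_preimage hmeas.nullMeasurableSet]
  · rw [← setIntegral_congr_set hae, boxSet_eq_preimage,
      ← hmp.setIntegral_preimage_emb (MeasurableEquiv.measurableEmbedding _)]
    rfl

/-- The dyadic subcube of `c` of generation `m` that contains `x`. -/
noncomputable def dyadicCell {n : ℕ} :
    ℕ → (Fin n → ℝ) × ℝ → EuclideanSpace ℝ (Fin n) → (Fin n → ℝ) × ℝ
  | 0, c, _ => c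
  | m + 1, c, x => dyadicCell m (child c (childIndex c x)) x

lemma dyadicCell_snd {n : ℕ} (m : ℕ) (c : (Fin n → ℝ) × ℝ) (x : EuclideanSpace ℝ (Fin n)) :
    (dyadicCell m c x).2 = c.2 / 2 ^ m := by
  induction m generalizing c with
  | zero => simp [dyadicCell]
  | succ m ih => rw [dyadicCell, ih, child_snd, pow_succ', div_div]

lemma mem_boxSet_dyadicCell {n : ℕ} (m : ℕ) {c : (Fin n → ℝ) × ℝ} (hc : 0 < c.2)
    {x : EuclideanSpace ℝ (Fin n)} (hx : x ∈ boxSet c) : x ∈ boxSet (dyadicCell m c x) := by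
  induction m generalizing c with
  | zero => exact hx
  | succ m ih => exact ih (half_pos hc) ((mem_boxSet_child_iff hc).2 ⟨hx, rfl⟩)

lemma boxSet_dyadicCell_subset {n : ℕ} (m : ℕ) {c : (Fin n → ℝ) × ℝ} (hc : 0 < c.2)
    (x : EuclideanSpace ℝ (Fin n)) : boxSet (dyadicCell m c x) ⊆ boxSet c := by
  induction m generalizing c with
  | zero => exact Subset.rfl
  | succ m ih => exact (ih (half_pos hc)).trans (boxSet_child_subset hc _)

lemma measurable_childIndex {n : ℕ} (c : (Fin n → ℝ) × ℝ) : Measurable (childIndex c) := by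
  refine measurable_pi_lambda _ fun i => measurable_to_bool ?_
  have : (fun x : EuclideanSpace ℝ (Fin n) => childIndex c x i) ⁻¹' {true} =
      {x | c.1 i + c.2 / 2 ≤ x i} := by
    ext x; simp [childIndex]
  rw [this]
  exact measurableSet_le measurable_const (by fun_prop)

/-- The cell depends on x through finitely many child indices per generation, each of them
measurable. -/
lemma measurable_comp_dyadicCell {n : ℕ} (φ : (Fin n → ℝ) × ℝ → ℝ) (m : ℕ)
    (c : (Fin n → ℝ) × ℝ) : Measurable fun x => φ (dyadicCell m c x) := by
  induction m generalizing c with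
  | zero => simp only [dyadicCell, measurable_const]
  | succ m ih =>
    have h : Measurable fun q : (Fin n → Bool) × EuclideanSpace ℝ (Fin n) =>
        φ (dyadicCell m (child c q.1) q.2) :=
      measurable_from_prod_countable_right fun ε => ih (child c ε)
    exact h.comp ((measurable_childIndex c).prodMk measurable_id)

/-- Identifies an iterated average with the integral of the step function of generation `m`, to
which Fatou's lemma can be applied. -/
lemma lintegral_comp_dyadicCell {n : ℕ} {φ : (Fin n → ℝ) × ℝ → ℝ} (hφ : ∀ c, 0 < c.2 → 0 ≤ φ c)
    (m : ℕ) {c : (Fin n → ℝ) × ℝ} (hc : 0 < c.2) :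
    ∫⁻ x in boxSet c, ENNReal.ofReal (φ (dyadicCell m c x)) =
      ENNReal.ofReal (c.2 ^ n * (childAvg n ^ m) φ c) := by
  have hnn : ∀ (m : ℕ) (c : (Fin n → ℝ) × ℝ), 0 < c.2 → 0 ≤ (childAvg n ^ m) φ c := by
    intro m
    induction m with
    | zero => exact hφ
    | succ m ih =>
      intro c hc
      rw [childAvg_pow_succ_apply]
      exact mul_nonneg (by positivity) (Finset.sum_nonneg fun ε _ => ih _ (half_pos hc))
  induction m generalizing c with
  | zero =>
    simp only [dyadicCell, lintegral_const, pow_zero, Module.End.one_apply,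
      Measure.restrict_apply_univ, volume_boxSet c hc]
    rw [← ENNReal.ofReal_mul (hφ c hc), mul_comm]
  | succ m ih =>
    have h1 : ∫⁻ x in boxSet c, ENNReal.ofReal (φ (dyadicCell (m + 1) c x)) =
        ∑ ε, ∫⁻ x in boxSet (child c ε), ENNReal.ofReal (φ (dyadicCell (m + 1) c x)) := by
      conv_lhs => rw [boxSet_eq_iUnion_child hc]
      rw [lintegral_iUnion (fun ε => measurableSet_boxSet _) (disjoint_boxSet_child hc),
        tsum_fintype]
    have h2 : ∀ ε, ∫⁻ x in boxSet (child c ε), ENNReal.ofReal (φ (dyadicCell (m + 1) c x)) =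
        ENNReal.ofReal ((c.2 / 2) ^ n * (childAvg n ^ m) φ (child c ε)) := by
      intro ε
      rw [← child_snd c ε, ← ih (half_pos hc)]
      refine setLIntegral_congr_fun (measurableSet_boxSet _) fun x hx => ?_
      rw [← ((mem_boxSet_child_iff hc).1 hx).2]
      rfl
    rw [h1, Finset.sum_congr rfl fun ε _ => h2 ε, ← ENNReal.ofReal_sum_of_nonneg
      fun ε _ => mul_nonneg (by positivity) (hnn m _ (half_pos hc)), ← Finset.mul_sum,
      childAvg_pow_succ_apply, div_pow]
    congr 1
    ring

open Filter Topology in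
/-- Lebesgue's differentiation theorem for dyadic cubes. -/
lemma ae_tendsto_boxMean_dyadicCell {n : ℕ} {F : EuclideanSpace ℝ (Fin n) → ℝ}
    {c : (Fin n → ℝ) × ℝ} (hc : 0 < c.2) (hF : IntegrableOn F (boxSet c)) :
    ∀ᵐ x, x ∈ boxSet c →
      Tendsto (fun m => boxMean F (dyadicCell m c x)) atTop (𝓝 (F x)) := by
  set F' : EuclideanSpace ℝ (Fin n) → ℝ := (boxSet c).indicator F with hF'
  have hF'int : Integrable F' := hF.integrable_indicator (measurableSet_boxSet c)
  have hloc : LocallyIntegrable (fun y : Fin n → ℝ => F' (WithLp.toLp 2 y)) volume :=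
    (((PiLp.volume_preserving_toLp (Fin n)).integrable_comp_emb
      (MeasurableEquiv.toLp 2 (Fin n → ℝ)).measurableEmbedding).2 hF'int).locallyIntegrable
  -- Closed balls of the supremum norm are cubes. A dyadic cell contains x without being centred
  -- there; the dilation factor 1 admits every ball that contains x.
  have h := IsUnifLocDoublingMeasure.ae_tendsto_average volume hloc 1
  filter_upwards [(PiLp.volume_preserving_ofLp (Fin n)).quasiMeasurePreserving.ae h] with x hx hxc
  have hlim : Tendsto (fun m : ℕ => (dyadicCell m c x).2 / 2) atTop (𝓝[>] 0) := by
    rw [tendsto_nhdsWithin_iff]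
    constructor
    · have : Tendsto (fun m : ℕ => c.2 / 2 * (1 / 2 : ℝ) ^ m) atTop (𝓝 (c.2 / 2 * 0)) :=
        (tendsto_pow_atTop_nhds_zero_of_lt_one (by norm_num) (by norm_num)).const_mul _
      rw [mul_zero] at this
      refine this.congr fun m => ?_
      rw [dyadicCell_snd, one_div, inv_pow]; field_simp
    · refine Eventually.of_forall fun m => ?_
      rw [dyadicCell_snd, mem_Ioi]; positivity
  have := hx (fun m i => (dyadicCell m c x).1 i + (dyadicCell m c x).2 / 2)
    (fun m => (dyadicCell m c x).2 / 2) hlim ?_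
  · have hFx : F' (WithLp.toLp 2 x.ofLp) = F x := by
      simp [hF', indicator_of_mem hxc]
    rw [hFx] at this
    refine this.congr fun m => ?_
    have hpos : 0 < (dyadicCell m c x).2 := by rw [dyadicCell_snd]; positivity
    rw [← boxMean_eq_average_closedBall _ hpos, boxMean, boxMean]
    congr 1
    refine setIntegral_congr_fun (measurableSet_boxSet _) fun y hy => ?_
    exact indicator_of_mem (boxSet_dyadicCell_subset m hc x hy) F
  · refine Eventually.of_forall fun m => ?_
    have hpos : 0 < (dyadicCell m c x).2 := by rw [dyadicCell_snd]; positivity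
    have hm := mem_boxSet_dyadicCell m hc hxc
    rw [one_mul, Metric.mem_closedBall, dist_pi_le_iff (half_pos hpos).le]
    intro i
    have := hm i
    rw [mem_Ico] at this
    rw [Real.dist_eq, abs_le]
    constructor <;> linarith

/-! ### From reverse Jensen to reverse Hölder on a cube -/

open Filter Topology in
/-- The reverse Hölder inequality on a cube `c` for a function that is bounded below by `1` and
satisfies a reverse Jensen inequality for the logarithm on the subcubes of `c`. -/
theorem lintegral_rpow_le_of_log_boxMean_le {n : ℕ} {k δ : ℝ} (h0 : 0 ≤ δ) (h1 : δ ≤ 1 / 2)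
    (hδ : 16 * 2 ^ n * δ * Real.exp (2 * k) ≤ 1) {G : EuclideanSpace ℝ (Fin n) → ℝ}
    (hGm : Measurable G) (hG1 : ∀ x, 1 ≤ G x) {c : (Fin n → ℝ) × ℝ} (hc : 0 < c.2)
    (hG : IntegrableOn G (boxSet c))
    (hk : ∀ c' : (Fin n → ℝ) × ℝ, 0 < c'.2 → boxSet c' ⊆ boxSet c →
      Real.log (boxMean G c') ≤ boxMean (fun x => Real.log (G x)) c' + k) :
    ∫⁻ x in boxSet c, ENNReal.ofReal (G x ^ (1 + δ)) ≤
      ENNReal.ofReal (c.2 ^ n * (2 * boxMean G c ^ (1 + δ))) := by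
  have hlog : IntegrableOn (fun x => Real.log (G x)) (boxSet c) := by
    refine hG.mono' (Real.measurable_log.comp hGm).aestronglyMeasurable
      (Eventually.of_forall fun x => ?_)
    rw [Real.norm_eq_abs, abs_of_nonneg (Real.log_nonneg (hG1 x))]
    exact (Real.log_le_sub_one_of_pos (by linarith [hG1 x])).trans (by linarith)
  have hpos : ∀ c' : (Fin n → ℝ) × ℝ, 0 < c'.2 → boxSet c' ⊆ boxSet c → 0 < boxMean G c' := by
    intro c' hc' hsub
    refine zero_lt_one.trans_le ?_
    rw [← boxMean_const hc' 1]
    exact boxMean_mono hc' (integrableOn_boxSet_const hc' 1) (hG.mono_set hsub)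
      (Eventually.of_forall fun x _ => hG1 x)
  have hpow : ∀ m, (childAvg n ^ m) (fun c => boxMean G c ^ (1 + δ)) c ≤
      2 * boxMean G c ^ (1 + δ) := by
    intro m
    have := childAvg_pow_rpow_le h0 h1 hδ
      (V := fun _ c' => 0 < c'.2 ∧ boxSet c' ⊆ boxSet c)
      (fun _ c' h ε => ⟨half_pos h.1, (boxSet_child_subset h.1 ε).trans h.2⟩)
      (f := boxMean G) (g := boxMean fun x => Real.log (G x))
      (fun c' h => hpos c' h.1 h.2) (fun c' h => ?_) (fun j c' h => ?_) m c ⟨hc, Subset.rfl⟩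
    · rwa [childAvg_pow_boxMean G m hc hG] at this
    · have hp := hpos c' h.1 h.2
      have hG' := hG.mono_set h.2
      -- Jensen's inequality, from the tangent line of the logarithm at the mean.
      calc boxMean (fun x => Real.log (G x)) c'
          ≤ boxMean (fun x => (boxMean G c')⁻¹ * G x + (Real.log (boxMean G c') - 1)) c' := by
            refine boxMean_mono h.1 (hlog.mono_set h.2)
              ((hG'.const_mul _).add (integrableOn_boxSet_const h.1 _))
              (Eventually.of_forall fun x _ => ?_)
            have hGx : 0 < G x := by linarith [hG1 x]
            have := Real.log_le_sub_one_of_pos (mul_pos (inv_pos.2 hp) hGx)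
            rw [Real.log_mul (inv_ne_zero hp.ne') hGx.ne', Real.log_inv] at this
            linarith
        _ = Real.log (boxMean G c') := by
            rw [boxMean_add (hG'.const_mul _) (integrableOn_boxSet_const h.1 _),
              boxMean_const_mul, boxMean_const h.1, inv_mul_cancel₀ hp.ne']
            ring
    · rw [childAvg_pow_boxMean G j h.1 (hG.mono_set h.2),
        childAvg_pow_boxMean _ j h.1 (hlog.mono_set h.2)]
      exact hk c' h.1 h.2
  have hnn : ∀ c' : (Fin n → ℝ) × ℝ, 0 < c'.2 → 0 ≤ boxMean G c' := fun c' hc' =>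
    mul_nonneg (by positivity) (integral_nonneg fun x => zero_le_one.trans (hG1 x))
  -- Almost everywhere G is the limit of its dyadic means, and the bound on iterated averages is
  -- uniform in the generation.
  calc ∫⁻ x in boxSet c, ENNReal.ofReal (G x ^ (1 + δ))
      = ∫⁻ x in boxSet c, liminf
          (fun m => ENNReal.ofReal (boxMean G (dyadicCell m c x) ^ (1 + δ))) atTop := by
        refine setLIntegral_congr_fun_ae (measurableSet_boxSet c) ?_
        filter_upwards [ae_tendsto_boxMean_dyadicCell hc hG] with x hx hxc
        refine (Tendsto.liminf_eq ?_).symm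
        exact ENNReal.tendsto_ofReal ((hx hxc).rpow_const (Or.inr (by linarith)))
    _ ≤ liminf (fun m => ∫⁻ x in boxSet c,
          ENNReal.ofReal (boxMean G (dyadicCell m c x) ^ (1 + δ))) atTop :=
        lintegral_liminf_le fun m =>
          (measurable_comp_dyadicCell (fun c => boxMean G c ^ (1 + δ)) m c).ennreal_ofReal
    _ ≤ _ := by
        refine liminf_le_of_le (by isBoundedDefault) fun b hb => ?_
        obtain ⟨m, hm⟩ := hb.exists
        refine hm.trans ?_
        rw [lintegral_comp_dyadicCell (φ := fun c => boxMean G c ^ (1 + δ))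
          (fun c' hc' => Real.rpow_nonneg (hnn c' hc') _) m hc]
        exact ENNReal.ofReal_le_ofReal (mul_le_mul_of_nonneg_left (hpow m) (by positivity))

/-! ### Quantitative data for exponents and weights; norms on cubes of edge at most 2 -/

/-- Quantitative bounds for a log-Hölder continuous exponent: `p₀` and `P` are lower and upper
bounds, `L` controls the oscillation on small cubes, and `Cinf` the decay at infinity. -/
structure ExponentBounds {n : ℕ} (p : EuclideanSpace ℝ (Fin n) → ℝ) (p₀ P L pinf Cinf : ℝ) :
    Prop where
  measurable : Measurable p
  p₀_pos : 0 < p₀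
  lower : ∀ x, p₀ ≤ p x
  upper : ∀ x, p x ≤ P
  lower_pinf : p₀ ≤ pinf
  pinf_upper : pinf ≤ P
  L_nonneg : 0 ≤ L
  Cinf_nonneg : 0 ≤ Cinf
  osc : ∀ c : (Fin n → ℝ) × ℝ, 0 < c.2 → ∀ x ∈ boxSet c, ∀ y ∈ boxSet c,
    |p x - p y| * -Real.log c.2 ≤ L
  infty : ∀ x, |p x - pinf| ≤ Cinf / Real.log (Real.exp 1 + ‖x‖)

/-- `N c` is the Luxemburg norm of `w` on the cube `c`, characterised by its modular. -/
def IsBoxNorm {n : ℕ} (p w : EuclideanSpace ℝ (Fin n) → ℝ) (N : (Fin n → ℝ) × ℝ → ℝ) : Prop :=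
  ∀ c, 0 < c.2 → 0 < N c ∧ ∫ x in boxSet c, (w x / N c) ^ p x = 1

/-- A weight `w` with local norms `N` (and local norms `S` of the constant `1`) that satisfies the
`𝒜_{p(·),∞}` condition with constant `exp κ` on half-open cubes. -/
structure WeightBounds {n : ℕ} (p w : EuclideanSpace ℝ (Fin n) → ℝ) (κ : ℝ)
    (N S : (Fin n → ℝ) × ℝ → ℝ) : Prop where
  measurable : Measurable w
  nonneg : ∀ x, 0 ≤ w x
  pos_ae : ∀ᵐ x, 0 < w x
  isBoxNorm : IsBoxNorm p w N
  isBoxNorm_one : IsBoxNorm p (fun _ => 1) S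
  log_integrable : ∀ c, 0 < c.2 → IntegrableOn (fun x => Real.log (w x)) (boxSet c)
  log_le : ∀ c, 0 < c.2 →
    Real.log (N c) - Real.log (S c) ≤ κ + boxMean (fun x => Real.log (w x)) c

lemma IsBoxNorm.integrableOn {n : ℕ} {p w : EuclideanSpace ℝ (Fin n) → ℝ}
    {N : (Fin n → ℝ) × ℝ → ℝ} (h : IsBoxNorm p w N) {c : (Fin n → ℝ) × ℝ} (hc : 0 < c.2) :
    IntegrableOn (fun x => (w x / N c) ^ p x) (boxSet c) := by
  by_contra hn
  have := (h c hc).2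
  rw [integral_undef hn] at this
  exact zero_ne_one this

lemma ExponentBounds.pos {n : ℕ} {p : EuclideanSpace ℝ (Fin n) → ℝ} {p₀ P L pinf Cinf : ℝ}
    (hp : ExponentBounds p p₀ P L pinf Cinf) (x : EuclideanSpace ℝ (Fin n)) : 0 < p x :=
  hp.p₀_pos.trans_le (hp.lower x)

lemma ExponentBounds.P_pos {n : ℕ} {p : EuclideanSpace ℝ (Fin n) → ℝ} {p₀ P L pinf Cinf : ℝ}
    (hp : ExponentBounds p p₀ P L pinf Cinf) : 0 < P :=
  (hp.pos 0).trans_le (hp.upper 0)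

lemma ExponentBounds.abs_sub_le {n : ℕ} {p : EuclideanSpace ℝ (Fin n) → ℝ} {p₀ P L pinf Cinf : ℝ}
    (hp : ExponentBounds p p₀ P L pinf Cinf) (x y : EuclideanSpace ℝ (Fin n)) :
    |p x - p y| ≤ P := by
  rw [abs_le]
  constructor <;> linarith [hp.pos x, hp.pos y, hp.upper x, hp.upper y]

/-- On cubes of bounded size the modular of the norm of `1_Q` is pointwise comparable to `1/|Q|`
(logarithmic form). -/
lemma ExponentBounds.abs_log_le {n : ℕ} {p : EuclideanSpace ℝ (Fin n) → ℝ} {p₀ P L pinf Cinf : ℝ}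
    (hp : ExponentBounds p p₀ P L pinf Cinf) {S : (Fin n → ℝ) × ℝ → ℝ}
    (hS : IsBoxNorm p (fun _ => 1) S) {c : (Fin n → ℝ) × ℝ} (hc : 0 < c.2) (hc2 : c.2 ≤ 2)
    {x : EuclideanSpace ℝ (Fin n)} (hx : x ∈ boxSet c) :
    |n * Real.log c.2 - p x * Real.log (S c)| ≤ n / p₀ * (L + P * Real.log 2) := by
  have hp0 := hp.p₀_pos
  have hP := hp.P_pos
  have hL := hp.L_nonneg
  have hS0 := (hS c hc).1
  have hint := hS.integrableOn hc
  have hv0 : volume (boxSet c) ≠ 0 := by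
    rw [volume_boxSet c hc]; simpa using pow_pos hc n
  have hv1 := (volume_boxSet_lt_top c hc).ne
  have havg : ⨍ y in boxSet c, (1 / S c) ^ p y = (c.2 ^ n)⁻¹ := by
    rw [← boxMean_eq_average _ hc, boxMean, (hS c hc).2, mul_one]
  have hexp : ∀ y, Real.log ((1 / S c) ^ p y) = -(p y * Real.log (S c)) := by
    intro y
    rw [Real.log_rpow (by positivity), one_div, Real.log_inv]; ring
  have hlogc : Real.log ((c.2 ^ n)⁻¹) = -(n * Real.log c.2) := by
    rw [Real.log_inv, Real.log_pow]
  -- The average of (1/S)^p is 1/|c|, so one point has a value below it and another a value above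
  -- it. The claim reduces to the oscillation of p between x and these points.
  obtain ⟨y, hy, hy'⟩ := exists_le_setAverage hv0 hv1 hint
  obtain ⟨z, hz, hz'⟩ := exists_setAverage_le hv0 hv1 hint
  rw [havg] at hy' hz'
  have hy2 := Real.log_le_log (by positivity) hy'
  have hz2 := Real.log_le_log (by positivity) hz'
  rw [hexp, hlogc] at hy2 hz2
  set t := Real.log (S c)
  have hbound : ∀ u ∈ boxSet c, |p x - p u| * |t| ≤ n / p₀ * (L + P * Real.log 2) := by
    intro u hu
    have hlog2 : 0 < Real.log 2 := Real.log_pos one_lt_two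
    have e1 := hp.osc c hc x hx u hu
    have e2 := hp.abs_sub_le x u
    have e3 := abs_nonneg (p x - p u)
    have hn : (0 : ℝ) ≤ n := Nat.cast_nonneg n
    rw [div_mul_eq_mul_div, le_div_iff₀ hp0]
    -- If S ≤ 1, then |log S| is at most n/p₀ times -log of the edge, and `osc` applies. If S ≥ 1,
    -- then log S ≤ n log 2 / p₀ because the edge is at most 2.
    rcases le_total t 0 with ht | ht
    · rw [abs_of_nonpos ht]
      have : p₀ * -t ≤ n * -Real.log c.2 := by nlinarith [hp.lower y]
      calc |p x - p u| * -t * p₀ = |p x - p u| * (p₀ * -t) := by ring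
        _ ≤ |p x - p u| * (n * -Real.log c.2) := by gcongr
        _ = n * (|p x - p u| * -Real.log c.2) := by ring
        _ ≤ n * (L + P * Real.log 2) := by gcongr; nlinarith
    · rw [abs_of_nonneg ht]
      have h1 : p₀ * t ≤ n * Real.log c.2 := by nlinarith [hp.lower z]
      have h2 : Real.log c.2 ≤ Real.log 2 := Real.log_le_log hc hc2
      calc |p x - p u| * t * p₀ = |p x - p u| * (p₀ * t) := by ring
        _ ≤ P * (n * Real.log 2) :=
          mul_le_mul e2 (h1.trans (by gcongr)) (by positivity) hP.le
        _ ≤ n * (L + P * Real.log 2) := by nlinarith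
  have by1 := hbound y hy
  have bz1 := hbound z hz
  rw [← abs_mul] at by1 bz1
  rw [abs_le] at by1 bz1 ⊢
  constructor <;> nlinarith

/-- The comparison constant for cubes of edge length at most `2`. -/
noncomputable def smallConst (n : ℕ) (p₀ P L : ℝ) : ℝ :=
  Real.exp (n / p₀ * (L + P * Real.log 2))

section Small

variable {n : ℕ} {p w : EuclideanSpace ℝ (Fin n) → ℝ} {p₀ P L pinf Cinf κ : ℝ}
  {N S : (Fin n → ℝ) × ℝ → ℝ}

lemma ExponentBounds.one_le_smallConst (hp : ExponentBounds p p₀ P L pinf Cinf) :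
    1 ≤ smallConst n p₀ P L := by
  have h0 := hp.p₀_pos
  have h1 := hp.P_pos
  have h2 := hp.L_nonneg
  have h3 := Real.log_pos one_lt_two
  exact Real.one_le_exp (by positivity)

lemma ExponentBounds.one_div_rpow_le (hp : ExponentBounds p p₀ P L pinf Cinf)
    (hS : IsBoxNorm p (fun _ => 1) S) {c : (Fin n → ℝ) × ℝ} (hc : 0 < c.2) (hc2 : c.2 ≤ 2)
    {x : EuclideanSpace ℝ (Fin n)} (hx : x ∈ boxSet c) :
    (1 / S c) ^ p x ≤ smallConst n p₀ P L * (c.2 ^ n)⁻¹ := by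
  have h := (abs_le.1 (hp.abs_log_le hS hc hc2 hx)).2
  have hS0 := (hS c hc).1
  have h1 : (c.2 ^ n)⁻¹ = Real.exp (-(n * Real.log c.2)) := by
    rw [Real.exp_neg, Real.exp_nat_mul, Real.exp_log hc]
  rw [smallConst, h1, ← Real.exp_add, Real.rpow_def_of_pos (by positivity), Real.exp_le_exp,
    one_div, Real.log_inv]
  linarith

lemma ExponentBounds.le_one_div_rpow (hp : ExponentBounds p p₀ P L pinf Cinf)
    (hS : IsBoxNorm p (fun _ => 1) S) {c : (Fin n → ℝ) × ℝ} (hc : 0 < c.2) (hc2 : c.2 ≤ 2)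
    {x : EuclideanSpace ℝ (Fin n)} (hx : x ∈ boxSet c) :
    (smallConst n p₀ P L)⁻¹ * (c.2 ^ n)⁻¹ ≤ (1 / S c) ^ p x := by
  have h := (abs_le.1 (hp.abs_log_le hS hc hc2 hx)).1
  have hS0 := (hS c hc).1
  have h1 : (c.2 ^ n)⁻¹ = Real.exp (-(n * Real.log c.2)) := by
    rw [Real.exp_neg, Real.exp_nat_mul, Real.exp_log hc]
  rw [smallConst, h1, ← Real.exp_neg, ← Real.exp_add, Real.rpow_def_of_pos (by positivity),
    Real.exp_le_exp, one_div, Real.log_inv]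
  linarith

lemma WeightBounds.norm_pos (hw : WeightBounds p w κ N S) {c : (Fin n → ℝ) × ℝ} (hc : 0 < c.2) :
    0 < N c := (hw.isBoxNorm c hc).1

lemma WeightBounds.norm_one_pos (hw : WeightBounds p w κ N S) {c : (Fin n → ℝ) × ℝ}
    (hc : 0 < c.2) : 0 < S c := (hw.isBoxNorm_one c hc).1

lemma WeightBounds.rpow_eq (hw : WeightBounds p w κ N S) {c : (Fin n → ℝ) × ℝ}
    (hc : 0 < c.2) (x : EuclideanSpace ℝ (Fin n)) :
    (w x / N c) ^ p x = (w x / (N c / S c)) ^ p x * (1 / S c) ^ p x := by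
  have h1 := hw.norm_pos hc
  have h2 := hw.norm_one_pos hc
  rw [← Real.mul_rpow (div_nonneg (hw.nonneg x) (by positivity)) (by positivity)]
  congr 1
  field_simp

lemma WeightBounds.measurable_rpow (hw : WeightBounds p w κ N S)
    (hp : ExponentBounds p p₀ P L pinf Cinf) (a r : ℝ) :
    Measurable fun x => (w x / a) ^ (r * p x) :=
  (hw.measurable.div_const a).pow (hp.measurable.const_mul r)

lemma WeightBounds.integrableOn_div (hw : WeightBounds p w κ N S)
    (hp : ExponentBounds p p₀ P L pinf Cinf) {a : ℝ} (ha : 0 < a) {c : (Fin n → ℝ) × ℝ}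
    (hc : 0 < c.2) : IntegrableOn (fun x => (w x / a) ^ p x) (boxSet c) := by
  have hN := hw.norm_pos hc
  set b := max 1 (N c / a) with hb
  have hb1 : 1 ≤ b := le_max_left _ _
  refine ((hw.isBoxNorm.integrableOn hc).const_mul (b ^ P)).mono' ?_ ?_
  · simpa using (hw.measurable_rpow hp a 1).aestronglyMeasurable
  · refine Filter.Eventually.of_forall fun x => ?_
    have h0 : 0 ≤ w x / N c := div_nonneg (hw.nonneg x) hN.le
    rw [Real.norm_eq_abs, abs_of_nonneg (Real.rpow_nonneg (div_nonneg (hw.nonneg x) ha.le) _)]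
    calc (w x / a) ^ p x = (N c / a) ^ p x * (w x / N c) ^ p x := by
          rw [← Real.mul_rpow (by positivity) h0]; congr 1; field_simp
      _ ≤ b ^ P * (w x / N c) ^ p x := by
          gcongr
          calc (N c / a) ^ p x ≤ b ^ p x :=
                Real.rpow_le_rpow (by positivity) (le_max_right _ _) (hp.pos x).le
            _ ≤ b ^ P := Real.rpow_le_rpow_of_exponent_le hb1 (hp.upper x)

/-- The modular of w / N(c) over c is 1, and its factor (1/S)^p is 1/|c| up to D^(±1). So the
p-modular mean of w divided by its normalised norm is pinched between 1/D and D, the lower half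
being `WeightBounds.le_boxMean_rpow`. -/
lemma WeightBounds.boxMean_rpow_le (hw : WeightBounds p w κ N S)
    (hp : ExponentBounds p p₀ P L pinf Cinf) {c : (Fin n → ℝ) × ℝ} (hc : 0 < c.2)
    (hc2 : c.2 ≤ 2) :
    boxMean (fun x => (w x / (N c / S c)) ^ p x) c ≤ smallConst n p₀ P L := by
  have h1 := hw.norm_pos hc
  have h2 := hw.norm_one_pos hc
  have hD := zero_lt_one.trans_le hp.one_le_smallConst
  set D := smallConst n p₀ P L
  have hl : 0 < c.2 ^ n := by positivity
  calc boxMean (fun x => (w x / (N c / S c)) ^ p x) c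
      ≤ boxMean (fun x => (D * c.2 ^ n) * (w x / N c) ^ p x) c := by
        refine boxMean_mono hc (hw.integrableOn_div hp (div_pos h1 h2) hc)
          ((hw.isBoxNorm.integrableOn hc).const_mul _) (Filter.Eventually.of_forall fun x hx => ?_)
        have h := hp.le_one_div_rpow hw.isBoxNorm_one hc hc2 hx
        have h0 : 0 ≤ (w x / (N c / S c)) ^ p x :=
          Real.rpow_nonneg (div_nonneg (hw.nonneg x) (by positivity)) _
        rw [hw.rpow_eq hc]
        calc (w x / (N c / S c)) ^ p x
            = (D * c.2 ^ n) * ((w x / (N c / S c)) ^ p x * (D⁻¹ * (c.2 ^ n)⁻¹)) := by field_simp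
          _ ≤ _ := by gcongr
    _ = D := by
        rw [boxMean_const_mul, boxMean, (hw.isBoxNorm c hc).2]; field_simp

lemma WeightBounds.le_boxMean_rpow (hw : WeightBounds p w κ N S)
    (hp : ExponentBounds p p₀ P L pinf Cinf) {c : (Fin n → ℝ) × ℝ} (hc : 0 < c.2)
    (hc2 : c.2 ≤ 2) :
    (smallConst n p₀ P L)⁻¹ ≤ boxMean (fun x => (w x / (N c / S c)) ^ p x) c := by
  have h1 := hw.norm_pos hc
  have h2 := hw.norm_one_pos hc
  have hD := zero_lt_one.trans_le hp.one_le_smallConst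
  set D := smallConst n p₀ P L
  have hl : 0 < c.2 ^ n := by positivity
  calc D⁻¹ = boxMean (fun x => (D⁻¹ * c.2 ^ n) * (w x / N c) ^ p x) c := by
        rw [boxMean_const_mul, boxMean, (hw.isBoxNorm c hc).2]; field_simp
    _ ≤ _ := by
        refine boxMean_mono hc ((hw.isBoxNorm.integrableOn hc).const_mul _)
          (hw.integrableOn_div hp (div_pos h1 h2) hc) (Filter.Eventually.of_forall fun x hx => ?_)
        have h := hp.one_div_rpow_le hw.isBoxNorm_one hc hc2 hx
        have h0 : 0 ≤ (w x / (N c / S c)) ^ p x :=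
          Real.rpow_nonneg (div_nonneg (hw.nonneg x) (by positivity)) _
        rw [hw.rpow_eq hc]
        calc (D⁻¹ * c.2 ^ n) * ((w x / (N c / S c)) ^ p x * (1 / S c) ^ p x)
            ≤ (D⁻¹ * c.2 ^ n) * ((w x / (N c / S c)) ^ p x * (D * (c.2 ^ n)⁻¹)) := by gcongr
          _ = _ := by field_simp

/-- Weight bounds are invariant under multiplication of the weight by a positive constant. -/
lemma WeightBounds.div_const (hw : WeightBounds p w κ N S) {a : ℝ} (ha : 0 < a) :
    WeightBounds p (fun x => w x / a) κ (fun c => N c / a) S where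
  measurable := hw.measurable.div_const a
  nonneg x := div_nonneg (hw.nonneg x) ha.le
  pos_ae := hw.pos_ae.mono fun x hx => div_pos hx ha
  isBoxNorm c hc := by
    refine ⟨div_pos (hw.norm_pos hc) ha, ?_⟩
    rw [← (hw.isBoxNorm c hc).2]
    simp only [div_div_div_cancel_right₀ ha.ne']
  isBoxNorm_one := hw.isBoxNorm_one
  log_integrable c hc := by
    refine ((hw.log_integrable c hc).sub (integrableOn_boxSet_const hc (Real.log a))).congr ?_
    filter_upwards [ae_restrict_of_ae hw.pos_ae] with x hx
    rw [Pi.sub_apply, Real.log_div hx.ne' ha.ne']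
  log_le c hc := by
    have h : boxMean (fun x => Real.log (w x / a)) c =
        boxMean (fun x => Real.log (w x)) c - Real.log a := by
      rw [← boxMean_const hc (Real.log a), ← boxMean_sub (hw.log_integrable c hc)
        (integrableOn_boxSet_const hc _), boxMean, boxMean]
      congr 1
      refine integral_congr_ae ?_
      filter_upwards [ae_restrict_of_ae hw.pos_ae] with x hx
      rw [Real.log_div hx.ne' ha.ne']
    rw [h, Real.log_div (hw.norm_pos hc).ne' ha.ne']
    linarith [hw.log_le c hc]

/-- The weight condition is scale invariant; for w divided by its normalised norm on c, the left
side of `log_le` is zero. -/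
lemma WeightBounds.neg_le_boxMean_log (hw : WeightBounds p w κ N S) {c : (Fin n → ℝ) × ℝ}
    (hc : 0 < c.2) : -κ ≤ boxMean (fun x => Real.log (w x / (N c / S c))) c := by
  have h1 := hw.norm_pos hc
  have h2 := hw.norm_one_pos hc
  have := (hw.div_const (div_pos h1 h2)).log_le c hc
  rw [div_div_cancel₀ h1.ne'] at this
  linarith

lemma log_le_rpow_div_of_le {t q p₀ : ℝ} (ht : 0 ≤ t) (hp₀ : 0 < p₀) (hq : p₀ ≤ q) :
    Real.log t ≤ t ^ q / p₀ := by
  have hq0 := hp₀.trans_le hq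
  refine (Real.log_le_rpow_div ht hq0).trans ?_
  have := Real.rpow_nonneg ht q
  gcongr

lemma WeightBounds.boxMean_log_le (hw : WeightBounds p w κ N S)
    (hp : ExponentBounds p p₀ P L pinf Cinf) {c : (Fin n → ℝ) × ℝ} (hc : 0 < c.2)
    (hc2 : c.2 ≤ 2) :
    boxMean (fun x => Real.log (w x / (N c / S c))) c ≤ smallConst n p₀ P L / p₀ := by
  have h12 := div_pos (hw.norm_pos hc) (hw.norm_one_pos hc)
  have hp0 := hp.p₀_pos
  calc boxMean (fun x => Real.log (w x / (N c / S c))) c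
      ≤ boxMean (fun x => p₀⁻¹ * (w x / (N c / S c)) ^ p x) c := by
        refine boxMean_mono hc ((hw.div_const h12).log_integrable c hc)
          ((hw.integrableOn_div hp h12 hc).const_mul _) (Filter.Eventually.of_forall fun x _ => ?_)
        rw [inv_mul_eq_div]
        exact log_le_rpow_div_of_le (div_nonneg (hw.nonneg x) h12.le) hp0 (hp.lower x)
    _ ≤ _ := by
        rw [boxMean_const_mul, inv_mul_eq_div]
        gcongr
        exact hw.boxMean_rpow_le hp hc hc2

/-- A lower bound for the constant of a weight. -/
lemma WeightBounds.neg_le_const (hw : WeightBounds p w κ N S)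
    (hp : ExponentBounds p p₀ P L pinf Cinf) : -(smallConst n p₀ P L / p₀) ≤ κ := by
  have h1 := hw.neg_le_boxMean_log (c := (0, 1)) one_pos
  have h2 := hw.boxMean_log_le hp (c := (0, 1)) one_pos one_le_two
  linarith

end Small

/-! ### Reverse Hölder on cubes of edge at most 2 -/

lemma corner_mem_boxSet {n : ℕ} {c : (Fin n → ℝ) × ℝ} (hc : 0 < c.2) :
    WithLp.toLp 2 c.1 ∈ boxSet c := fun i => by simp [hc]

lemma snd_le_of_boxSet_subset {n : ℕ} (hn : n ≠ 0) {c c' : (Fin n → ℝ) × ℝ} (hc : 0 < c.2)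
    (hc' : 0 < c'.2) (h : boxSet c' ⊆ boxSet c) : c'.2 ≤ c.2 := by
  have := measure_mono (μ := volume) h
  rw [volume_boxSet c hc, volume_boxSet c' hc', ENNReal.ofReal_le_ofReal_iff (by positivity)] at this
  exact (pow_le_pow_iff_left₀ hc'.le hc.le hn).1 this

/-- Allows the variable exponent in front of a logarithm to be replaced by P before taking means:
for t ≤ 1 this only decreases the term, and for t ≥ 1 the subtracted power makes the left side
nonpositive. -/
lemma mul_log_sub_rpow_le {t q p₀ P : ℝ} (ht : 0 < t) (hp₀ : 0 < p₀) (hq : p₀ ≤ q) (hP : q ≤ P) :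
    P * Real.log t - P / p₀ * t ^ q ≤ q * Real.log t := by
  have h1 := log_le_rpow_div_of_le ht.le hp₀ hq
  have hq0 := hp₀.trans_le hq
  have h2 : P / p₀ * t ^ q = P * (t ^ q / p₀) := by ring
  have h3 : 0 ≤ t ^ q / p₀ := by positivity
  rw [h2]
  rcases le_total 0 (Real.log t) with h | h
  · have h4 := mul_nonneg hq0.le h
    have h5 := mul_le_mul_of_nonneg_left h1 (hq0.le.trans hP)
    linarith
  · have h4 := mul_le_mul_of_nonpos_right hP h
    have h5 := mul_nonneg (hq0.le.trans hP) h3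
    linarith

/-- Controls the oscillation of `p` against the size of the weight on cubes where it is large. -/
noncomputable def smallOscConst (n : ℕ) (p₀ P L : ℝ) : ℝ :=
  (P * (2 * (n / p₀ * (L + P * Real.log 2)) + n * Real.log 2) + n * L) / p₀

/-- The constant in the reverse Jensen inequality on small cubes. -/
noncomputable def smallLogConst (n : ℕ) (p₀ P L : ℝ) : ℝ :=
  P * smallConst n p₀ P L / p₀ + smallOscConst n p₀ P L +
    Real.log (1 + smallConst n p₀ P L * Real.exp (smallOscConst n p₀ P L))

section SmallReverseHolder

variable {n : ℕ} {p w : EuclideanSpace ℝ (Fin n) → ℝ} {p₀ P L pinf Cinf κ : ℝ}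
  {N S : (Fin n → ℝ) × ℝ → ℝ}

lemma ExponentBounds.smallOscConst_nonneg (hp : ExponentBounds p p₀ P L pinf Cinf) :
    0 ≤ smallOscConst n p₀ P L := by
  have h0 := hp.p₀_pos
  have h1 := hp.P_pos
  have h2 := hp.L_nonneg
  have h3 := Real.log_pos one_lt_two
  unfold smallOscConst
  positivity

/-- If `w` is normalised on a small cube `c` then `1 + w ^ p` satisfies a reverse Jensen inequality
for the logarithm on all subcubes of `c`. -/
lemma WeightBounds.log_boxMean_le (hn : n ≠ 0) (hw : WeightBounds p w κ N S)
    (hp : ExponentBounds p p₀ P L pinf Cinf) {c : (Fin n → ℝ) × ℝ} (hc : 0 < c.2)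
    (hc2 : c.2 ≤ 2) (hNS : N c = S c) {c' : (Fin n → ℝ) × ℝ} (hc' : 0 < c'.2)
    (hsub : boxSet c' ⊆ boxSet c) :
    Real.log (boxMean (fun x => 1 + w x ^ p x) c') ≤
      boxMean (fun x => Real.log (1 + w x ^ p x)) c' + (P * κ + smallLogConst n p₀ P L) := by
  have hp0 := hp.p₀_pos
  have hP := hp.P_pos
  have hL := hp.L_nonneg
  have hlog2 := Real.log_pos one_lt_two
  have hD1 := hp.one_le_smallConst
  have ho := hp.smallOscConst_nonneg
  have hc'c := snd_le_of_boxSet_subset hn hc hc' hsub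
  have hc'2 := hc'c.trans hc2
  set lam := N c' / S c' with hlam
  have hlam0 : 0 < lam := div_pos (hw.norm_pos hc') (hw.norm_one_pos hc')
  have i1 := hw.boxMean_rpow_le hp hc' hc'2
  have i2 := hw.le_boxMean_rpow hp hc' hc'2
  have i3 := hw.neg_le_boxMean_log hc'
  have hκ := hw.neg_le_const hp
  rw [← hlam] at i1 i2 i3
  have hvint := hw.integrableOn_div hp hlam0 hc'
  have hwint : IntegrableOn (fun x => w x ^ p x) (boxSet c') := by
    simpa using hw.integrableOn_div hp one_pos hc'
  have hwint_c : IntegrableOn (fun x => w x ^ p x) (boxSet c) := by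
    simpa using hw.integrableOn_div hp one_pos hc
  have hcint := integrableOn_boxSet_const hc' (1 : ℝ)
  have hGint : IntegrableOn (fun x => 1 + w x ^ p x) (boxSet c') := hcint.add hwint
  have hwnn : ∀ x, 0 ≤ w x ^ p x := fun x => Real.rpow_nonneg (hw.nonneg x) _
  have hvnn : ∀ x, 0 ≤ (w x / lam) ^ p x := fun x =>
    Real.rpow_nonneg (div_nonneg (hw.nonneg x) hlam0.le) _
  have hlogint : IntegrableOn (fun x => Real.log (1 + w x ^ p x)) (boxSet c') := by
    refine hwint.mono' ?_ (Filter.Eventually.of_forall fun x => ?_)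
    · exact (Real.measurable_log.comp
        (measurable_const.add (hw.measurable.pow hp.measurable))).aestronglyMeasurable
    · rw [Real.norm_eq_abs, abs_of_nonneg (Real.log_nonneg (by linarith [hwnn x]))]
      linarith [Real.log_le_sub_one_of_pos (show 0 < 1 + w x ^ p x by linarith [hwnn x])]
  have hG1 : 1 ≤ boxMean (fun x => 1 + w x ^ p x) c' := by
    calc (1 : ℝ) = boxMean (fun _ => (1 : ℝ)) c' := (boxMean_const hc' 1).symm
      _ ≤ _ := boxMean_mono hc' hcint hGint
        (Filter.Eventually.of_forall fun x _ => by linarith [hwnn x])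
  rw [smallLogConst]
  set D := smallConst n p₀ P L with hD
  have hD0 : 0 < D := by linarith
  set o := smallOscConst n p₀ P L with hodef
  have hPκ : -(P * D / p₀) ≤ P * κ := by
    calc -(P * D / p₀) = P * -(D / p₀) := by ring
      _ ≤ P * κ := by gcongr
  -- If the local average is at most 1, the mean of 1 + w^p is bounded and the mean of its logarithm
  -- is nonnegative.
  rcases le_or_gt lam 1 with h | h
  · have h1 : boxMean (fun x => 1 + w x ^ p x) c' ≤ 1 + D * Real.exp o := by
      calc boxMean (fun x => 1 + w x ^ p x) c' ≤ boxMean (fun x => 1 + (w x / lam) ^ p x) c' := by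
            refine boxMean_mono hc' hGint (hcint.add hvint)
              (Filter.Eventually.of_forall fun x _ => ?_)
            have : w x ≤ w x / lam := le_div_self (hw.nonneg x) hlam0 h
            have := Real.rpow_le_rpow (hw.nonneg x) this (hp.pos x).le
            linarith
        _ ≤ 1 + D := by
            rw [boxMean_add hcint hvint, boxMean_const hc']
            linarith
        _ ≤ _ := by nlinarith [Real.one_le_exp ho]
    have h2 : 0 ≤ boxMean (fun x => Real.log (1 + w x ^ p x)) c' :=
      mul_nonneg (by positivity) (integral_nonneg fun x =>
        Real.log_nonneg (by linarith [hwnn x]))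
    have h3 := Real.log_le_log (by linarith) h1
    linarith
  · set t := Real.log lam with ht
    have ht0 : 0 < t := Real.log_pos h
    have hlamt : lam = Real.exp t := (Real.exp_log hlam0).symm
    have hvw : ∀ x, w x ^ p x = (w x / lam) ^ p x * Real.exp (p x * t) := by
      intro x
      rw [mul_comm (p x) t, Real.exp_mul, ← hlamt,
        ← Real.mul_rpow (div_nonneg (hw.nonneg x) hlam0.le) hlam0.le,
        div_mul_cancel₀ _ hlam0.ne']
    -- Since w is normalised on c, its modular over c' is at most 2^n D, while the modular mean of
    -- w/lam is at least 1/D. Hence lam is at most a power of the inverse edge of c'.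
    have hsize : p₀ * t ≤ 2 * (n / p₀ * (L + P * Real.log 2)) + n * Real.log 2 -
        n * Real.log c'.2 := by
      have e1 : D⁻¹ ≤ Real.exp (-(p₀ * t)) * boxMean (fun x => w x ^ p x) c' := by
        refine i2.trans ?_
        rw [← boxMean_const_mul]
        refine boxMean_mono hc' hvint (hwint.const_mul _)
          (Filter.Eventually.of_forall fun x _ => ?_)
        rw [hvw x, mul_left_comm, ← Real.exp_add]
        refine le_mul_of_one_le_right (hvnn x) (Real.one_le_exp ?_)
        nlinarith [hp.lower x]
      have e2 : boxMean (fun x => w x ^ p x) c' ≤ (c'.2 ^ n)⁻¹ * (2 ^ n * D) := by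
        rw [boxMean]
        refine mul_le_mul_of_nonneg_left ?_ (by positivity)
        calc ∫ x in boxSet c', w x ^ p x ≤ ∫ x in boxSet c, w x ^ p x :=
              setIntegral_mono_set hwint_c (Filter.Eventually.of_forall hwnn)
                (Filter.Eventually.of_forall hsub)
          _ = c.2 ^ n * boxMean (fun x => w x ^ p x) c := setIntegral_eq_boxMean _ hc
          _ ≤ 2 ^ n * D := by
              have := hw.boxMean_rpow_le hp hc hc2
              rw [hNS, div_self (hw.norm_one_pos hc).ne'] at this
              simp only [div_one] at this
              gcongr
              exact mul_nonneg (by positivity) (integral_nonneg hwnn)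
      have e3 : D⁻¹ ≤ Real.exp (-(p₀ * t)) * ((c'.2 ^ n)⁻¹ * (2 ^ n * D)) :=
        e1.trans (by gcongr)
      have e4 := Real.log_le_log (by positivity) e3
      rw [Real.log_mul (by positivity) (by positivity), Real.log_mul (by positivity)
        (by positivity), Real.log_mul (by positivity) (by positivity), Real.log_exp,
        Real.log_inv, Real.log_inv, Real.log_pow, Real.log_pow, hD, smallConst,
        Real.log_exp] at e4
      linarith
    have hosc : ∀ x ∈ boxSet c', ∀ y ∈ boxSet c', |p x - p y| * t ≤ o := by
      intro x hx y hy
      rw [hodef, smallOscConst, le_div_iff₀ hp0]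
      have e1 := hp.osc c' hc' x hx y hy
      have e2 := hp.abs_sub_le x y
      have e3 := abs_nonneg (p x - p y)
      have e4 : 0 ≤ 2 * (n / p₀ * (L + P * Real.log 2)) + n * Real.log 2 := by positivity
      calc |p x - p y| * t * p₀ = |p x - p y| * (p₀ * t) := by ring
        _ ≤ |p x - p y| * (2 * (n / p₀ * (L + P * Real.log 2)) + n * Real.log 2 -
              n * Real.log c'.2) := by gcongr
        _ = |p x - p y| * (2 * (n / p₀ * (L + P * Real.log 2)) + n * Real.log 2) +
              n * (|p x - p y| * -Real.log c'.2) := by ring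
        _ ≤ _ := by gcongr
    -- The exponent is frozen at the corner: by `hosc`, lam^p(x) equals lam^q up to e^(±o) on c',
    -- and lam^q cancels between the upper and lower bounds.
    set q := p (WithLp.toLp 2 c'.1) with hq
    have hqb : ∀ x ∈ boxSet c', q * t - o ≤ p x * t ∧ p x * t ≤ q * t + o := by
      intro x hx
      have := hosc x hx _ (corner_mem_boxSet hc')
      rw [← hq, ← abs_of_pos ht0, ← abs_mul, abs_le, sub_mul] at this
      constructor <;> linarith
    have hq0 : 0 < q := hp.pos _
    have hup : Real.log (boxMean (fun x => 1 + w x ^ p x) c') ≤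
        q * t + Real.log (1 + D * Real.exp o) := by
      have e1 : boxMean (fun x => 1 + w x ^ p x) c' ≤ Real.exp (q * t) * (1 + D * Real.exp o) := by
        calc boxMean (fun x => 1 + w x ^ p x) c'
            ≤ boxMean (fun x => 1 + Real.exp (q * t + o) * (w x / lam) ^ p x) c' := by
              refine boxMean_mono hc' hGint (hcint.add (hvint.const_mul _))
                (Filter.Eventually.of_forall fun x hx => ?_)
              rw [hvw x, mul_comm]
              have := hvnn x
              have := (hqb x hx).2
              gcongr
          _ ≤ 1 + Real.exp (q * t + o) * D := by
              rw [boxMean_add hcint (hvint.const_mul _), boxMean_const hc', boxMean_const_mul]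
              gcongr
          _ ≤ _ := by
              rw [Real.exp_add]
              have := Real.one_le_exp (mul_pos hq0 ht0).le
              nlinarith
      have e2 := Real.log_le_log (by linarith) e1
      rwa [Real.log_mul (by positivity) (by positivity), Real.log_exp] at e2
    -- The term Pκ enters here: the mean of log(w/lam) is at least -κ, and it appears with factor P.
    have hlow : -(P * κ) - P * D / p₀ + (q * t - o) ≤
        boxMean (fun x => Real.log (1 + w x ^ p x)) c' := by
      have hlv := (hw.div_const hlam0).log_integrable c' hc'
      have hI1 : IntegrableOn (fun x => P * Real.log (w x / lam) + (q * t - o)) (boxSet c') :=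
        (hlv.const_mul _).add (integrableOn_boxSet_const hc' _)
      have hI2 : IntegrableOn (fun x => P / p₀ * (w x / lam) ^ p x) (boxSet c') :=
        hvint.const_mul _
      calc -(P * κ) - P * D / p₀ + (q * t - o)
          ≤ P * boxMean (fun x => Real.log (w x / lam)) c' + (q * t - o) -
              P / p₀ * boxMean (fun x => (w x / lam) ^ p x) c' := by
            have e1 : P * -κ ≤ P * boxMean (fun x => Real.log (w x / lam)) c' := by gcongr
            have e2 : P / p₀ * boxMean (fun x => (w x / lam) ^ p x) c' ≤ P / p₀ * D := by gcongr
            have e3 : P / p₀ * D = P * D / p₀ := by ring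
            linarith
        _ = boxMean (fun x => (P * Real.log (w x / lam) + (q * t - o)) -
              P / p₀ * (w x / lam) ^ p x) c' := by
            rw [boxMean_sub hI1 hI2, boxMean_add (hlv.const_mul _)
              (integrableOn_boxSet_const hc' _), boxMean_const_mul, boxMean_const_mul,
              boxMean_const hc']
        _ ≤ _ := by
            refine boxMean_mono hc' (hI1.sub hI2) hlogint ?_
            filter_upwards [hw.pos_ae] with x hx hxc
            have hv0 : 0 < w x / lam := div_pos hx hlam0
            have e1 : Real.log (w x ^ p x) ≤ Real.log (1 + w x ^ p x) :=
              Real.log_le_log (by positivity) (by linarith)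
            have e2 : Real.log (w x ^ p x) = p x * Real.log (w x / lam) + p x * t := by
              rw [Real.log_rpow hx, Real.log_div hx.ne' hlam0.ne']; ring
            have e3 := (hqb x hxc).1
            have e4 : P * Real.log (w x / lam) - P / p₀ * (w x / lam) ^ p x ≤
                p x * Real.log (w x / lam) :=
              mul_log_sub_rpow_le hv0 hp0 (hp.lower x) (hp.upper x)
            linarith
    linarith

/-- The reverse Hölder inequality on small cubes. -/
theorem WeightBounds.lintegral_rpow_le_of_snd_le (hn : n ≠ 0) (hw : WeightBounds p w κ N S)
    (hp : ExponentBounds p p₀ P L pinf Cinf) {δ : ℝ} (h0 : 0 ≤ δ) (h1 : δ ≤ 1 / 2)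
    (hδ : 16 * 2 ^ n * δ * Real.exp (2 * (P * κ + smallLogConst n p₀ P L)) ≤ 1)
    {c : (Fin n → ℝ) × ℝ} (hc : 0 < c.2) (hc2 : c.2 ≤ 2) :
    ∫⁻ x in boxSet c, ENNReal.ofReal ((w x / (N c / S c)) ^ ((1 + δ) * p x)) ≤
      ENNReal.ofReal (c.2 ^ n * (2 * (1 + smallConst n p₀ P L) ^ 2)) := by
  have hlam := div_pos (hw.norm_pos hc) (hw.norm_one_pos hc)
  have hD1 := hp.one_le_smallConst
  set v : EuclideanSpace ℝ (Fin n) → ℝ := fun x => w x / (N c / S c) with hv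
  have hv' : WeightBounds p v κ (fun c' => N c' / (N c / S c)) S := hw.div_const hlam
  have hNS : N c / (N c / S c) = S c := div_div_cancel₀ (hw.norm_pos hc).ne'
  have hnn : ∀ x, 0 ≤ v x ^ p x := fun x => Real.rpow_nonneg (hv'.nonneg x) _
  have hint : IntegrableOn (fun x => v x ^ p x) (boxSet c) := hw.integrableOn_div hp hlam hc
  have hint' : IntegrableOn (fun x => 1 + v x ^ p x) (boxSet c) :=
    (integrableOn_boxSet_const hc 1).add hint
  have key := lintegral_rpow_le_of_log_boxMean_le h0 h1 hδ (G := fun x => 1 + v x ^ p x)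
    (measurable_const.add (hv'.measurable.pow hp.measurable)) (fun x => by linarith [hnn x]) hc
    hint' (fun c' hc' hsub => hv'.log_boxMean_le hn hp hc hc2 hNS hc' hsub)
  refine (lintegral_mono fun x => ENNReal.ofReal_le_ofReal ?_).trans
    (key.trans (ENNReal.ofReal_le_ofReal ?_))
  · rw [mul_comm, Real.rpow_mul (hv'.nonneg x)]
    exact Real.rpow_le_rpow (hnn x) (by linarith) (by linarith)
  · have hm : boxMean (fun x => 1 + v x ^ p x) c ≤ 1 + smallConst n p₀ P L := by
      rw [boxMean_add (integrableOn_boxSet_const hc 1) hint, boxMean_const hc]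
      have : boxMean (fun x => v x ^ p x) c ≤ _ := hw.boxMean_rpow_le hp hc hc2
      linarith
    have hm0 : 0 ≤ boxMean (fun x => 1 + v x ^ p x) c :=
      mul_nonneg (by positivity) (integral_nonneg fun x => add_nonneg zero_le_one (hnn x))
    have := hc.le
    gcongr
    calc boxMean (fun x => 1 + v x ^ p x) c ^ (1 + δ)
        ≤ (1 + smallConst n p₀ P L) ^ (1 + δ) := Real.rpow_le_rpow hm0 hm (by linarith)
      _ ≤ (1 + smallConst n p₀ P L) ^ (2 : ℝ) :=
        Real.rpow_le_rpow_of_exponent_le (by linarith) (by linarith)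
      _ = _ := by norm_num

end SmallReverseHolder

/-! ### Replacing the variable exponent by its limit at infinity -/

/-- On cubes of edge length between `1` and `2`, powers with exponents `p x` and `pinf` of numbers
in `[0,1]` agree up to a constant and an error with small total mass. -/
theorem exists_rpow_comparison (n : ℕ) {p₀ Cinf : ℝ} (hp₀ : 0 < p₀) (hC : 0 ≤ Cinf) :
    ∃ (E : ℝ) (H : EuclideanSpace ℝ (Fin n) → ℝ), 1 ≤ E ∧ (∀ x, 0 ≤ H x) ∧ Integrable H ∧
      ∫ x, H x ≤ 1 / 2 ∧ ∀ (p : EuclideanSpace ℝ (Fin n) → ℝ) (P L pinf : ℝ),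
        ExponentBounds p p₀ P L pinf Cinf → ∀ c : (Fin n → ℝ) × ℝ, 1 ≤ c.2 → c.2 ≤ 2 →
          ∀ x ∈ boxSet c, ∀ s : ℝ, 0 ≤ s → s ≤ 1 →
            s ^ p x ≤ E * s ^ pinf + ∫ y in boxSet c, H y ∧
            s ^ pinf ≤ E * s ^ p x + ∫ y in boxSet c, H y := by
  -- Any decay rate above n makes H₀ integrable.
  set b : ℝ := n + 1 with hb
  have hb0 : 0 < b := by positivity
  set H₀ : EuclideanSpace ℝ (Fin n) → ℝ := fun x => (1 + ‖x‖) ^ (-b) with hH₀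
  have hH₀pos : ∀ x, 0 < H₀ x := fun x => by positivity
  have hH₀int : Integrable H₀ := integrable_one_add_norm (by simp [hb])
  set I := ∫ x, H₀ x
  have hI : 0 ≤ I := integral_nonneg fun x => (hH₀pos x).le
  -- Brings the total mass of a·H₀ below 1/2, so that it can be absorbed on large cubes.
  set a : ℝ := 1 / (2 * (I + 1)) with ha
  have ha0 : 0 < a := by positivity
  have ha1 : a ≤ 1 := by rw [ha, div_le_one (by positivity)]; linarith
  -- On a cube of edge at most 2 the quantity 1 + ‖·‖ varies by at most the factor M; θ compensates
  -- for this loss in H₀.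
  set M : ℝ := 1 + √n * 2 with hM
  have hM1 : 1 ≤ M := by rw [hM]; linarith [Real.sqrt_nonneg n]
  set θ : ℝ := a * M ^ (-b) with hθ
  have hθ0 : 0 < θ := by positivity
  have hθ1 : θ ≤ 1 := mul_le_one₀ ha1 (by positivity)
    (Real.rpow_le_one_of_one_le_of_nonpos hM1 (by linarith))
  have hlogθ : Real.log θ ≤ 0 := Real.log_nonpos hθ0.le hθ1
  set e₀ := Cinf * ((b - Real.log θ) / p₀) with he₀
  have he₀0 : 0 ≤ e₀ := mul_nonneg hC (div_nonneg (by linarith) hp₀.le)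
  refine ⟨Real.exp e₀, fun x => a * H₀ x, Real.one_le_exp he₀0,
    fun x => mul_nonneg ha0.le (hH₀pos x).le, hH₀int.const_mul a, ?_, ?_⟩
  · rw [integral_const_mul, ha, div_mul_eq_mul_div, one_mul, div_le_div_iff₀ (by positivity)
      two_pos]
    change I * 2 ≤ _
    linarith
  intro p P L pinf hp c hc1 hc2 x hx s hs0 hs1
  have hc : 0 < c.2 := by linarith
  have hx1 : 1 ≤ Real.exp 1 + ‖x‖ := by linarith [norm_nonneg x, Real.one_le_exp zero_le_one]
  set lam := Real.log (Real.exp 1 + ‖x‖) with hlam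
  have hlam1 : 1 ≤ lam := by
    have := Real.log_le_log (Real.exp_pos 1) (show Real.exp 1 ≤ Real.exp 1 + ‖x‖ by
      linarith [norm_nonneg x])
    rwa [Real.log_exp] at this
  set h := θ * Real.exp (-(b * lam)) with hh
  have hh0 : 0 < h := by positivity
  have hHh : h ≤ ∫ y in boxSet c, a * H₀ y := by
    have hexp : Real.exp (-(b * lam)) ≤ (1 + ‖x‖) ^ (-b) := by
      rw [Real.rpow_def_of_pos (by positivity), Real.exp_le_exp]
      have := Real.log_le_log (by positivity) (show 1 + ‖x‖ ≤ Real.exp 1 + ‖x‖ by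
        linarith [Real.one_le_exp zero_le_one])
      rw [← hlam] at this
      nlinarith
    have hpt : ∀ y ∈ boxSet c, h ≤ a * H₀ y := by
      intro y hy
      have h1 : 1 + ‖y‖ ≤ M * (1 + ‖x‖) := by
        have h2 := norm_sub_le_of_mem_boxSet hc hy hx
        have h3 : ‖y‖ ≤ ‖x‖ + ‖y - x‖ := by
          simpa using norm_add_le x (y - x)
        have h4 : √n * c.2 ≤ √n * 2 := by gcongr
        have h5 := mul_nonneg (Real.sqrt_nonneg (n : ℝ)) (norm_nonneg x)
        rw [hM]
        nlinarith
      calc h ≤ θ * (1 + ‖x‖) ^ (-b) := by rw [hh]; gcongr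
        _ = a * (M * (1 + ‖x‖)) ^ (-b) := by
          rw [Real.mul_rpow (by linarith) (by positivity), hθ, mul_assoc]
        _ ≤ a * (1 + ‖y‖) ^ (-b) :=
          mul_le_mul_of_nonneg_left
            (Real.rpow_le_rpow_of_nonpos (by positivity) h1 (by linarith)) ha0.le
    calc h ≤ c.2 ^ n * h := le_mul_of_one_le_left hh0.le (one_le_pow₀ hc1)
      _ = ∫ y in boxSet c, h := by
        rw [setIntegral_const, volume_real_boxSet c hc, smul_eq_mul]
      _ ≤ _ := setIntegral_mono_on (integrableOn_boxSet_const hc h)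
        (hH₀int.const_mul a).integrableOn (measurableSet_boxSet c) hpt
  have hE0 := Real.exp_pos e₀
  -- If s^p₀ ≤ h, both powers of s are at most h and the error term covers them. Otherwise -log s is
  -- at most a constant times log(e + ‖x‖), which the decay of |p(x) - pinf| compensates, so the two
  -- powers are comparable.
  rcases le_or_gt (s ^ p₀) h with hsh | hsh
  · rcases hs0.eq_or_lt with rfl | hs
    · rw [Real.zero_rpow (hp.pos x).ne', Real.zero_rpow (hp₀.trans_le hp.lower_pinf).ne']
      constructor <;> linarith
    · have h1 : s ^ p x ≤ s ^ p₀ := Real.rpow_le_rpow_of_exponent_ge hs hs1 (hp.lower x)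
      have h2 : s ^ pinf ≤ s ^ p₀ := Real.rpow_le_rpow_of_exponent_ge hs hs1 hp.lower_pinf
      have h3 := mul_nonneg hE0.le (Real.rpow_nonneg hs0 (p x))
      have h4 := mul_nonneg hE0.le (Real.rpow_nonneg hs0 pinf)
      constructor <;> linarith
  · have hs : 0 < s := by
      rcases hs0.eq_or_lt with rfl | hs
      · rw [Real.zero_rpow hp₀.ne'] at hsh; linarith
      · exact hs
    have hlog := Real.log_le_log hh0 hsh.le
    rw [hh, Real.log_mul hθ0.ne' (Real.exp_pos _).ne', Real.log_exp, Real.log_rpow hs] at hlog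
    have hls : -Real.log s ≤ lam * ((b - Real.log θ) / p₀) := by
      rw [mul_div_assoc', le_div_iff₀ hp₀]
      nlinarith
    have hls0 : Real.log s ≤ 0 := Real.log_nonpos hs0 hs1
    have hosc : |p x - pinf| * -Real.log s ≤ e₀ := by
      calc |p x - pinf| * -Real.log s ≤ Cinf / lam * (lam * ((b - Real.log θ) / p₀)) := by
            refine mul_le_mul (hp.infty x) hls (by linarith) (by positivity)
        _ = e₀ := by rw [he₀]; field_simp
    have hosc2 : |(p x - pinf) * Real.log s| ≤ e₀ := by
      rwa [abs_mul, abs_of_nonpos hls0]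
    rw [abs_le] at hosc2
    have h1 : s ^ p x ≤ Real.exp e₀ * s ^ pinf := by
      rw [Real.rpow_def_of_pos hs, Real.rpow_def_of_pos hs, ← Real.exp_add, Real.exp_le_exp]
      linarith
    have h2 : s ^ pinf ≤ Real.exp e₀ * s ^ p x := by
      rw [Real.rpow_def_of_pos hs, Real.rpow_def_of_pos hs, ← Real.exp_add, Real.exp_le_exp]
      linarith
    constructor <;> linarith

/-- Admissible data in `exists_rpow_comparison`. -/
structure RpowComparison {n : ℕ} (p : EuclideanSpace ℝ (Fin n) → ℝ) (pinf E : ℝ)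
    (H : EuclideanSpace ℝ (Fin n) → ℝ) : Prop where
  one_le : 1 ≤ E
  nonneg : ∀ x, 0 ≤ H x
  integrable : Integrable H
  integral_le : ∫ x, H x ≤ 1 / 2
  rpow_le : ∀ c : (Fin n → ℝ) × ℝ, 1 ≤ c.2 → c.2 ≤ 2 → ∀ x ∈ boxSet c, ∀ s : ℝ, 0 ≤ s → s ≤ 1 →
    s ^ p x ≤ E * s ^ pinf + ∫ y in boxSet c, H y
  le_rpow : ∀ c : (Fin n → ℝ) × ℝ, 1 ≤ c.2 → c.2 ≤ 2 → ∀ x ∈ boxSet c, ∀ s : ℝ, 0 ≤ s → s ≤ 1 →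
    s ^ pinf ≤ E * s ^ p x + ∫ y in boxSet c, H y

/-! ### The norm on a large cube against the norms on its blocks -/

section LocalToGlobal

variable {n : ℕ} {p w : EuclideanSpace ℝ (Fin n) → ℝ} {p₀ P L pinf Cinf E : ℝ}
  {N : (Fin n → ℝ) × ℝ → ℝ} {H : EuclideanSpace ℝ (Fin n) → ℝ}

lemma RpowComparison.setIntegral_le (hH : RpowComparison p pinf E H)
    (s : Set (EuclideanSpace ℝ (Fin n))) : ∫ x in s, H x ≤ 1 / 2 :=
  (setIntegral_le_integral hH.integrable (Filter.Eventually.of_forall hH.nonneg)).trans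
    hH.integral_le

lemma IsBoxNorm.rpow_eq_mul (hN : IsBoxNorm p w N) (hw : ∀ x, 0 ≤ w x)
    {b c : (Fin n → ℝ) × ℝ} (hb : 0 < b.2) (hc : 0 < c.2) (x : EuclideanSpace ℝ (Fin n)) :
    (w x / N c) ^ p x = (w x / N b) ^ p x * (N b / N c) ^ p x := by
  have h1 := (hN b hb).1
  have h2 := (hN c hc).1
  rw [← Real.mul_rpow (div_nonneg (hw x) h1.le) (by positivity)]
  congr 1
  field_simp

/-- If N(b) > N(c), the modular of w/N(b) over b would be at most (N(c)/N(b))^p₀ < 1. Monotonicity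
places the ratios N(b)/N(c) in [0, 1], where the comparison of powers holds. -/
lemma IsBoxNorm.mono (hN : IsBoxNorm p w N) (hp : ExponentBounds p p₀ P L pinf Cinf)
    (hw : ∀ x, 0 ≤ w x) {b c : (Fin n → ℝ) × ℝ} (hb : 0 < b.2) (hc : 0 < c.2)
    (h : boxSet b ⊆ boxSet c) : N b ≤ N c := by
  by_contra! hlt
  have hNb := (hN b hb).1
  have hNc := (hN c hc).1
  have hnn : ∀ x, 0 ≤ (w x / N c) ^ p x := fun x =>
    Real.rpow_nonneg (div_nonneg (hw x) hNc.le) _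
  have h1 : (1 : ℝ) ≤ (N c / N b) ^ p₀ := by
    calc (1 : ℝ) = ∫ x in boxSet b, (w x / N b) ^ p x := (hN b hb).2.symm
      _ ≤ ∫ x in boxSet b, (N c / N b) ^ p₀ * (w x / N c) ^ p x := by
        refine setIntegral_mono_on (hN.integrableOn hb)
          (((hN.integrableOn hc).mono_set h).const_mul _) (measurableSet_boxSet b) fun x _ => ?_
        rw [hN.rpow_eq_mul hw hc hb, mul_comm]
        refine mul_le_mul_of_nonneg_right ?_ (hnn x)
        exact Real.rpow_le_rpow_of_exponent_ge (by positivity) ((div_le_one hNb).2 hlt.le)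
          (hp.lower x)
      _ = (N c / N b) ^ p₀ * ∫ x in boxSet b, (w x / N c) ^ p x := integral_const_mul _ _
      _ ≤ (N c / N b) ^ p₀ * ∫ x in boxSet c, (w x / N c) ^ p x := by
        refine mul_le_mul_of_nonneg_left ?_ (by positivity)
        exact setIntegral_mono_set (hN.integrableOn hc) (Filter.Eventually.of_forall hnn)
          (Filter.Eventually.of_forall h)
      _ = _ := by rw [(hN c hc).2, mul_one]
  have h2 := Real.rpow_lt_one (by positivity) ((div_lt_one hNb).2 hlt) hp.p₀_pos
  linarith

/-- The local norms on the blocks of a large cube control the norm on the cube from above. -/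
lemma IsBoxNorm.childAvg_pow_le (hN : IsBoxNorm p w N) (hp : ExponentBounds p p₀ P L pinf Cinf)
    (hH : RpowComparison p pinf E H) (hw : ∀ x, 0 ≤ w x) {m : ℕ} {β : ℝ} (hβ1 : 1 ≤ β)
    (hβ2 : β ≤ 2) {c : (Fin n → ℝ) × ℝ} (hc : c.2 = 2 ^ m * β) :
    (childAvg n ^ m) (fun b => N b ^ pinf) c ≤ 2 * E * ((2 ^ m) ^ n)⁻¹ * N c ^ pinf := by
  have hβ0 : 0 < β := by linarith
  have hc0 : 0 < c.2 := by rw [hc]; positivity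
  have hNc := (hN c hc0).1
  have hHi : ∀ s, IntegrableOn H s := fun s => hH.integrable.integrableOn
  have hFi : IntegrableOn (fun x => E * (w x / N c) ^ p x + H x) (boxSet c) :=
    ((hN.integrableOn hc0).const_mul E).add (hHi _)
  have hmono := childAvg_pow_mono
    (V := fun j b => b.2 = 2 ^ j * β ∧ boxSet b ⊆ boxSet c)
    (fun j b hb ε => ⟨by rw [child_snd, hb.1, pow_succ]; ring,
      (boxSet_child_subset (by rw [hb.1]; positivity) ε).trans hb.2⟩)
    (f := fun b => N b ^ pinf)
    (g := (N c ^ pinf * β ^ n) • boxMean fun x => E * (w x / N c) ^ p x + H x)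
    (fun b hb => ?_) m c ⟨hc, Subset.rfl⟩
  · refine hmono.trans ?_
    rw [map_smul, Pi.smul_apply, childAvg_pow_boxMean _ m hc0 hFi, boxMean,
      integral_add ((hN.integrableOn hc0).const_mul E) (hHi _), integral_const_mul, (hN c hc0).2,
      hc, mul_pow, smul_eq_mul]
    have h1 := hH.setIntegral_le (boxSet c)
    have h2 := hH.one_le
    have h3 := Real.rpow_nonneg hNc.le pinf
    calc N c ^ pinf * β ^ n * (((2 ^ m) ^ n * β ^ n)⁻¹ * (E * 1 + ∫ x in boxSet c, H x))
        = (E * 1 + ∫ x in boxSet c, H x) * ((2 ^ m) ^ n)⁻¹ * N c ^ pinf := by field_simp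
      _ ≤ _ := by gcongr; linarith
  · have hb2 : b.2 = β := by simpa using hb.1
    have hb0 : 0 < b.2 := by linarith
    have hNb := (hN b hb0).1
    have hs1 : N b / N c ≤ 1 := (div_le_one hNc).2 (hN.mono hp hw hb0 hc0 hb.2)
    have hI0 := hN.integrableOn hb0
    have hIc := (hN.integrableOn hc0).mono_set hb.2
    -- Inserting the integral of (w/N(b))^p, which equals 1, lets the exponent be changed pointwise
    -- from pinf to p(x). The product is then (w/N(c))^p, whose integral is additive over blocks.
    have key : (N b / N c) ^ pinf ≤ ∫ x in boxSet b, (E * (w x / N c) ^ p x + H x) := by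
      calc (N b / N c) ^ pinf = ∫ x in boxSet b, (N b / N c) ^ pinf * (w x / N b) ^ p x := by
            rw [integral_const_mul, (hN b hb0).2, mul_one]
        _ ≤ ∫ x in boxSet b, (E * (w x / N c) ^ p x +
              (∫ y in boxSet b, H y) * (w x / N b) ^ p x) := by
            refine setIntegral_mono_on (hI0.const_mul _)
              ((hIc.const_mul _).add (hI0.const_mul _)) (measurableSet_boxSet b) fun x hx => ?_
            have h1 := hH.le_rpow b (hb2 ▸ hβ1) (hb2 ▸ hβ2) x hx (N b / N c) (by positivity) hs1
            have h2 : 0 ≤ (w x / N b) ^ p x := Real.rpow_nonneg (div_nonneg (hw x) hNb.le) _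
            rw [hN.rpow_eq_mul hw hb0 hc0]
            calc (N b / N c) ^ pinf * (w x / N b) ^ p x
                ≤ (E * (N b / N c) ^ p x + ∫ y in boxSet b, H y) * (w x / N b) ^ p x := by gcongr
              _ = _ := by ring
        _ = _ := by
            rw [integral_add (hIc.const_mul _) (hI0.const_mul _), integral_const_mul,
              integral_const_mul, (hN b hb0).2, integral_add (hIc.const_mul _) (hHi _),
              integral_const_mul, mul_one]
    rw [Real.div_rpow hNb.le hNc.le, div_le_iff₀ (by positivity), setIntegral_eq_boxMean _ hb0,
      hb2] at key
    simp only [Pi.smul_apply, smul_eq_mul]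
    linarith

/-- The local norms on the blocks of a large cube control the norm on the cube from below. -/
lemma IsBoxNorm.le_childAvg_pow (hN : IsBoxNorm p w N) (hp : ExponentBounds p p₀ P L pinf Cinf)
    (hH : RpowComparison p pinf E H) (hw : ∀ x, 0 ≤ w x) {m : ℕ} {β : ℝ} (hβ1 : 1 ≤ β)
    (hβ2 : β ≤ 2) {c : (Fin n → ℝ) × ℝ} (hc : c.2 = 2 ^ m * β) :
    ((2 ^ m) ^ n)⁻¹ * N c ^ pinf ≤ 2 * E * (childAvg n ^ m) (fun b => N b ^ pinf) c := by
  have hβ0 : 0 < β := by linarith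
  have hc0 : 0 < c.2 := by rw [hc]; positivity
  have hNc := (hN c hc0).1
  have hHi : ∀ s, IntegrableOn H s := fun s => hH.integrable.integrableOn
  have hFi : IntegrableOn (fun x => (w x / N c) ^ p x - H x) (boxSet c) :=
    (hN.integrableOn hc0).sub (hHi _)
  have hmono := childAvg_pow_mono
    (V := fun j b => b.2 = 2 ^ j * β ∧ boxSet b ⊆ boxSet c)
    (fun j b hb ε => ⟨by rw [child_snd, hb.1, pow_succ]; ring,
      (boxSet_child_subset (by rw [hb.1]; positivity) ε).trans hb.2⟩)
    (f := (N c ^ pinf * β ^ n) • boxMean fun x => (w x / N c) ^ p x - H x)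
    (g := E • fun b => N b ^ pinf)
    (fun b hb => ?_) m c ⟨hc, Subset.rfl⟩
  · rw [map_smul, Pi.smul_apply, childAvg_pow_boxMean _ m hc0 hFi, boxMean,
      integral_sub (hN.integrableOn hc0) (hHi _), (hN c hc0).2, hc, mul_pow, smul_eq_mul, map_smul,
      Pi.smul_apply, smul_eq_mul] at hmono
    have h1 := hH.setIntegral_le (boxSet c)
    have h3 := Real.rpow_nonneg hNc.le pinf
    have h4 : N c ^ pinf * β ^ n * (((2 ^ m) ^ n * β ^ n)⁻¹ * (1 - ∫ x in boxSet c, H x)) =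
        (1 - ∫ x in boxSet c, H x) * (((2 ^ m) ^ n)⁻¹ * N c ^ pinf) := by field_simp
    rw [h4] at hmono
    -- The error has mass at most 1/2 and leaves half of the modular.
    have h5 : (1 / 2) * (((2 ^ m) ^ n)⁻¹ * N c ^ pinf) ≤
        (1 - ∫ x in boxSet c, H x) * (((2 ^ m) ^ n)⁻¹ * N c ^ pinf) := by
      gcongr; linarith
    linarith
  · have hb2 : b.2 = β := by simpa using hb.1
    have hb0 : 0 < b.2 := by linarith
    have hNb := (hN b hb0).1
    have hs1 : N b / N c ≤ 1 := (div_le_one hNc).2 (hN.mono hp hw hb0 hc0 hb.2)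
    have hI0 := hN.integrableOn hb0
    have hIc := (hN.integrableOn hc0).mono_set hb.2
    have key : ∫ x in boxSet b, ((w x / N c) ^ p x - H x) ≤ E * (N b / N c) ^ pinf := by
      rw [integral_sub hIc (hHi _), sub_le_iff_le_add]
      calc ∫ x in boxSet b, (w x / N c) ^ p x
          ≤ ∫ x in boxSet b, (E * (N b / N c) ^ pinf + ∫ y in boxSet b, H y) *
              (w x / N b) ^ p x := by
            refine setIntegral_mono_on hIc (hI0.const_mul _) (measurableSet_boxSet b) fun x hx => ?_
            have h1 := hH.rpow_le b (hb2 ▸ hβ1) (hb2 ▸ hβ2) x hx (N b / N c) (by positivity) hs1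
            have h2 : 0 ≤ (w x / N b) ^ p x := Real.rpow_nonneg (div_nonneg (hw x) hNb.le) _
            rw [hN.rpow_eq_mul hw hb0 hc0, mul_comm]
            gcongr
        _ = _ := by rw [integral_const_mul, (hN b hb0).2, mul_one]
    rw [Real.div_rpow hNb.le hNc.le, mul_div_assoc', le_div_iff₀ (by positivity),
      setIntegral_eq_boxMean _ hb0, hb2] at key
    simp only [Pi.smul_apply, smul_eq_mul]
    linarith

end LocalToGlobal

/-! ### Reverse Hölder on large cubes -/

/-- Bound for the logarithm of the norm of the constant `1` on cubes of edge length in `[1,2]`. -/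
noncomputable def unitLogConst (n : ℕ) (p₀ P L : ℝ) : ℝ :=
  (n * Real.log 2 + n / p₀ * (L + P * Real.log 2)) / p₀

/-- The constant in the reverse Jensen inequality at large scales. -/
noncomputable def largeLogConst (n : ℕ) (p₀ P L pinf E : ℝ) : ℝ :=
  2 * Real.log (2 * E) + 2 * (pinf * unitLogConst n p₀ P L) + pinf * (smallConst n p₀ P L / p₀)

/-- Bound for normalised block sums in the reverse Hölder inequality at large scales. -/
noncomputable def blockSumConst (n : ℕ) (p₀ P L pinf E : ℝ) : ℝ :=
  2 * (2 * E * (2 * E * Real.exp (pinf * unitLogConst n p₀ P L))) ^ 2 *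
    (2 * E * Real.exp (pinf * unitLogConst n p₀ P L))

/-- The constant in the reverse Hölder inequality on large cubes. -/
noncomputable def largeConst (n : ℕ) (p₀ P L pinf E : ℝ) : ℝ :=
  2 ^ n * (2 * (1 + smallConst n p₀ P L) ^ 2) *
    (Real.exp (2 * unitLogConst n p₀ P L) * blockSumConst n p₀ P L pinf E ^ (1 / pinf)) ^ P *
      (2 * E)

section Large

variable {n : ℕ} {p w : EuclideanSpace ℝ (Fin n) → ℝ} {p₀ P L pinf Cinf κ E : ℝ}
  {N S : (Fin n → ℝ) × ℝ → ℝ} {H : EuclideanSpace ℝ (Fin n) → ℝ}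

lemma ExponentBounds.pinf_pos (hp : ExponentBounds p p₀ P L pinf Cinf) : 0 < pinf :=
  hp.p₀_pos.trans_le hp.lower_pinf

lemma ExponentBounds.unitLogConst_nonneg (hp : ExponentBounds p p₀ P L pinf Cinf) :
    0 ≤ unitLogConst n p₀ P L := by
  have h0 := hp.p₀_pos
  have h1 := hp.P_pos
  have h2 := hp.L_nonneg
  have h3 := Real.log_pos one_lt_two
  unfold unitLogConst
  positivity

lemma ExponentBounds.abs_log_norm_one_le (hp : ExponentBounds p p₀ P L pinf Cinf)
    (hS : IsBoxNorm p (fun _ => 1) S) {b : (Fin n → ℝ) × ℝ} (hb1 : 1 ≤ b.2) (hb2 : b.2 ≤ 2) :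
    |Real.log (S b)| ≤ unitLogConst n p₀ P L := by
  have hb : 0 < b.2 := by linarith
  have h := hp.abs_log_le hS hb hb2 (corner_mem_boxSet hb)
  set q := p (WithLp.toLp 2 b.1)
  have hq : p₀ ≤ q := hp.lower _
  have hp0 := hp.p₀_pos
  have h1 : 0 ≤ Real.log b.2 := Real.log_nonneg hb1
  have h2 : Real.log b.2 ≤ Real.log 2 := Real.log_le_log hb hb2
  have h3 : (n : ℝ) * Real.log b.2 ≤ n * Real.log 2 := by gcongr
  have h4 : 0 ≤ (n : ℝ) * Real.log b.2 := by positivity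
  rw [unitLogConst, le_div_iff₀ hp0]
  have h5 : |Real.log (S b)| * p₀ ≤ |q * Real.log (S b)| := by
    rw [abs_mul, abs_of_pos (hp0.trans_le hq), mul_comm]
    gcongr
  refine h5.trans ?_
  rw [abs_le] at h ⊢
  constructor <;> linarith

lemma ExponentBounds.rpow_norm_one_bounds (hp : ExponentBounds p p₀ P L pinf Cinf)
    (hS : IsBoxNorm p (fun _ => 1) S) {b : (Fin n → ℝ) × ℝ} (hb1 : 1 ≤ b.2) (hb2 : b.2 ≤ 2) :
    (Real.exp (pinf * unitLogConst n p₀ P L))⁻¹ ≤ S b ^ pinf ∧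
      S b ^ pinf ≤ Real.exp (pinf * unitLogConst n p₀ P L) := by
  have h := hp.abs_log_norm_one_le hS hb1 hb2
  have hi := hp.pinf_pos
  rw [abs_le] at h
  rw [← Real.exp_neg, Real.rpow_def_of_pos (hS b (by linarith)).1, Real.exp_le_exp,
    Real.exp_le_exp]
  constructor <;> nlinarith

/-- The number of blocks in a large cube is comparable to a power of the norm of `1`. -/
lemma RpowComparison.two_pow_le (hH : RpowComparison p pinf E H)
    (hp : ExponentBounds p p₀ P L pinf Cinf) (hS : IsBoxNorm p (fun _ => 1) S) {m : ℕ} {β : ℝ}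
    (hβ1 : 1 ≤ β) (hβ2 : β ≤ 2) {c : (Fin n → ℝ) × ℝ} (hc : c.2 = 2 ^ m * β) :
    (2 ^ m : ℝ) ^ n ≤ 2 * E * Real.exp (pinf * unitLogConst n p₀ P L) * S c ^ pinf := by
  have h1 := hS.childAvg_pow_le hp hH (fun _ => zero_le_one) hβ1 hβ2 hc
  have h2 := childAvg_pow_mono (V := fun j b => b.2 = 2 ^ j * β)
    (fun j b hb ε => by rw [child_snd, hb, pow_succ]; ring)
    (f := fun _ => (Real.exp (pinf * unitLogConst n p₀ P L))⁻¹) (g := fun b => S b ^ pinf)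
    (fun b hb => ?_) m c hc
  · have h3 : (childAvg n ^ m) (fun _ => (Real.exp (pinf * unitLogConst n p₀ P L))⁻¹) =
        fun _ => (Real.exp (pinf * unitLogConst n p₀ P L))⁻¹ := childAvg_pow_const m _
    rw [h3] at h2
    have h4 := h2.trans h1
    rw [inv_le_iff_one_le_mul₀ (Real.exp_pos _)] at h4
    have h5 : (0 : ℝ) < (2 ^ m) ^ n := by positivity
    calc (2 ^ m : ℝ) ^ n = (2 ^ m : ℝ) ^ n * 1 := (mul_one _).symm
      _ ≤ (2 ^ m : ℝ) ^ n * (2 * E * ((2 ^ m) ^ n)⁻¹ * S c ^ pinf *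
            Real.exp (pinf * unitLogConst n p₀ P L)) := by gcongr
      _ = _ := by field_simp
  · have hb : b.2 = β := by simpa using hb
    exact (hp.rpow_norm_one_bounds hS (hb ▸ hβ1) (hb ▸ hβ2)).1

lemma RpowComparison.rpow_norm_one_le (hH : RpowComparison p pinf E H)
    (hp : ExponentBounds p p₀ P L pinf Cinf) (hS : IsBoxNorm p (fun _ => 1) S) {m : ℕ} {β : ℝ}
    (hβ1 : 1 ≤ β) (hβ2 : β ≤ 2) {c : (Fin n → ℝ) × ℝ} (hc : c.2 = 2 ^ m * β) :
    ((2 ^ m : ℝ) ^ n)⁻¹ * S c ^ pinf ≤ 2 * E * Real.exp (pinf * unitLogConst n p₀ P L) := by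
  have hE := hH.one_le
  refine (hS.le_childAvg_pow hp hH (fun _ => zero_le_one) hβ1 hβ2 hc).trans ?_
  gcongr
  have h2 := childAvg_pow_mono (V := fun j b => b.2 = 2 ^ j * β)
    (fun j b hb ε => by rw [child_snd, hb, pow_succ]; ring)
    (g := fun _ => Real.exp (pinf * unitLogConst n p₀ P L)) (f := fun b => S b ^ pinf)
    (fun b hb => ?_) m c hc
  · have h3 : (childAvg n ^ m) (fun _ => Real.exp (pinf * unitLogConst n p₀ P L)) =
        fun _ => Real.exp (pinf * unitLogConst n p₀ P L) := childAvg_pow_const m _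
    rwa [h3] at h2
  · have hb : b.2 = β := by simpa using hb
    exact (hp.rpow_norm_one_bounds hS (hb ▸ hβ1) (hb ▸ hβ2)).2

/-- The local norms of the weight on blocks satisfy a reverse Jensen inequality at large scales. -/
lemma WeightBounds.log_childAvg_pow_le (hw : WeightBounds p w κ N S)
    (hp : ExponentBounds p p₀ P L pinf Cinf) (hH : RpowComparison p pinf E H) {m : ℕ} {β : ℝ}
    (hβ1 : 1 ≤ β) (hβ2 : β ≤ 2) {c : (Fin n → ℝ) × ℝ} (hc : c.2 = 2 ^ m * β) :
    Real.log ((childAvg n ^ m) (fun b => N b ^ pinf) c) ≤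
      (childAvg n ^ m) (fun b => Real.log (N b ^ pinf)) c +
        (pinf * κ + largeLogConst n p₀ P L pinf E) := by
  have hE := hH.one_le
  have hi := hp.pinf_pos
  have hc0 : 0 < c.2 := by rw [hc]; positivity
  have hNc := hw.norm_pos hc0
  have hSc := hw.norm_one_pos hc0
  have hM : (0 : ℝ) < (2 ^ m) ^ n := by positivity
  set σ := unitLogConst n p₀ P L with hσ
  have e1 := hw.isBoxNorm.childAvg_pow_le hp hH hw.nonneg hβ1 hβ2 hc
  have e2 := hw.isBoxNorm.le_childAvg_pow hp hH hw.nonneg hβ1 hβ2 hc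
  have e3 := hH.rpow_norm_one_le hp hw.isBoxNorm_one hβ1 hβ2 hc
  have hpos : 0 < (childAvg n ^ m) (fun b => N b ^ pinf) c := by
    have : 0 < ((2 ^ m : ℝ) ^ n)⁻¹ * N c ^ pinf := by positivity
    exact pos_of_mul_pos_right (this.trans_le e2) (by positivity)
  have f1 := Real.log_le_log hpos e1
  have f3 := Real.log_le_log (by positivity) e3
  rw [Real.log_mul (by positivity) (by positivity), Real.log_mul (by positivity) (by positivity),
    Real.log_inv, Real.log_rpow hNc] at f1
  rw [Real.log_mul (by positivity) (by positivity), Real.log_mul (by positivity) (by positivity),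
    Real.log_inv, Real.log_rpow hSc, Real.log_exp] at f3
  have f4 := hw.log_le c hc0
  -- On a block the mean of log w exceeds log(N/S) by at most D/p₀, and |log S| ≤ σ there; averaging
  -- over the blocks preserves the bound.
  have f5 : pinf * boxMean (fun x => Real.log (w x)) c ≤
      (childAvg n ^ m) (fun b => Real.log (N b ^ pinf)) c +
        pinf * (σ + smallConst n p₀ P L / p₀) := by
    have hcm : (childAvg n ^ m) (fun _ => pinf * (σ + smallConst n p₀ P L / p₀)) =
        fun _ => pinf * (σ + smallConst n p₀ P L / p₀) := childAvg_pow_const m _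
    have := childAvg_pow_mono (V := fun j b => b.2 = 2 ^ j * β)
      (fun j b hb ε => by rw [child_snd, hb, pow_succ]; ring)
      (f := pinf • boxMean fun x => Real.log (w x))
      (g := (fun b => Real.log (N b ^ pinf)) + fun _ => pinf * (σ + smallConst n p₀ P L / p₀))
      (fun b hb => ?_) m c hc
    · rwa [map_smul, map_add, Pi.smul_apply, Pi.add_apply, smul_eq_mul, hcm,
        childAvg_pow_boxMean _ m hc0 (hw.log_integrable c hc0)] at this
    · have hb : b.2 = β := by simpa using hb
      have hb0 : 0 < b.2 := by linarith
      have hNb := hw.norm_pos hb0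
      have hSb := hw.norm_one_pos hb0
      have g1 := hw.boxMean_log_le hp hb0 (hb ▸ hβ2)
      have g2 : boxMean (fun x => Real.log (w x / (N b / S b))) b =
          boxMean (fun x => Real.log (w x)) b - Real.log (N b / S b) := by
        rw [← boxMean_const hb0 (Real.log (N b / S b)), ← boxMean_sub
          (hw.log_integrable b hb0) (integrableOn_boxSet_const hb0 _), boxMean, boxMean]
        congr 1
        refine integral_congr_ae ?_
        filter_upwards [ae_restrict_of_ae hw.pos_ae] with x hx
        rw [Real.log_div hx.ne' (by positivity)]
      rw [g2, Real.log_div hNb.ne' hSb.ne'] at g1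
      have g3 := (abs_le.1 (hp.abs_log_norm_one_le hw.isBoxNorm_one (hb ▸ hβ1) (hb ▸ hβ2))).1
      simp only [Pi.smul_apply, Pi.add_apply, smul_eq_mul]
      rw [Real.log_rpow hNb, ← mul_add]
      gcongr
      linarith
  have f6 := mul_le_mul_of_nonneg_left f4 hi.le
  rw [largeLogConst]
  linarith

/-- The reverse Hölder inequality for the block norms in a large cube. -/
lemma WeightBounds.two_pow_mul_childAvg_pow_rpow_le (hw : WeightBounds p w κ N S)
    (hp : ExponentBounds p p₀ P L pinf Cinf) (hH : RpowComparison p pinf E H) {δ : ℝ}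
    (h0 : 0 ≤ δ) (h1 : δ ≤ 1 / 2)
    (hδ : 16 * 2 ^ n * δ * Real.exp (2 * (pinf * κ + largeLogConst n p₀ P L pinf E)) ≤ 1)
    {m : ℕ} {β : ℝ} (hβ1 : 1 ≤ β) (hβ2 : β ≤ 2) {c : (Fin n → ℝ) × ℝ} (hc : c.2 = 2 ^ m * β)
    (hNS : N c = S c) :
    (2 ^ m : ℝ) ^ n * (childAvg n ^ m) (fun b => (N b ^ pinf) ^ (1 + δ)) c ≤
      blockSumConst n p₀ P L pinf E * S c ^ pinf := by
  have hE := hH.one_le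
  have hi := hp.pinf_pos
  have hσ := hp.unitLogConst_nonneg
  have hc0 : 0 < c.2 := by rw [hc]; positivity
  have hSc := hw.norm_one_pos hc0
  have hexp : 1 ≤ Real.exp (pinf * unitLogConst n p₀ P L) := Real.one_le_exp (by positivity)
  have hpos : ∀ b : (Fin n → ℝ) × ℝ, b.2 = 2 ^ 0 * β → 0 < N b ^ pinf := fun b hb =>
    Real.rpow_pos_of_pos (hw.norm_pos (by rw [hb]; linarith)) _
  -- The tree is finite, its leaves are the blocks, and the leaf data are exactly a number and its
  -- logarithm, so no limit is involved.
  have key := childAvg_pow_rpow_le h0 h1 hδ (V := fun j b => b.2 = 2 ^ j * β)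
    (fun j b hb ε => by rw [child_snd, hb, pow_succ]; ring)
    (f := fun b => N b ^ pinf) (g := fun b => Real.log (N b ^ pinf)) hpos
    (fun b _ => le_rfl) (fun j b hb => hw.log_childAvg_pow_le hp hH hβ1 hβ2 hb) m c hc
  have hX : (childAvg n ^ m) (fun b => N b ^ pinf) c ≤
      2 * E * (2 * E * Real.exp (pinf * unitLogConst n p₀ P L)) := by
    refine (hw.isBoxNorm.childAvg_pow_le hp hH hw.nonneg hβ1 hβ2 hc).trans ?_
    rw [mul_assoc, hNS]
    exact mul_le_mul_of_nonneg_left (hH.rpow_norm_one_le hp hw.isBoxNorm_one hβ1 hβ2 hc)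
      (by positivity)
  have hX0 : 0 ≤ (childAvg n ^ m) (fun b => N b ^ pinf) c := by
    have := hw.isBoxNorm.le_childAvg_pow hp hH hw.nonneg hβ1 hβ2 hc
    have h2 : 0 < ((2 ^ m : ℝ) ^ n)⁻¹ * N c ^ pinf := by rw [hNS]; positivity
    exact (pos_of_mul_pos_right (h2.trans_le this) (by positivity)).le
  set X₀ := 2 * E * (2 * E * Real.exp (pinf * unitLogConst n p₀ P L)) with hX₀
  have hX1 : 1 ≤ X₀ := by
    have h2E : 1 ≤ 2 * E := by linarith
    exact one_le_mul_of_one_le_of_one_le h2E (one_le_mul_of_one_le_of_one_le h2E hexp)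
  have hpow : (childAvg n ^ m) (fun b => (N b ^ pinf) ^ (1 + δ)) c ≤ 2 * X₀ ^ 2 := by
    refine key.trans ?_
    gcongr
    calc (childAvg n ^ m) (fun b => N b ^ pinf) c ^ (1 + δ) ≤ X₀ ^ (1 + δ) :=
          Real.rpow_le_rpow hX0 hX (by linarith)
      _ ≤ X₀ ^ (2 : ℝ) := Real.rpow_le_rpow_of_exponent_le hX1 (by linarith)
      _ = X₀ ^ 2 := by norm_num
  calc (2 ^ m : ℝ) ^ n * (childAvg n ^ m) (fun b => (N b ^ pinf) ^ (1 + δ)) c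
      ≤ (2 ^ m : ℝ) ^ n * (2 * X₀ ^ 2) := by gcongr
    _ ≤ (2 * E * Real.exp (pinf * unitLogConst n p₀ P L) * S c ^ pinf) * (2 * X₀ ^ 2) := by
        gcongr
        exact hH.two_pow_le hp hw.isBoxNorm_one hβ1 hβ2 hc
    _ = _ := by rw [blockSumConst, ← hX₀]; ring

/-- The small-cube inequality gives integrability for edges at most 2, and larger cubes split into
finitely many of these. Changing the normalisation costs a bounded factor because p ≤ P. -/
lemma WeightBounds.integrableOn_rpow (hn : n ≠ 0) (hw : WeightBounds p w κ N S)
    (hp : ExponentBounds p p₀ P L pinf Cinf) {δ : ℝ} (h0 : 0 ≤ δ) (h1 : δ ≤ 1 / 2)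
    (hδ : 16 * 2 ^ n * δ * Real.exp (2 * (P * κ + smallLogConst n p₀ P L)) ≤ 1)
    {a : ℝ} (ha : 0 < a) {c : (Fin n → ℝ) × ℝ} (hc : 0 < c.2) :
    IntegrableOn (fun x => (w x / a) ^ ((1 + δ) * p x)) (boxSet c) := by
  refine integrableOn_boxSet_of_le two_pos (fun c hc hc2 => ?_) hc
  have hlam := div_pos (hw.norm_pos hc) (hw.norm_one_pos hc)
  have hr : 0 < 1 + δ := by linarith
  have hI : IntegrableOn (fun x => (w x / (N c / S c)) ^ ((1 + δ) * p x)) (boxSet c) := by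
    refine ⟨(hw.measurable_rpow hp _ _).aestronglyMeasurable, ?_⟩
    rw [hasFiniteIntegral_iff_ofReal (Filter.Eventually.of_forall fun x =>
      Real.rpow_nonneg (div_nonneg (hw.nonneg x) hlam.le) _)]
    exact (hw.lintegral_rpow_le_of_snd_le hn hp h0 h1 hδ hc hc2).trans_lt ENNReal.ofReal_lt_top
  set lam := N c / S c
  set b := max 1 (lam / a) with hb
  have hb1 : 1 ≤ b := le_max_left _ _
  refine (hI.const_mul (b ^ ((1 + δ) * P))).mono'
    (hw.measurable_rpow hp a _).aestronglyMeasurable (Filter.Eventually.of_forall fun x => ?_)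
  have h0 : 0 ≤ w x / lam := div_nonneg (hw.nonneg x) hlam.le
  rw [Real.norm_eq_abs, abs_of_nonneg (Real.rpow_nonneg (div_nonneg (hw.nonneg x) ha.le) _)]
  calc (w x / a) ^ ((1 + δ) * p x)
      = (lam / a) ^ ((1 + δ) * p x) * (w x / lam) ^ ((1 + δ) * p x) := by
        rw [← Real.mul_rpow (by positivity) h0]; congr 1; field_simp
    _ ≤ b ^ ((1 + δ) * P) * (w x / lam) ^ ((1 + δ) * p x) := by
        gcongr
        calc (lam / a) ^ ((1 + δ) * p x) ≤ b ^ ((1 + δ) * p x) :=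
              Real.rpow_le_rpow (by positivity) (le_max_right _ _)
                (mul_pos hr (hp.pos x)).le
          _ ≤ b ^ ((1 + δ) * P) := Real.rpow_le_rpow_of_exponent_le hb1
                (by gcongr; exact hp.upper x)

lemma ExponentBounds.integrableOn_mul_rpow (hp : ExponentBounds p p₀ P L pinf Cinf)
    {F : EuclideanSpace ℝ (Fin n) → ℝ} {s : Set (EuclideanSpace ℝ (Fin n))}
    (hF : IntegrableOn F s) {a : ℝ} (ha : 0 ≤ a) : IntegrableOn (fun x => F x * a ^ p x) s := by
  refine Integrable.mul_bdd (c := max 1 a ^ P) hF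
    (measurable_const.pow hp.measurable).aestronglyMeasurable
    (Filter.Eventually.of_forall fun x => ?_)
  rw [Real.norm_eq_abs, abs_of_nonneg (Real.rpow_nonneg ha _)]
  calc a ^ p x ≤ max 1 a ^ p x := Real.rpow_le_rpow ha (le_max_right _ _) (hp.pos x).le
    _ ≤ max 1 a ^ P := Real.rpow_le_rpow_of_exponent_le (le_max_left _ _) (hp.upper x)

/-- The reverse Hölder inequality on large cubes. -/
theorem WeightBounds.setIntegral_rpow_mul_le (hn : n ≠ 0) (hw : WeightBounds p w κ N S)
    (hp : ExponentBounds p p₀ P L pinf Cinf) (hH : RpowComparison p pinf E H) {δ : ℝ}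
    (h0 : 0 ≤ δ) (h1 : δ ≤ 1 / 2)
    (hδ : 16 * 2 ^ n * δ * Real.exp (2 * (P * κ + smallLogConst n p₀ P L)) ≤ 1)
    (hδ' : 16 * 2 ^ n * δ * Real.exp (2 * (pinf * κ + largeLogConst n p₀ P L pinf E)) ≤ 1)
    {m : ℕ} {β : ℝ} (hβ1 : 1 ≤ β) (hβ2 : β ≤ 2) {c : (Fin n → ℝ) × ℝ} (hc : c.2 = 2 ^ m * β)
    (hNS : N c = S c) :
    ∫ x in boxSet c, w x ^ ((1 + δ) * p x) * (1 / S c) ^ p x ≤ largeConst n p₀ P L pinf E := by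
  have hE := hH.one_le
  have hi := hp.pinf_pos
  have hσ := hp.unitLogConst_nonneg
  have hβ0 : 0 < β := by linarith
  have hc0 : 0 < c.2 := by rw [hc]; positivity
  have hSc := hw.norm_one_pos hc0
  have hr : 0 < 1 + δ := by linarith
  have hD1 := hp.one_le_smallConst
  set Y := blockSumConst n p₀ P L pinf E with hY
  have hY1 : 1 ≤ Y := by
    have h2E : 1 ≤ 2 * E := by linarith
    have h3 : 1 ≤ 2 * E * Real.exp (pinf * unitLogConst n p₀ P L) :=
      one_le_mul_of_one_le_of_one_le h2E (Real.one_le_exp (by positivity))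
    have h4 := one_le_mul_of_one_le_of_one_le h2E h3
    exact one_le_mul_of_one_le_of_one_le
      (one_le_mul_of_one_le_of_one_le one_le_two (one_le_pow₀ h4)) h3
  have hY0 : 0 < Y := by linarith
  set σ := unitLogConst n p₀ P L with hσdef
  set K₀ := 2 * (1 + smallConst n p₀ P L) ^ 2 with hK₀
  have hK₀0 : 0 < K₀ := by positivity
  set M := Real.exp (2 * σ) * Y ^ (1 / pinf) with hM
  have hM1 : 1 ≤ M := one_le_mul_of_one_le_of_one_le (Real.one_le_exp (by positivity))
    (Real.one_le_rpow hY1 (by positivity))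
  set F : EuclideanSpace ℝ (Fin n) → ℝ := fun x => w x ^ ((1 + δ) * p x) * (1 / S c) ^ p x with hF
  have hwI : ∀ b : (Fin n → ℝ) × ℝ, 0 < b.2 →
      IntegrableOn (fun x => w x ^ ((1 + δ) * p x)) (boxSet b) := fun b hb => by
    simpa using hw.integrableOn_rpow hn hp h0 h1 hδ one_pos hb
  have hFI : ∀ b : (Fin n → ℝ) × ℝ, 0 < b.2 → IntegrableOn F (boxSet b) := fun b hb =>
    hp.integrableOn_mul_rpow (hwI b hb) (by positivity)
  set U : (Fin n → ℝ) × ℝ → ℝ := fun b => (N b ^ pinf) ^ (1 + δ) with hU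
  have hsum := hw.two_pow_mul_childAvg_pow_rpow_le hp hH h0 h1 hδ' hβ1 hβ2 hc hNS
  have hUnn : ∀ b, 0 < b.2 → 0 ≤ U b := fun b hb => by
    have := hw.norm_pos hb
    positivity
  have hUpow : ∀ (j : ℕ) (b : (Fin n → ℝ) × ℝ), 0 < b.2 → 0 ≤ (childAvg n ^ j) U b := by
    intro j b hb
    have := childAvg_pow_mono (V := fun _ b => 0 < b.2) (fun _ _ hb ε => half_pos hb)
      (f := 0) (g := U) hUnn j b hb
    simpa using this
  -- The second condition in V passes the bound on the total sum of U down to every subcube, the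
  -- terms being nonnegative. On a single block it reads U(b) ≤ Y·S(c)^pinf.
  have hmono := childAvg_pow_mono
    (V := fun j b => b.2 = 2 ^ j * β ∧ (2 ^ j : ℝ) ^ n * (childAvg n ^ j) U b ≤ Y * S c ^ pinf)
    (fun j b hb ε => ⟨by rw [child_snd, hb.1, pow_succ]; ring, ?_⟩)
    (f := β ^ n • boxMean F)
    (g := (2 ^ n * K₀ * M ^ P) • ((E / (Y * S c ^ pinf)) • U + β ^ n • boxMean H))
    (fun b hb => ?_) m c ⟨hc, hsum⟩
  · rw [map_smul, map_smul, map_add, map_smul, map_smul, Pi.smul_apply, Pi.smul_apply,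
      Pi.add_apply, Pi.smul_apply, Pi.smul_apply, childAvg_pow_boxMean _ m hc0 (hFI c hc0),
      childAvg_pow_boxMean _ m hc0 hH.integrable.integrableOn, boxMean, boxMean, hc] at hmono
    simp only [smul_eq_mul] at hmono
    have hI := hH.setIntegral_le (boxSet c)
    have hT : (0 : ℝ) < (2 ^ m) ^ n := by positivity
    have hb : ∀ I : ℝ, (2 ^ m : ℝ) ^ n * (β ^ n * (((2 ^ m * β) ^ n)⁻¹ * I)) = I := by
      intro I; rw [mul_pow]; field_simp
    have hUs : E / (Y * S c ^ pinf) * ((2 ^ m : ℝ) ^ n * (childAvg n ^ m) U c) ≤ E := by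
      rw [div_mul_eq_mul_div, div_le_iff₀ (by positivity)]
      gcongr
    calc ∫ x in boxSet c, F x
        = (2 ^ m : ℝ) ^ n * (β ^ n * (((2 ^ m * β) ^ n)⁻¹ * ∫ x in boxSet c, F x)) := (hb _).symm
      _ ≤ (2 ^ m : ℝ) ^ n * (2 ^ n * K₀ * M ^ P * (E / (Y * S c ^ pinf) * (childAvg n ^ m) U c +
            β ^ n * (((2 ^ m * β) ^ n)⁻¹ * ∫ x in boxSet c, H x))) := by gcongr
      _ = 2 ^ n * K₀ * M ^ P * (E / (Y * S c ^ pinf) * ((2 ^ m : ℝ) ^ n * (childAvg n ^ m) U c) +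
            (2 ^ m : ℝ) ^ n * (β ^ n * (((2 ^ m * β) ^ n)⁻¹ * ∫ x in boxSet c, H x))) := by ring
      _ ≤ 2 ^ n * K₀ * M ^ P * (2 * E) := by
          rw [hb]
          gcongr
          linarith
      _ = largeConst n p₀ P L pinf E := rfl
  · refine le_trans ?_ hb.2
    have hb0 : 0 < b.2 := by rw [hb.1]; positivity
    rw [childAvg_pow_succ_apply, pow_succ, mul_pow, mul_assoc, mul_inv_cancel_left₀ (by positivity)]
    gcongr
    exact Finset.single_le_sum (f := fun ε => (childAvg n ^ j) U (child b ε))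
      (fun ε' _ => hUpow j _ (half_pos hb0)) (Finset.mem_univ ε)
  · obtain ⟨hb, hUb⟩ := hb
    rw [pow_zero, one_mul] at hb
    simp only [pow_zero, one_pow, one_mul, Module.End.one_apply] at hUb
    have hb0 : 0 < b.2 := by linarith
    have hNb := hw.norm_pos hb0
    have hSb := hw.norm_one_pos hb0
    have hlam : 0 < N b / S b := div_pos hNb hSb
    -- Normalised so that s^pinf is the share of the block in the bound Y·S(c)^pinf. Thus s ≤ 1, as
    -- the comparison of powers requires, and the shares add up to at most 1.
    set s := N b ^ (1 + δ) / (Y ^ (1 / pinf) * S c) with hs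
    have hs0 : 0 ≤ s := by positivity
    have hspow : s ^ pinf = U b / (Y * S c ^ pinf) := by
      change s ^ pinf = (N b ^ pinf) ^ (1 + δ) / _
      rw [hs, Real.div_rpow (by positivity) (by positivity), Real.mul_rpow (by positivity)
        hSc.le, ← Real.rpow_mul hY0.le, one_div_mul_cancel hi.ne', Real.rpow_one,
        ← Real.rpow_mul hNb.le, ← Real.rpow_mul hNb.le, mul_comm pinf]
    have hs1 : s ≤ 1 := by
      have : s ^ pinf ≤ 1 := by rw [hspow, div_le_one (by positivity)]; exact hUb
      by_contra! hlt
      have := Real.one_lt_rpow hlt hi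
      linarith
    have hlamr : (N b / S b) ^ (1 + δ) / S c ≤ M * s := by
      have h3 : N b / S b ≤ N b * Real.exp σ := by
        rw [div_eq_mul_inv]
        gcongr
        have := (abs_le.1 (hp.abs_log_norm_one_le hw.isBoxNorm_one (hb ▸ hβ1) (hb ▸ hβ2))).1
        rw [← Real.exp_log (inv_pos.2 hSb), Real.log_inv, Real.exp_le_exp]
        linarith
      have h4 : (N b / S b) ^ (1 + δ) ≤ N b ^ (1 + δ) * Real.exp (2 * σ) := by
        calc (N b / S b) ^ (1 + δ) ≤ (N b * Real.exp σ) ^ (1 + δ) := by gcongr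
          _ = N b ^ (1 + δ) * Real.exp (σ * (1 + δ)) := by
            rw [Real.mul_rpow hNb.le (Real.exp_pos _).le, ← Real.exp_mul]
          _ ≤ _ := mul_le_mul_of_nonneg_left (Real.exp_le_exp.2 (by nlinarith)) (by positivity)
      calc (N b / S b) ^ (1 + δ) / S c ≤ N b ^ (1 + δ) * Real.exp (2 * σ) / S c := by gcongr
        _ = M * s := by rw [hM, hs]; field_simp
    -- Here w is split into its average on the block and w divided by that average. The average
    -- contributes at most (Ms)^p(x), to which the comparison of powers applies; the rest is left to
    -- the small-cube inequality.
    have hpt : ∀ x ∈ boxSet b, F x ≤ (M ^ P * (E * s ^ pinf + ∫ y in boxSet b, H y)) *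
        (w x / (N b / S b)) ^ ((1 + δ) * p x) := by
      intro x hx
      have hv : 0 ≤ w x / (N b / S b) := div_nonneg (hw.nonneg x) hlam.le
      have e1 : F x = (w x / (N b / S b)) ^ ((1 + δ) * p x) *
          ((N b / S b) ^ (1 + δ) / S c) ^ p x := by
        change w x ^ ((1 + δ) * p x) * (1 / S c) ^ p x = _
        rw [one_div, Real.inv_rpow hSc.le, Real.div_rpow (Real.rpow_nonneg hlam.le _) hSc.le,
          ← Real.rpow_mul hlam.le, mul_div_assoc', ← Real.mul_rpow hv hlam.le,
          div_mul_cancel₀ _ hlam.ne', div_eq_mul_inv]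
      have e2 : ((N b / S b) ^ (1 + δ) / S c) ^ p x ≤
          M ^ P * (E * s ^ pinf + ∫ y in boxSet b, H y) := by
        calc ((N b / S b) ^ (1 + δ) / S c) ^ p x ≤ (M * s) ^ p x :=
              Real.rpow_le_rpow (by positivity) hlamr (hp.pos x).le
          _ = M ^ p x * s ^ p x := Real.mul_rpow (by linarith) hs0
          _ ≤ M ^ P * (E * s ^ pinf + ∫ y in boxSet b, H y) := by
              refine mul_le_mul (Real.rpow_le_rpow_of_exponent_le hM1 (hp.upper x))
                (hH.rpow_le b (hb ▸ hβ1) (hb ▸ hβ2) x hx s hs0 hs1) (by positivity) (by positivity)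
      rw [e1, mul_comm]
      gcongr
    have hHb : 0 ≤ ∫ y in boxSet b, H y := integral_nonneg hH.nonneg
    have hsmall : ∫ x in boxSet b, (w x / (N b / S b)) ^ ((1 + δ) * p x) ≤ 2 ^ n * K₀ := by
      have h3 := hw.lintegral_rpow_le_of_snd_le hn hp h0 h1 hδ hb0 (hb ▸ hβ2)
      rw [integral_eq_lintegral_of_nonneg_ae (Filter.Eventually.of_forall fun x =>
        Real.rpow_nonneg (div_nonneg (hw.nonneg x) hlam.le) _)
        (hw.measurable_rpow hp _ _).aestronglyMeasurable]
      refine (ENNReal.toReal_le_of_le_ofReal (by positivity) h3).trans ?_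
      rw [hb, ← hK₀]
      gcongr
    have hint : ∫ x in boxSet b, F x ≤
        (M ^ P * (E * s ^ pinf + ∫ y in boxSet b, H y)) * (2 ^ n * K₀) := by
      refine (setIntegral_mono_on (hFI b hb0) ((hw.integrableOn_rpow hn hp h0 h1 hδ hlam
        hb0).const_mul _) (measurableSet_boxSet b) hpt).trans ?_
      rw [integral_const_mul]
      gcongr
    rw [setIntegral_eq_boxMean F hb0, setIntegral_eq_boxMean H hb0, hb, hspow] at hint
    simp only [Pi.smul_apply, Pi.add_apply, smul_eq_mul]
    refine hint.trans (le_of_eq ?_)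
    ring

end Large

/-! ### All cubes in modular form -/

/-- The reverse Hölder inequality on all cubes, in modular form. -/
theorem exists_reverseHolder_modular {n : ℕ} (hn : n ≠ 0) {p₀ P L pinf Cinf : ℝ} (hp₀ : 0 < p₀)
    (hCinf : 0 ≤ Cinf) :
    ∃ K a B : ℝ, 1 ≤ K ∧ ∀ (p w : EuclideanSpace ℝ (Fin n) → ℝ) (κ : ℝ)
      (N S : (Fin n → ℝ) × ℝ → ℝ), ExponentBounds p p₀ P L pinf Cinf → WeightBounds p w κ N S →
        -B ≤ κ ∧ ∀ δ : ℝ, 0 ≤ δ → δ * Real.exp (2 * P * κ + a) ≤ 1 →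
          ∀ c : (Fin n → ℝ) × ℝ, 0 < c.2 →
            ∫⁻ x in boxSet c,
              ENNReal.ofReal ((w x / (N c / S c)) ^ ((1 + δ) * p x) * (1 / S c) ^ p x) ≤
                ENNReal.ofReal K := by
  obtain ⟨E, H, hE, hHnn, hHint, hHle, hcomp⟩ := exists_rpow_comparison n hp₀ hCinf
  set D := smallConst n p₀ P L with hD
  set B := D / p₀ with hB
  set K₁ := D * (2 * (1 + D) ^ 2) with hK₁
  set K₂ := largeConst n p₀ P L pinf E with hK₂
  set k₁ := smallLogConst n p₀ P L with hk₁
  set k₂ := largeLogConst n p₀ P L pinf E with hk₂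
  -- κ may be negative but is at least -B. Adding PB makes Pκ + PB nonnegative and at least pinf·κ,
  -- so one condition on δ covers both scales and δ ≤ 1/2.
  set a := Real.log (16 * 2 ^ n) + 2 * (|k₁| + |k₂| + P * B) with ha
  refine ⟨max 1 (max K₁ K₂), a, B, le_max_left _ _, fun p w κ N S hp hw => ?_⟩
  have hH : RpowComparison p pinf E H := ⟨hE, hHnn, hHint, hHle,
    fun c hc1 hc2 x hx s hs0 hs1 => (hcomp p P L pinf hp c hc1 hc2 x hx s hs0 hs1).1,
    fun c hc1 hc2 x hx s hs0 hs1 => (hcomp p P L pinf hp c hc1 hc2 x hx s hs0 hs1).2⟩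
  have hκ : -B ≤ κ := hw.neg_le_const hp
  refine ⟨hκ, fun δ h0 hδ c hc => ?_⟩
  have hD1 : 1 ≤ D := hp.one_le_smallConst
  have hD0 : 0 < D := by linarith
  have hB0 : 0 ≤ B := by positivity
  have hP := hp.P_pos
  have hi := hp.pinf_pos
  have hPκ : -(P * B) ≤ P * κ := by nlinarith
  have hsuff : ∀ k, k ≤ P * κ + (|k₁| + |k₂| + P * B) →
      16 * 2 ^ n * δ * Real.exp (2 * k) ≤ 1 := by
    intro k hk
    refine le_trans ?_ hδ
    have h16 : (16 : ℝ) * 2 ^ n = Real.exp (Real.log (16 * 2 ^ n)) :=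
      (Real.exp_log (by positivity)).symm
    rw [mul_right_comm, mul_comm _ δ, h16, ← Real.exp_add]
    refine mul_le_mul_of_nonneg_left (Real.exp_le_exp.2 ?_) h0
    rw [ha]
    linarith
  have hδ1 := hsuff (P * κ + k₁) (by
    have := le_abs_self k₁
    have := abs_nonneg k₂
    nlinarith)
  have hδ2 := hsuff (pinf * κ + k₂) (by
    have := le_abs_self k₂
    have := abs_nonneg k₁
    have h3 : 0 ≤ (P - pinf) * (κ + B) := mul_nonneg (by linarith [hp.pinf_upper]) (by linarith)
    nlinarith)
  have h1 : δ ≤ 1 / 2 := by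
    have h := hsuff 0 (by
      have := abs_nonneg k₁
      have := abs_nonneg k₂
      linarith)
    rw [mul_zero, Real.exp_zero, mul_one] at h
    have : (1 : ℝ) ≤ 2 ^ n := one_le_pow₀ one_le_two
    nlinarith
  have hlam := div_pos (hw.norm_pos hc) (hw.norm_one_pos hc)
  have hSc := hw.norm_one_pos hc
  have hnn : ∀ x, 0 ≤ (w x / (N c / S c)) ^ ((1 + δ) * p x) := fun x =>
    Real.rpow_nonneg (div_nonneg (hw.nonneg x) hlam.le) _
  rcases le_or_gt c.2 2 with hc2 | hc2
  · calc ∫⁻ x in boxSet c,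
          ENNReal.ofReal ((w x / (N c / S c)) ^ ((1 + δ) * p x) * (1 / S c) ^ p x)
        ≤ ∫⁻ x in boxSet c, ENNReal.ofReal (D * (c.2 ^ n)⁻¹) *
            ENNReal.ofReal ((w x / (N c / S c)) ^ ((1 + δ) * p x)) := by
          refine setLIntegral_mono' (measurableSet_boxSet c) fun x hx => ?_
          rw [← ENNReal.ofReal_mul (by positivity), mul_comm]
          exact ENNReal.ofReal_le_ofReal (mul_le_mul_of_nonneg_right
            (hp.one_div_rpow_le hw.isBoxNorm_one hc hc2 hx) (hnn x))
      _ = ENNReal.ofReal (D * (c.2 ^ n)⁻¹) * ∫⁻ x in boxSet c,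
            ENNReal.ofReal ((w x / (N c / S c)) ^ ((1 + δ) * p x)) :=
          lintegral_const_mul _ (hw.measurable_rpow hp _ _).ennreal_ofReal
      _ ≤ ENNReal.ofReal (D * (c.2 ^ n)⁻¹) * ENNReal.ofReal (c.2 ^ n * (2 * (1 + D) ^ 2)) := by
          gcongr
          exact hw.lintegral_rpow_le_of_snd_le hn hp h0 h1 hδ1 hc hc2
      _ = ENNReal.ofReal K₁ := by
          rw [← ENNReal.ofReal_mul (by positivity), hK₁]
          congr 1
          field_simp
      _ ≤ _ := ENNReal.ofReal_le_ofReal ((le_max_left _ _).trans (le_max_right _ _))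
  -- The largest power 2^m not exceeding the edge leaves blocks of edge in [1, 2).
  · obtain ⟨m, hm1, hm2⟩ := exists_nat_pow_near (show (1 : ℝ) ≤ c.2 by linarith) one_lt_two
    have hcm : c.2 = 2 ^ m * (c.2 / 2 ^ m) := by field_simp
    have hβ1 : 1 ≤ c.2 / 2 ^ m := by rwa [one_le_div (by positivity)]
    have hβ2 : c.2 / 2 ^ m ≤ 2 := by
      rw [div_le_iff₀ (by positivity)]
      rw [pow_succ] at hm2
      linarith
    have hI := hp.integrableOn_mul_rpow (hw.integrableOn_rpow hn hp h0 h1 hδ1 hlam hc)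
      (a := 1 / S c) (by positivity)
    rw [← ofReal_integral_eq_lintegral_ofReal hI (Filter.Eventually.of_forall fun x =>
      mul_nonneg (hnn x) (by positivity))]
    refine ENNReal.ofReal_le_ofReal (le_trans ?_ ((le_max_right K₁ K₂).trans (le_max_right _ _)))
    exact (hw.div_const hlam).setIntegral_rpow_mul_le hn hp hH h0 h1 hδ1 hδ2 hβ1 hβ2 hcm
      (div_div_cancel₀ (hw.norm_pos hc).ne')

/-! ### Bounds from log-Hölder continuity -/

section Exponent

variable {n : ℕ} {p : EuclideanSpace ℝ (Fin n) → ℝ} {C₀ pinf Cinf : ℝ}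

lemma one_le_log_exp_one_add {t : ℝ} (ht : 0 ≤ t) : 1 ≤ Real.log (Real.exp 1 + t) := by
  have := Real.log_le_log (Real.exp_pos 1) (show Real.exp 1 ≤ Real.exp 1 + t by linarith)
  rwa [Real.log_exp] at this

lemma IsLogHolder.abs_sub_pinf_le (h : IsLogHolder p C₀ pinf Cinf)
    (x : EuclideanSpace ℝ (Fin n)) : |p x - pinf| ≤ Cinf :=
  (h.infty x).trans (div_le_self h.Cinf_pos.le (one_le_log_exp_one_add (norm_nonneg x)))

lemma IsLogHolder.continuous (h : IsLogHolder p C₀ pinf Cinf) : Continuous p := by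
  rw [Metric.continuous_iff]
  intro y ε hε
  refine ⟨min (1 / 2) (Real.exp (-(C₀ / ε))), by positivity, fun x hx => ?_⟩
  rw [dist_eq_norm, lt_min_iff] at hx
  rw [Real.dist_eq]
  rcases eq_or_ne x y with rfl | hne
  · simpa using hε
  have hd : 0 < ‖x - y‖ := norm_pos_iff.2 (sub_ne_zero.2 hne)
  have hlog : Real.log ‖x - y‖ < -(C₀ / ε) := by
    rw [Real.log_lt_iff_lt_exp hd]; exact hx.2
  have hCε : 0 < C₀ / ε := div_pos h.C₀_pos hε
  refine (h.loc x y hx.1).trans_lt ?_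
  rw [neg_div, ← div_neg, div_lt_iff₀ (by linarith)]
  have : C₀ = ε * (C₀ / ε) := by field_simp
  nlinarith

/-- By continuity the exceptional set is open; being null, it is empty. -/
lemma IsLogHolder.essInf_le (h : IsLogHolder p C₀ pinf Cinf) (x : EuclideanSpace ℝ (Fin n)) :
    essInf p volume ≤ p x := by
  have hb : Filter.IsBoundedUnder (· ≥ ·) (ae volume) p :=
    ⟨pinf - Cinf, Filter.eventually_map.2 (Filter.Eventually.of_forall fun y => by
      have := (abs_le.1 (h.abs_sub_pinf_le y)).1
      simp only [ge_iff_le]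
      linarith)⟩
  have hopen : IsOpen {y | p y < essInf p volume} := isOpen_lt h.continuous continuous_const
  have hnull : volume {y | p y < essInf p volume} = 0 := by
    have := ae_essInf_le hb
    rw [ae_iff] at this
    simpa using this
  have hempty := hopen.eq_empty_of_measure_zero hnull
  by_contra! hlt
  exact (hempty ▸ (show x ∈ {y | p y < essInf p volume} from hlt) : x ∈ (∅ : Set _))

lemma IsLogHolder.le_pinf (hn : n ≠ 0) (h : IsLogHolder p C₀ pinf Cinf) {p₀ : ℝ}
    (hp₀ : ∀ x, p₀ ≤ p x) : p₀ ≤ pinf := by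
  by_contra! hlt
  have : Nonempty (Fin n) := ⟨⟨0, Nat.pos_of_ne_zero hn⟩⟩
  obtain ⟨x, hx⟩ := NormedSpace.exists_lt_norm ℝ (EuclideanSpace ℝ (Fin n))
    (Real.exp (Cinf / (p₀ - pinf)))
  have h1 : Cinf / (p₀ - pinf) < Real.log (Real.exp 1 + ‖x‖) := by
    rw [Real.lt_log_iff_exp_lt (by positivity)]
    linarith [Real.exp_pos 1]
  have h2 := (abs_le.1 (h.infty x)).2
  have h3 := one_le_log_exp_one_add (norm_nonneg x)
  have h4 : p₀ - pinf ≤ Cinf / Real.log (Real.exp 1 + ‖x‖) := by linarith [hp₀ x]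
  rw [le_div_iff₀ (by linarith)] at h4
  rw [div_lt_iff₀ (by linarith)] at h1
  linarith

/-- Oscillation constant of a log-Hölder continuous exponent on cubes. -/
noncomputable def oscConst (n : ℕ) (C₀ Cinf : ℝ) : ℝ :=
  C₀ * (1 + Real.log √n / Real.log 2) + 2 * Cinf * Real.log (2 * √n)

/-- Edges at least 1 make the left side nonpositive. For points closer than 1/2, the local condition
applies with |x - y| ≤ √n·edge; otherwise the edge is at least 1/(2√n) and both factors are bounded.
-/
lemma IsLogHolder.abs_sub_mul_neg_log_le (hn : n ≠ 0) (h : IsLogHolder p C₀ pinf Cinf)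
    {c : (Fin n → ℝ) × ℝ} (hc : 0 < c.2) {x y : EuclideanSpace ℝ (Fin n)} (hx : x ∈ boxSet c)
    (hy : y ∈ boxSet c) : |p x - p y| * -Real.log c.2 ≤ oscConst n C₀ Cinf := by
  have hC₀ := h.C₀_pos
  have hCinf := h.Cinf_pos
  have hs1 : 1 ≤ √(n : ℝ) := by
    rw [Real.one_le_sqrt]; exact_mod_cast Nat.one_le_iff_ne_zero.2 hn
  have hs0 : 0 < √(n : ℝ) := by linarith
  have hlogs : 0 ≤ Real.log √n := Real.log_nonneg hs1
  have hlog2 : 0 < Real.log 2 := Real.log_pos one_lt_two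
  have hlog2s : 0 ≤ Real.log (2 * √n) := Real.log_nonneg (by linarith)
  have hd := norm_sub_le_of_mem_boxSet hc hx hy
  have hA : 0 ≤ C₀ * (1 + Real.log √n / Real.log 2) := by positivity
  have hBn : 0 ≤ 2 * Cinf * Real.log (2 * √n) := by positivity
  unfold oscConst
  rcases le_or_gt 0 (Real.log c.2) with hl | hl
  · nlinarith [abs_nonneg (p x - p y)]
  rcases eq_or_ne x y with rfl | hne
  · simp only [sub_self, abs_zero, zero_mul]; linarith
  have hpos : 0 < ‖x - y‖ := norm_pos_iff.2 (sub_ne_zero.2 hne)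
  rcases lt_or_ge ‖x - y‖ (1 / 2) with hlt | hge
  · have e1 := h.loc x y hlt
    have e2 : Real.log ‖x - y‖ < -Real.log 2 := by
      rw [← Real.log_inv]
      exact Real.log_lt_log hpos (by rwa [← one_div])
    have e3 : Real.log ‖x - y‖ ≤ Real.log √n + Real.log c.2 := by
      rw [← Real.log_mul hs0.ne' hc.ne']; exact Real.log_le_log hpos hd
    set t := -Real.log ‖x - y‖ with ht
    have ht0 : Real.log 2 < t := by linarith
    have e4 : |p x - p y| ≤ C₀ / t := by rwa [neg_div, ← div_neg] at e1
    -- As t > log 2, the additive loss log √n becomes a factor of t, which cancels against C₀/t.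
    have e5 : Real.log √n ≤ t * (Real.log √n / Real.log 2) := by
      rw [mul_div_assoc', le_div_iff₀ hlog2]
      nlinarith
    calc |p x - p y| * -Real.log c.2 ≤ C₀ / t * (t * (1 + Real.log √n / Real.log 2)) :=
          mul_le_mul e4 (by linarith) (by linarith) (div_nonneg hC₀.le (by linarith))
      _ = C₀ * (1 + Real.log √n / Real.log 2) := by
          have : t ≠ 0 := by linarith
          field_simp
      _ ≤ _ := by linarith
  · have e1 : |p x - p y| ≤ 2 * Cinf := by
      have h1 := abs_le.1 (h.abs_sub_pinf_le x)
      have h2 := abs_le.1 (h.abs_sub_pinf_le y)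
      rw [abs_le]
      constructor <;> linarith
    have e2 : -Real.log c.2 ≤ Real.log (2 * √n) := by
      rw [← Real.log_inv]
      refine Real.log_le_log (by positivity) ?_
      rw [inv_le_iff_one_le_mul₀ hc]
      linarith
    calc |p x - p y| * -Real.log c.2 ≤ 2 * Cinf * Real.log (2 * √n) :=
          mul_le_mul e1 e2 (by linarith) (by positivity)
      _ ≤ _ := by linarith

lemma IsLogHolder.exponentBounds (hn : n ≠ 0) (hp : IsExponentP0 p)
    (h : IsLogHolder p C₀ pinf Cinf) :
    ExponentBounds p (essInf p volume) (pinf + Cinf) (oscConst n C₀ Cinf) pinf Cinf where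
  measurable := hp.measurable
  p₀_pos := hp.essInf_pos
  lower := h.essInf_le
  upper x := by linarith [(abs_le.1 (h.abs_sub_pinf_le x)).2]
  lower_pinf := h.le_pinf hn h.essInf_le
  pinf_upper := by linarith [h.Cinf_pos]
  L_nonneg := by
    have := h.abs_sub_mul_neg_log_le hn (c := (0, 1)) one_pos (corner_mem_boxSet one_pos)
      (corner_mem_boxSet one_pos)
    simpa using this
  Cinf_nonneg := h.Cinf_pos.le
  osc c hc x hx y hy := h.abs_sub_mul_neg_log_le hn hc hx hy
  infty := h.infty

end Exponent

/-! ### Modular and Luxemburg norm -/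

section Norm

variable {n : ℕ} {q f : EuclideanSpace ℝ (Fin n) → ℝ} {q₀ R : ℝ}

lemma varNorm_le {t : ℝ} (ht : 0 < t) (h : varModular q (fun x => f x / t) ≤ 1) :
    varNorm q f ≤ ENNReal.ofReal t :=
  iInf_le_of_le t (iInf_le_of_le ht (iInf_le_of_le h le_rfl))

lemma varModular_div_mono (hq : ∀ x, 0 ≤ q x) {s t : ℝ} (hs : 0 < s) (hst : s ≤ t) :
    varModular q (fun x => f x / t) ≤ varModular q fun x => f x / s := by
  refine lintegral_mono fun x => ENNReal.ofReal_le_ofReal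
    (Real.rpow_le_rpow (abs_nonneg _) ?_ (hq x))
  rw [abs_div, abs_div, abs_of_pos hs, abs_of_pos (hs.trans_le hst)]
  gcongr

lemma varModular_div_le_mul (hR : ∀ x, q x ≤ R) {s t : ℝ} (hs : 1 ≤ s)
    (ht : 0 < t) : varModular q (fun x => f x / t) ≤
      ENNReal.ofReal (s ^ R) * varModular q fun x => f x / (s * t) := by
  have hs0 : 0 < s := by linarith
  rw [varModular, varModular, ← lintegral_const_mul' _ _ ENNReal.ofReal_ne_top]
  refine lintegral_mono fun x => ?_
  rw [← ENNReal.ofReal_mul (by positivity)]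
  refine ENNReal.ofReal_le_ofReal ?_
  have h : |f x / t| = s * |f x / (s * t)| := by
    rw [abs_div, abs_div, abs_mul, abs_of_pos hs0]
    field_simp
  rw [h, Real.mul_rpow hs0.le (abs_nonneg _)]
  exact mul_le_mul_of_nonneg_right (Real.rpow_le_rpow_of_exponent_le hs (hR x)) (by positivity)

lemma varModular_div_mul_le (hq : ∀ x, q₀ ≤ q x) {s t : ℝ} (hs : 1 ≤ s)
    (ht : 0 < t) : varModular q (fun x => f x / (s * t)) ≤
      ENNReal.ofReal (s ^ (-q₀)) * varModular q fun x => f x / t := by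
  have hs0 : 0 < s := by linarith
  rw [varModular, varModular, ← lintegral_const_mul' _ _ ENNReal.ofReal_ne_top]
  refine lintegral_mono fun x => ?_
  rw [← ENNReal.ofReal_mul (by positivity)]
  refine ENNReal.ofReal_le_ofReal ?_
  have h : |f x / (s * t)| = s⁻¹ * |f x / t| := by
    rw [abs_div, abs_div, abs_mul, abs_of_pos hs0]
    field_simp
  rw [h, Real.mul_rpow (by positivity) (abs_nonneg _), Real.rpow_neg hs0.le,
    ← Real.inv_rpow hs0.le]
  exact mul_le_mul_of_nonneg_right (Real.rpow_le_rpow_of_exponent_ge (by positivity)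
    (inv_le_one_of_one_le₀ hs) (hq x)) (by positivity)

lemma le_varNorm (hq₀ : 0 < q₀) (hq : ∀ x, q₀ ≤ q x) {t : ℝ} (ht : 0 < t)
    (h : 1 ≤ varModular q (fun x => f x / t)) : ENNReal.ofReal t ≤ varNorm q f := by
  refine le_iInf fun u => le_iInf fun hu => le_iInf fun hmod => ?_
  by_contra! hlt
  have hut : u < t := (ENNReal.ofReal_lt_ofReal_iff ht).1 hlt
  have h1 := varModular_div_mul_le (f := f) hq (s := t / u) (t := u)
    ((one_le_div hu).2 hut.le) hu
  rw [div_mul_cancel₀ _ hu.ne'] at h1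
  have h2 : ENNReal.ofReal ((t / u) ^ (-q₀)) < 1 := by
    rw [ENNReal.ofReal_lt_one]
    exact Real.rpow_lt_one_of_one_lt_of_neg ((one_lt_div hu).2 hut) (by linarith)
  have h3 : varModular q (fun x => f x / t) ≤ ENNReal.ofReal ((t / u) ^ (-q₀)) :=
    h1.trans (mul_le_of_le_one_right' hmod)
  exact absurd (h.trans h3) (not_le.2 h2)

open Filter Topology in
lemma ENNReal.le_of_forall_one_lt_le_rpow_mul {X Y : ℝ≥0∞} (hY : Y ≠ ∞)
    (h : ∀ s : ℝ, 1 < s → X ≤ ENNReal.ofReal (s ^ R) * Y) : X ≤ Y := by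
  have hlim : Tendsto (fun s : ℝ => ENNReal.ofReal (s ^ R) * Y) (𝓝[>] 1) (𝓝 (1 * Y)) := by
    refine ENNReal.Tendsto.mul_const ?_ (Or.inr hY)
    have h1 : ContinuousAt (fun s : ℝ => ENNReal.ofReal (s ^ R)) 1 :=
      ENNReal.continuous_ofReal.continuousAt.comp
        (Real.continuousAt_rpow_const 1 R (Or.inl one_ne_zero))
    have := h1.tendsto
    rw [Real.one_rpow, ENNReal.ofReal_one] at this
    exact this.mono_left nhdsWithin_le_nhds
  rw [one_mul] at hlim
  exact ge_of_tendsto hlim (eventually_mem_nhdsWithin.mono fun s hs => h s hs)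

/-- A bounded exponent makes rescaling by s change the modular by at most s^R, so it cannot jump at
the norm; letting s decrease to 1 gives both inequalities. -/
lemma varModular_div_varNorm (hq : ∀ x, 0 ≤ q x) (hR : ∀ x, q x ≤ R) {t : ℝ} (ht : 0 < t)
    (h : varNorm q f = ENNReal.ofReal t) : varModular q (fun x => f x / t) = 1 := by
  have hle : varModular q (fun x => f x / t) ≤ 1 := by
    refine ENNReal.le_of_forall_one_lt_le_rpow_mul (R := R) ENNReal.one_ne_top fun s hs => ?_
    have hst : t < s * t := lt_mul_of_one_lt_left ht hs
    have h1 : varNorm q f < ENNReal.ofReal (s * t) := by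
      rw [h]; exact (ENNReal.ofReal_lt_ofReal_iff (ht.trans hst)).2 hst
    rw [varNorm] at h1
    simp only [iInf_lt_iff] at h1
    obtain ⟨u, hu, hmod, hlt⟩ := h1
    have hus : u ≤ s * t := ((ENNReal.ofReal_lt_ofReal_iff (ht.trans hst)).1 hlt).le
    refine (varModular_div_le_mul hR hs.le ht).trans ?_
    gcongr
    exact (varModular_div_mono hq hu hus).trans hmod
  refine le_antisymm hle ?_
  refine ENNReal.le_of_forall_one_lt_le_rpow_mul (R := R) (hle.trans_lt ENNReal.one_lt_top).ne
    fun s hs => ?_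
  have hs0 : 0 < s := by linarith
  have hu : 0 < t / s := by positivity
  have h1 : 1 < varModular q (fun x => f x / (t / s)) := by
    by_contra! hmod
    have := varNorm_le hu hmod
    rw [h, ENNReal.ofReal_le_ofReal_iff hu.le] at this
    exact absurd this (not_le.2 (div_lt_self ht hs))
  have h2 := varModular_div_le_mul (f := f) hR hs.le hu
  rw [mul_div_cancel₀ _ hs0.ne'] at h2
  exact h1.le.trans h2

open Filter Topology in
-- With norm zero every multiple of f has modular at most 1, so the modular of f is at most s^(-q₀)
-- for all s ≥ 1, hence zero.
lemma varNorm_ne_zero (hq₀ : 0 < q₀) (hq : ∀ x, q₀ ≤ q x) (hqm : Measurable q)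
    (hf : Measurable f) (hf0 : ¬ f =ᵐ[volume] 0) : varNorm q f ≠ 0 := by
  intro h0
  have hq0 : ∀ x, 0 ≤ q x := fun x => hq₀.le.trans (hq x)
  have hmod : ∀ t : ℝ, 0 < t → varModular q (fun x => f x / t) ≤ 1 := by
    intro t ht
    have h1 : varNorm q f < ENNReal.ofReal t := by rw [h0]; simpa using ht
    rw [varNorm] at h1
    simp only [iInf_lt_iff] at h1
    obtain ⟨u, hu, hmod, hlt⟩ := h1
    exact (varModular_div_mono hq0 hu ((ENNReal.ofReal_lt_ofReal_iff ht).1 hlt).le).trans hmod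
  have hle : ∀ s : ℝ, 1 ≤ s → varModular q (fun x => f x / 1) ≤ ENNReal.ofReal (s ^ (-q₀)) := by
    intro s hs
    have hs0 : 0 < s := by linarith
    have := varModular_div_mul_le (f := f) hq hs (t := s⁻¹) (by positivity)
    rw [mul_inv_cancel₀ hs0.ne'] at this
    exact this.trans (mul_le_of_le_one_right' (hmod _ (by positivity)))
  have hlim : Tendsto (fun s : ℝ => ENNReal.ofReal (s ^ (-q₀))) atTop (𝓝 0) := by
    simpa using ENNReal.tendsto_ofReal (tendsto_rpow_neg_atTop hq₀)
  have hzero : varModular q (fun x => f x / 1) = 0 := le_antisymm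
    (ge_of_tendsto hlim ((eventually_ge_atTop 1).mono hle)) bot_le
  have hm : Measurable fun x => ENNReal.ofReal (|f x / 1| ^ q x) :=
    ((hf.div_const 1).norm.pow hqm).ennreal_ofReal
  rw [varModular, lintegral_eq_zero_iff hm] at hzero
  refine hf0 (hzero.mono fun x hx => ?_)
  simp only [div_one, Pi.zero_apply, ENNReal.ofReal_eq_zero] at hx ⊢
  by_contra hne
  exact absurd hx (not_le.2 (Real.rpow_pos_of_pos (abs_pos.2 hne) _))

lemma varModular_indicator_div (hq : ∀ x, 0 < q x) (hf : ∀ x, 0 ≤ f x)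
    {s : Set (EuclideanSpace ℝ (Fin n))} (hs : MeasurableSet s) {t : ℝ} (ht : 0 < t) :
    varModular q (fun x => s.indicator f x / t) =
      ∫⁻ x in s, ENNReal.ofReal ((f x / t) ^ q x) := by
  rw [varModular, ← lintegral_indicator hs]
  refine lintegral_congr fun x => ?_
  by_cases hx : x ∈ s
  · rw [indicator_of_mem hx, indicator_of_mem hx, abs_of_nonneg (div_nonneg (hf x) ht.le)]
  · rw [indicator_of_notMem hx, indicator_of_notMem hx, zero_div, abs_zero,
      Real.zero_rpow (hq x).ne', ENNReal.ofReal_zero]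

lemma varNorm_indicator_one_ne_top (hq₀ : 0 < q₀) (hq : ∀ x, q₀ ≤ q x)
    {c : (Fin n → ℝ) × ℝ} (hc : 0 < c.2) :
    varNorm q ((boxSet c).indicator fun _ => 1) ≠ ∞ := by
  set s := max 1 ((c.2 ^ n) ^ (1 / q₀)) with hs
  have hs1 : 1 ≤ s := le_max_left _ _
  have hs0 : 0 < s := by linarith
  have hpow : c.2 ^ n ≤ s ^ q₀ := by
    calc c.2 ^ n = ((c.2 ^ n) ^ (1 / q₀)) ^ q₀ := by
          rw [← Real.rpow_mul (by positivity), one_div_mul_cancel hq₀.ne', Real.rpow_one]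
      _ ≤ s ^ q₀ := Real.rpow_le_rpow (by positivity) (le_max_right _ _) hq₀.le
  refine ((varNorm_le hs0 ?_).trans_lt ENNReal.ofReal_lt_top).ne
  have h := varModular_div_mul_le (f := (boxSet c).indicator fun _ => (1 : ℝ)) hq hs1 one_pos
  rw [varModular_indicator_div (fun x => hq₀.trans_le (hq x)) (fun _ => zero_le_one)
    (measurableSet_boxSet c) one_pos, mul_one] at h
  refine h.trans ?_
  simp only [div_one, Real.one_rpow, ENNReal.ofReal_one, lintegral_const, one_mul,
    Measure.restrict_apply_univ, volume_boxSet c hc]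
  rw [← ENNReal.ofReal_mul (by positivity), ENNReal.ofReal_le_one, Real.rpow_neg hs0.le,
    inv_mul_le_one₀ (by positivity)]
  exact hpow

lemma varNorm_congr {g : EuclideanSpace ℝ (Fin n) → ℝ} (h : f =ᵐ[volume] g) :
    varNorm q f = varNorm q g := by
  have : ∀ t : ℝ, varModular q (fun x => f x / t) = varModular q fun x => g x / t := fun t =>
    lintegral_congr_ae (h.mono fun x hx => by simp only [hx])
  simp only [varNorm, this]

lemma varAverage_congr_set {s t : Set (EuclideanSpace ℝ (Fin n))} (h : s =ᵐ[volume] t) :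
    varAverage q f s = varAverage q f t := by
  rw [varAverage, varAverage, varNorm_congr (indicator_ae_eq_of_ae_eq_set h),
    varNorm_congr (indicator_ae_eq_of_ae_eq_set h)]

end Norm

/-! ### Reduction to half-open cubes and the weight condition -/

lemma isCube_boxSet {n : ℕ} {c : (Fin n → ℝ) × ℝ} (hc : 0 < c.2) : IsCube (boxSet c) :=
  ⟨c.1, c.2, fun i => Ico (c.1 i) (c.1 i + c.2), hc,
    fun _ => ⟨Ioo_subset_Ico_self, Ico_subset_Icc_self⟩, rfl⟩

lemma IsCube.exists_ae_eq_boxSet {n : ℕ} {Q : Set (EuclideanSpace ℝ (Fin n))} (hQ : IsCube Q) :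
    ∃ c : (Fin n → ℝ) × ℝ, 0 < c.2 ∧ Q =ᵐ[volume] boxSet c := by
  obtain ⟨a, l, I, hl, hI, rfl⟩ := hQ
  refine ⟨(a, l), hl, ?_⟩
  have hsub : ∀ i, I i =ᵐ[volume] Ico (a i) (a i + l) := by
    intro i
    have h1 : Ico (a i) (a i + l) =ᵐ[volume] Icc (a i) (a i + l) := Ico_ae_eq_Icc
    have h2 : Ioo (a i) (a i + l) =ᵐ[volume] Icc (a i) (a i + l) := Ioo_ae_eq_Icc
    refine Filter.EventuallyEq.trans ?_ h1.symm
    refine Filter.EventuallyLE.antisymm (LE.le.eventuallyLE (hI i).2) ?_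
    exact h2.symm.le.trans (LE.le.eventuallyLE (hI i).1)
  have hpi : (Set.univ.pi I : Set (Fin n → ℝ)) =ᵐ[volume]
      Set.univ.pi fun i => Ico (a i) (a i + l) := Measure.ae_eq_set_pi fun i _ => hsub i
  have hpre := (PiLp.volume_preserving_ofLp (Fin n)).quasiMeasurePreserving.preimage_ae_eq hpi
  have e1 : (WithLp.ofLp ⁻¹' (Set.univ.pi I) : Set (EuclideanSpace ℝ (Fin n))) =
      {x | ∀ i, x i ∈ I i} := by ext x; simp
  have e2 : (WithLp.ofLp ⁻¹' (Set.univ.pi fun i => Ico (a i) (a i + l)) :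
      Set (EuclideanSpace ℝ (Fin n))) = boxSet (a, l) := by ext x; simp [boxSet]
  rwa [e1, e2] at hpre

section Weight

variable {n : ℕ} {p w : EuclideanSpace ℝ (Fin n) → ℝ} {p₀ P L pinf Cinf : ℝ}

lemma ExponentBounds.isBoxNorm (hp : ExponentBounds p p₀ P L pinf Cinf) (hw : Measurable w)
    (hnn : ∀ x, 0 ≤ w x) (hpos : ∀ᵐ x, 0 < w x)
    (hfin : ∀ c : (Fin n → ℝ) × ℝ, 0 < c.2 → varNorm p ((boxSet c).indicator w) ≠ ∞) :
    IsBoxNorm p w fun c => (varNorm p ((boxSet c).indicator w)).toReal := by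
  intro c hc
  have hne : varNorm p ((boxSet c).indicator w) ≠ 0 := by
    refine varNorm_ne_zero hp.p₀_pos hp.lower hp.measurable
      (hw.indicator (measurableSet_boxSet c)) fun h0 => ?_
    have hnull : volume (boxSet c) = 0 := by
      rw [measure_eq_zero_iff_ae_notMem]
      filter_upwards [h0, hpos] with x hx hx' hxc
      rw [indicator_of_mem hxc, Pi.zero_apply] at hx
      exact hx'.ne' hx
    rw [volume_boxSet c hc, ENNReal.ofReal_eq_zero] at hnull
    exact absurd hnull (not_le.2 (by positivity))
  have hN := ENNReal.toReal_pos hne (hfin c hc)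
  refine ⟨hN, ?_⟩
  have h1 := varModular_div_varNorm (fun x => (hp.pos x).le) hp.upper hN
    (ENNReal.ofReal_toReal (hfin c hc)).symm
  rw [varModular_indicator_div hp.pos hnn (measurableSet_boxSet c) hN] at h1
  rw [integral_eq_lintegral_of_nonneg_ae (Filter.Eventually.of_forall fun x =>
    Real.rpow_nonneg (div_nonneg (hnn x) hN.le) _)
    ((hw.div_const _).pow hp.measurable).aestronglyMeasurable, h1, ENNReal.toReal_one]

lemma ExponentBounds.isBoxNorm_one (hp : ExponentBounds p p₀ P L pinf Cinf) :
    IsBoxNorm p (fun _ => 1)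
      fun c => (varNorm p ((boxSet c).indicator fun _ => (1 : ℝ))).toReal :=
  hp.isBoxNorm measurable_const (fun _ => zero_le_one)
    (Filter.Eventually.of_forall fun _ => one_pos)
    fun _ hc => varNorm_indicator_one_ne_top hp.p₀_pos hp.lower hc

/-- The exponential mean is never zero, its default value being ∞, so an infinite norm would make
the weight constant infinite. -/
lemma IsApInfty.varNorm_ne_top (hp : ExponentBounds p p₀ P L pinf Cinf) (hw : IsApInfty p w)
    {c : (Fin n → ℝ) × ℝ} (hc : 0 < c.2) : varNorm p ((boxSet c).indicator w) ≠ ∞ := by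
  intro htop
  have h1 : varAverage p w (boxSet c) * expMeanLogInv w (boxSet c) ≤ apInftyConst p w :=
    le_iSup₂_of_le (boxSet c) (isCube_boxSet hc) le_rfl
  have h2 : expMeanLogInv w (boxSet c) ≠ 0 := by
    unfold expMeanLogInv
    split_ifs
    · simpa using Real.exp_pos _
    · exact ENNReal.top_ne_zero
  have h3 : varAverage p w (boxSet c) = ∞ := by
    rw [varAverage, htop]
    exact ENNReal.top_div_of_ne_top (varNorm_indicator_one_ne_top hp.p₀_pos hp.lower hc)
  rw [h3, ENNReal.top_mul h2] at h1
  exact (h1.trans_lt hw.const_lt_top).ne rfl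

lemma IsApInfty.varAverage_eq (hp : ExponentBounds p p₀ P L pinf Cinf) (hw : IsApInfty p w)
    {c : (Fin n → ℝ) × ℝ} (hc : 0 < c.2) :
    varAverage p w (boxSet c) = ENNReal.ofReal ((varNorm p ((boxSet c).indicator w)).toReal /
      (varNorm p ((boxSet c).indicator fun _ => (1 : ℝ))).toReal) := by
  rw [ENNReal.ofReal_div_of_pos (hp.isBoxNorm_one c hc).1,
    ENNReal.ofReal_toReal (hw.varNorm_ne_top hp hc),
    ENNReal.ofReal_toReal (varNorm_indicator_one_ne_top hp.p₀_pos hp.lower hc), varAverage]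

/-- The quantitative content of membership in `𝒜_{p(·),∞}` on half-open cubes. -/
lemma IsApInfty.weightBounds (hp : ExponentBounds p p₀ P L pinf Cinf) (hw : IsApInfty p w) :
    0 < (apInftyConst p w).toReal ∧
    WeightBounds p w (Real.log (apInftyConst p w).toReal)
      (fun c => (varNorm p ((boxSet c).indicator w)).toReal)
      (fun c => (varNorm p ((boxSet c).indicator fun _ => (1 : ℝ))).toReal) := by
  have hwt := hw.isWeight
  have hN := hp.isBoxNorm hwt.measurable hwt.nonneg hwt.pos_ae fun c hc => hw.varNorm_ne_top hp hc
  have hS := hp.isBoxNorm_one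
  set N : (Fin n → ℝ) × ℝ → ℝ := fun c => (varNorm p ((boxSet c).indicator w)).toReal with hNdef
  set S : (Fin n → ℝ) × ℝ → ℝ :=
    fun c => (varNorm p ((boxSet c).indicator fun _ => (1 : ℝ))).toReal with hSdef
  have key : ∀ c : (Fin n → ℝ) × ℝ, 0 < c.2 →
      IntegrableOn (fun x => Real.log (w x)) (boxSet c) ∧
      N c / S c * Real.exp (-boxMean (fun x => Real.log (w x)) c) ≤
        (apInftyConst p w).toReal := by
    intro c hc
    have hlam : 0 < N c / S c := div_pos (hN c hc).1 (hS c hc).1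
    have h1 : varAverage p w (boxSet c) * expMeanLogInv w (boxSet c) ≤ apInftyConst p w :=
      le_iSup₂_of_le (boxSet c) (isCube_boxSet hc) le_rfl
    rw [hw.varAverage_eq hp hc] at h1
    by_cases hint : IntegrableOn (fun y => Real.log (w y)⁻¹) (boxSet c) volume
    · have hint' : IntegrableOn (fun x => Real.log (w x)) (boxSet c) := by
        have := hint.neg
        simpa [Real.log_inv] using this
      refine ⟨hint', ?_⟩
      rw [expMeanLogInv, if_pos hint, ← ENNReal.ofReal_mul hlam.le,
        ENNReal.ofReal_le_iff_le_toReal hw.const_lt_top.ne] at h1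
      have h2 : ⨍ y in boxSet c, Real.log (w y)⁻¹ = -boxMean (fun x => Real.log (w x)) c := by
        rw [← boxMean_eq_average _ hc, boxMean, boxMean]
        simp only [Real.log_inv, integral_neg, mul_neg]
      rwa [h2] at h1
    -- Without integrability the exponential mean is ∞ while the average is positive, contradicting
    -- a finite weight constant.
    · rw [expMeanLogInv, if_neg hint, ENNReal.mul_top (by simpa using hlam)] at h1
      exact absurd (h1.trans_lt hw.const_lt_top) (lt_irrefl _)
  have hpos : 0 < (apInftyConst p w).toReal := by
    have hc : (0 : ℝ) < ((0, 1) : (Fin n → ℝ) × ℝ).2 := one_pos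
    have := div_pos (hN _ hc).1 (hS _ hc).1
    exact (by positivity : (0 : ℝ) < _ * _).trans_le (key _ hc).2
  refine ⟨hpos, hwt.measurable, hwt.nonneg, hwt.pos_ae, hN, hS, fun c hc => (key c hc).1,
    fun c hc => ?_⟩
  have h1 := (hN c hc).1
  have h2 := (hS c hc).1
  have h3 := Real.log_le_log (by positivity) (key c hc).2
  rw [Real.log_mul (by positivity) (by positivity), Real.log_exp,
    Real.log_div h1.ne' h2.ne'] at h3
  linarith

/-- A modular reverse Hölder inequality on a cube gives one for normalised local norms. -/
lemma WeightBounds.varAverage_le {κ K r : ℝ} {N S : (Fin n → ℝ) × ℝ → ℝ}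
    (hw : WeightBounds p w κ N S) (hp : ExponentBounds p p₀ P L pinf Cinf) (hr : 1 ≤ r)
    (hK : 1 ≤ K) {c : (Fin n → ℝ) × ℝ} (hc : 0 < c.2)
    (h : ∫⁻ x in boxSet c, ENNReal.ofReal ((w x / (N c / S c)) ^ (r * p x) * (1 / S c) ^ p x) ≤
      ENNReal.ofReal K) :
    varAverage (fun x => r * p x) w (boxSet c) ≤
      ENNReal.ofReal (K ^ (1 / p₀) * (N c / S c)) := by
  have hr0 : 0 < r := by linarith
  have hN := hw.norm_pos hc
  have hS := hw.norm_one_pos hc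
  have hp0 := hp.p₀_pos
  have hqpos : ∀ x, 0 < r * p x := fun x => mul_pos hr0 (hp.pos x)
  have hqlow : ∀ x, p₀ ≤ r * p x := fun x => by nlinarith [hp.lower x]
  -- Chosen so that (1/t)^(r p) = (1/S)^p, which makes t the norm of the indicator for the exponent
  -- r p; only the lower bound is needed.
  set t := S c ^ (1 / r) with ht
  have ht0 : 0 < t := by positivity
  have htr : ∀ x, (1 / t) ^ (r * p x) = (1 / S c) ^ p x := by
    intro x
    rw [Real.rpow_mul (by positivity), one_div, Real.inv_rpow ht0.le, ht,
      ← Real.rpow_mul hS.le, one_div_mul_cancel hr0.ne', Real.rpow_one, one_div]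
  have hone : ENNReal.ofReal t ≤
      varNorm (fun x => r * p x) ((boxSet c).indicator fun _ => (1 : ℝ)) := by
    refine le_varNorm hp0 hqlow ht0 ?_
    rw [varModular_indicator_div hqpos (fun _ => zero_le_one) (measurableSet_boxSet c) ht0]
    simp only [htr]
    rw [← ofReal_integral_eq_lintegral_ofReal (hw.isBoxNorm_one.integrableOn hc)
      (Filter.Eventually.of_forall fun x => by positivity), (hw.isBoxNorm_one c hc).2,
      ENNReal.ofReal_one]
  -- Dividing by a further M lowers the modular by at least the factor M^(-p₀) = 1/K, because r p ≥
  -- p₀.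
  set M := K ^ (1 / p₀) with hM
  have hM1 : 1 ≤ M := Real.one_le_rpow hK (by positivity)
  have hM0 : 0 < M := by linarith
  have hwn : varNorm (fun x => r * p x) ((boxSet c).indicator w) ≤
      ENNReal.ofReal (M * (N c / S c * t)) := by
    refine varNorm_le (by positivity) ?_
    refine (varModular_div_mul_le hqlow hM1 (by positivity)).trans ?_
    rw [varModular_indicator_div hqpos hw.nonneg (measurableSet_boxSet c) (by positivity)]
    have hpt : ∀ x, (w x / (N c / S c * t)) ^ (r * p x) =
        (w x / (N c / S c)) ^ (r * p x) * (1 / S c) ^ p x := by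
      intro x
      rw [← htr, ← Real.mul_rpow (div_nonneg (hw.nonneg x) (by positivity)) (by positivity)]
      congr 1
      field_simp
    simp only [hpt]
    have hMp : M ^ (-p₀) = K⁻¹ := by
      rw [hM, ← Real.rpow_mul (by linarith), one_div, mul_neg, inv_mul_cancel₀ hp0.ne',
        Real.rpow_neg_one]
    calc ENNReal.ofReal (M ^ (-p₀)) * ∫⁻ x in boxSet c,
          ENNReal.ofReal ((w x / (N c / S c)) ^ (r * p x) * (1 / S c) ^ p x)
        ≤ ENNReal.ofReal (M ^ (-p₀)) * ENNReal.ofReal K := by gcongr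
      _ = 1 := by
        rw [← ENNReal.ofReal_mul (by positivity), hMp, inv_mul_cancel₀ (by linarith),
          ENNReal.ofReal_one]
  calc varAverage (fun x => r * p x) w (boxSet c)
      ≤ ENNReal.ofReal (M * (N c / S c * t)) / ENNReal.ofReal t := ENNReal.div_le_div hwn hone
    _ = ENNReal.ofReal (M * (N c / S c)) := by
        rw [← ENNReal.ofReal_div_of_pos ht0]
        congr 1
        field_simp

end Weight

/-! ### Choice of the constants -/

theorem theorem2p30 (n : ℕ) (hn : 1 ≤ n) (pminus pplus pinf C₀ Cinf : ℝ) :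
    ∃ C C₁ C₂ A A₁ : ℝ, 0 < C ∧ 0 < C₁ ∧ 0 < C₂ ∧ 0 < A ∧ 0 < A₁ ∧
      ∀ p : EuclideanSpace ℝ (Fin n) → ℝ,
        IsExponentP0 p → IsLogHolder p C₀ pinf Cinf →
        essInf p volume = pminus → essSup p volume = pplus →
        ∀ w : EuclideanSpace ℝ (Fin n) → ℝ, IsApInfty p w →
        ∀ r : ℝ, 1 < r →
          r ≤ 1 + 1 / (C₁ * (apInftyConst p w).toReal ^ A₁ *
            (2 : ℝ) ^ (C₂ * (apInftyConst p w).toReal)) →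
        ∀ Q : Set (EuclideanSpace ℝ (Fin n)), IsCube Q →
          varAverage (fun x => r * p x) w Q
            ≤ ENNReal.ofReal (C * (apInftyConst p w).toReal ^ A) * varAverage p w Q := by
  have hn0 : n ≠ 0 := Nat.one_le_iff_ne_zero.1 hn
  by_cases hpar : 0 < pminus ∧ 0 < pinf ∧ 0 < Cinf
  swap
  -- No exponent satisfies the hypotheses with such parameters, so any constants serve.
  · refine ⟨1, 1, 1, 1, 1, one_pos, one_pos, one_pos, one_pos, one_pos, ?_⟩
    intro p hp hlog hmin
    exact absurd ⟨hmin ▸ hp.essInf_pos, hlog.pinf_pos, hlog.Cinf_pos⟩ hpar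
  obtain ⟨hpm, hpi, hCi⟩ := hpar
  obtain ⟨K, a, B, hK, hmain⟩ := exists_reverseHolder_modular hn0 (P := pinf + Cinf)
    (L := oscConst n C₀ Cinf) (pinf := pinf) hpm hCi.le
  -- The upper bound pinf + Cinf of p plays the role of P. C₁ and A₁ reproduce the condition
  -- δ·e^(2Pκ + a) ≤ 1 with κ = log [w]. Since κ ≥ -B, e^B·[w] ≥ 1, which permits A = 1; C₂ may be
  -- any positive number because 2^(C₂[w]) ≥ 1.
  refine ⟨K ^ (1 / pminus) * Real.exp B, Real.exp a, 1, 1, 2 * (pinf + Cinf), by positivity,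
    Real.exp_pos a, one_pos, one_pos, by positivity, ?_⟩
  intro p hpe hlog hmin _ w hw r hr1 hr Q hQ
  have hp : ExponentBounds p pminus (pinf + Cinf) (oscConst n C₀ Cinf) pinf Cinf :=
    hmin ▸ hlog.exponentBounds hn0 hpe
  obtain ⟨hW, hwb⟩ := hw.weightBounds hp
  obtain ⟨hB, hrh⟩ := hmain p w _ _ _ hp hwb
  set W := (apInftyConst p w).toReal with hWdef
  obtain ⟨c, hc, hQc⟩ := hQ.exists_ae_eq_boxSet
  rw [varAverage_congr_set hQc, varAverage_congr_set hQc]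
  have hδ : (r - 1) * Real.exp (2 * (pinf + Cinf) * Real.log W + a) ≤ 1 := by
    have hexp : Real.exp (2 * (pinf + Cinf) * Real.log W + a) =
        Real.exp a * W ^ (2 * (pinf + Cinf)) := by
      rw [Real.exp_add, Real.rpow_def_of_pos hW]; ring_nf
    have h2 : (1 : ℝ) ≤ 2 ^ (1 * W) := Real.one_le_rpow one_le_two (by linarith)
    have h3 : 0 < Real.exp a * W ^ (2 * (pinf + Cinf)) := by positivity
    have h4 : r - 1 ≤ 1 / (Real.exp a * W ^ (2 * (pinf + Cinf)) * 2 ^ (1 * W)) := by linarith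
    rw [le_div_iff₀ (by positivity)] at h4
    rw [hexp]
    refine le_trans ?_ h4
    exact mul_le_mul_of_nonneg_left (le_mul_of_one_le_right h3.le h2) (by linarith)
  have h := hrh (r - 1) (by linarith) hδ c hc
  rw [add_sub_cancel] at h
  refine (hwb.varAverage_le hp hr1.le hK hc h).trans ?_
  have hlam := div_pos (hwb.norm_pos hc) (hwb.norm_one_pos hc)
  rw [hw.varAverage_eq hp hc, ← ENNReal.ofReal_mul (by positivity), Real.rpow_one]
  refine ENNReal.ofReal_le_ofReal (mul_le_mul_of_nonneg_right ?_ hlam.le)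
  rw [mul_assoc]
  refine le_mul_of_one_le_right (by positivity) ?_
  have : Real.exp B * W = Real.exp (B + Real.log W) := by rw [Real.exp_add, Real.exp_log hW]
  rw [this]
  exact Real.one_le_exp (by linarith)
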